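/- **Setting.** Write $\log(x):=\max(\ln x,1)$. A bandit instance consists of $n$ distributions $\nu_1,\dots,\nu_n$ on $\mathbb R$ that are $1$-sub-Gaussian around their means $\mu_1\ge\mu_2\ge\dots\ge\mu_n$, where $\mu_0,\mu_1,\dots,\mu_n\in[0,1]$ and $\mu_0$ is a given threshold. Let $\mathcal H_1=\{i:\mu_i>\mu_0\}$, $\mathcal H_0=\{i:\mu_i\le\mu_0\}$, $m=|\mathcal H_1|$, $\Delta_{i,j}=\mu_i-\mu_j$, $\Delta_{j,0}=\mu_j-\mu_0$ and $\Delta_{i\vee j,0}:=\max(\Delta_{i,0},\Delta_{j,0})$. Put $U(T,\alpha)=c\sqrt{\tfrac1T\log(\log(T)/\alpha)}$ for $T\ge1$, where $c$ is a sufficiently large universal constant. **Algorithm.** Let $\delta_r=\delta/r^2$, $\delta'_r=\delta_r/(6.4\log(36/\delta_r))$, $M_r=\min(n,2^r)$, $\ell=0$, $R_0=0$, $\mathcal S_0=\mathcal S_1=\emptyset$. In round $t=1,2,\dots$: (1) if $t\ge 2^{\ell}\ell$, draw a bracket $A_{\ell+1}$ uniformly at random from the $M_{\ell+1}$-element subsets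 of $[n]$ (independently of everything else) and increase $\ell$ by one; (2) set $R_t=1+R_{t-1}\mathbf 1\{R_{t-1}<\ell\}$, and write $r=R_t$; (3) if some arm of $A_r\setminus\mathcal S_t$ has not yet been pulled in bracket $r$, pull such an arm $I_t$; otherwise pull an arm $I_t$ that maximizes $\widehat\mu_{i,r,T_{i,r}}+U(T_{i,r},\delta)$ over $i\in A_r\setminus\mathcal S_t$ (ties are broken arbitrarily; nothing is pulled if $A_r\setminus\mathcal S_t=\emptyset$). Here $T_{i,r}$ is the number of pulls of arm $i$ in bracket $r$ so far and $\widehat\mu_{i,r,T}$ is the mean of its first $T$ observations in this bracket; the observations of arm $i$ are i.i.d. with law $\nu_i$, all observations are independent, and they are not shared between brackets; (4) with the counts updated by this pull, let $s(p)=\{i\in A_r: T_{i,r}\ge1,\ \widehat\mu_{i,r,T_{i,r}}-U(T_{i,r},\tfrac{p}{|A_r|}\delta'_r)\ge\mu_0\}$ for $1\le p\le|A_r|$ and set $\mathcal S_{t+1}=\mathcal S_t\cup s(\widehat p)$ with $\widehat p=\max\{p:|s(p)|\ge p\}$ ($\mathcal S_{t+1}=\mathcal S_t$ if there is no such $p$).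 Let $\mathcal F_t$ be generated by the pulled arms $I_s$, the observed rewards and the sets $\mathcal S_{s+1}$, $1\le s\le t$. **Complexities.** For $1\le k\le m$ and $j\in[m]$ let $$\mathrm H_{\mathrm{FDR}}(\mu_0;j)=\frac kj\Big(\sum_{i=1}^m\Delta_{i\vee j,0}^{-2}\log\big(\tfrac{nk}{j\delta}\log(\Delta_{i\vee j,0}^{-2})\big)+\sum_{i=m+1}^n\Delta_{j,i}^{-2}\log\big(\tfrac{\log(\Delta_{j,i}^{-2})}{\delta}\big)\Big),$$ $$\widetilde{\mathrm H}_{\mathrm{FDR}}(\mu_0;j)=\frac nj k\,\Delta_{j,0}^{-2}\log\big(\log(\tfrac njk)\log(\Delta_{j,0}^{-2})/\delta\big).$$ **Theorem.** There is a universal constant $c_0>0$ such that for every $c\ge c_0$ there is a constant $C>0$, depending on $c$ only, for which the following holds for every instance as above, every $0<\delta\le0.025$ and every run of the algorithm. For all $t\in\mathbb N$, $$\mathbb E\Big[\frac{|\mathcal S_t\cap\mathcal H_0|}{|\mathcal S_t|\vee1}\Big]\le2\delta .$$ Moreover, for every $1\le k\le|\mathcal H_1|$ there is a stopping time $\tau_k$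 with respect to $(\mathcal F_t)$ such that $$\mathbb E[\tau_k]\le C\min_{k\le j\le m}\mathrm H_{\mathrm{FDR}}(\mu_0;j)\log\big(\mathrm H_{\mathrm{FDR}}(\mu_0;j)+\Delta_{j,0}^{-2}\big),\qquad \mathbb E[\tau_k]\le C\min_{k\le j\le m}\widetilde{\mathrm H}_{\mathrm{FDR}}(\mu_0;j)\log\big(\widetilde{\mathrm H}_{\mathrm{FDR}}(\mu_0;j)\big),$$ and $\mathbb E[|\mathcal S_t\cap\mathcal H_1|]\ge(1-\delta)k$ for $t\ge\tau_k$, that is: $\mathbb E[|\mathcal S_\sigma\cap\mathcal H_1|]\ge(1-\delta)k$ for every (possibly random) time $\sigma$ with $\sigma\ge\tau_k$ almost surely, and $\mathbb E[|\mathcal S_t\cap\mathcal H_1|\,\mathbf 1\{\tau_k\le t\}]\ge(1-\delta)k\,\mathbb P(\tau_k\le t)$ for every fixed $t\in\mathbb N$. -/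

import Mathlib

open MeasureTheory ProbabilityTheory
open scoped ENNReal NNReal

namespace InfiniteUCB

/-! ### Constants and deterministic schedules of the algorithm -/

/-- The truncated logarithm `log x := max (ln x) 1`. -/
noncomputable def tlog (x : ℝ) : ℝ := max (Real.log x) 1

/-- The anytime confidence width `U(t, δ) = c √((1 / t) log (log t / δ))`, used for `t ≥ 1` only
(an arm without observations is treated separately by the algorithm). -/
noncomputable def width (c : ℝ) (t : ℕ) (δ : ℝ) : ℝ :=
  c * √((1 / (t : ℝ)) * tlog (tlog (t : ℝ) / δ))

/-- `δ_r = δ / r ^ 2`. -/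
noncomputable def bracketLevel (δ : ℝ) (r : ℕ) : ℝ := δ / (r : ℝ) ^ 2

/-- `δ'_r = δ_r / (6.4 log (36 / δ_r))`. -/
noncomputable def bracketLevel' (δ : ℝ) (r : ℕ) : ℝ :=
  bracketLevel δ r / (6.4 * tlog (36 / bracketLevel δ r))

/-- `M_r = min n (2 ^ r)`, the number of arms of bracket `r`. -/
def bracketSize (n r : ℕ) : ℕ := min n (2 ^ r)

/-- The number `ℓ` of open brackets during round `t` (rounds are numbered from `1`): at the
beginning of round `t`, a new bracket is opened if `t ≥ 2 ^ ℓ * ℓ`. -/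
def numOpen : ℕ → ℕ
  | 0 => 0
  | t + 1 => if 2 ^ numOpen t * numOpen t ≤ t + 1 then numOpen t + 1 else numOpen t

/-- The bracket `R_t` that is used in round `t`, with `R_0 = 0`. -/
def current : ℕ → ℕ
  | 0 => 0
  | t + 1 => 1 + if current t < numOpen (t + 1) then current t else 0

/-! ### The algorithm along one realization

`x i r s` is the observation (number `s + 1`) that the arm `i` produces when it is pulled for the
`(s + 1)`-st time in bracket `r`; `A r` is the set of arms of bracket `r ≥ 1`; `a t` is the arm that
is pulled in round `t ≥ 1` (`none` if no arm is left to be pulled in the current bracket). -/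

section Path

variable {n : ℕ}

/-- `T_{i,r}`: the number of pulls of arm `i` in bracket `r` in the rounds `1, …, t`. -/
def pulls (a : ℕ → Option (Fin n)) (i : Fin n) (r t : ℕ) : ℕ :=
  ((Finset.Icc 1 t).filter fun s => current s = r ∧ a s = some i).card

/-- The empirical mean of the first `T` observations of arm `i` in bracket `r`. -/
noncomputable def empMean (x : Fin n → ℕ → ℕ → ℝ) (i : Fin n) (r T : ℕ) : ℝ :=
  (∑ s ∈ Finset.range T, x i r s) / (T : ℝ)

/-- The set `s(p)` of round `t`, computed after the pull of this round: the arms of the current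
bracket whose lower confidence bound at level `(p / |A_r|) δ'_r` is at least `μ₀`. The lower
confidence bound of an arm without observations is `-∞`. -/
noncomputable def levelSet (c δ μ₀ : ℝ) (x : Fin n → ℕ → ℕ → ℝ) (A : ℕ → Finset (Fin n))
    (a : ℕ → Option (Fin n)) (t p : ℕ) : Finset (Fin n) :=
  open Classical in
  (A (current t)).filter fun i =>
    0 < pulls a i (current t) t ∧
      μ₀ ≤ empMean x i (current t) (pulls a i (current t) t) -
        width c (pulls a i (current t) t)
          ((p : ℝ) / ((A (current t)).card : ℝ) * bracketLevel' δ (current t))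

/-- The indices `p ∈ {1, …, |A_r|}` with `|s(p)| ≥ p` in round `t`. -/
noncomputable def levels (c δ μ₀ : ℝ) (x : Fin n → ℕ → ℕ → ℝ) (A : ℕ → Finset (Fin n))
    (a : ℕ → Option (Fin n)) (t : ℕ) : Finset ℕ :=
  (Finset.Icc 1 (A (current t)).card).filter fun p => p ≤ (levelSet c δ μ₀ x A a t p).card

/-- The Benjamini–Hochberg set `s(p̂)` of round `t`, where `p̂` is the largest `p` with
`|s(p)| ≥ p`; it is empty if there is no such `p`. -/
noncomputable def accepted (c δ μ₀ : ℝ) (x : Fin n → ℕ → ℕ → ℝ) (A : ℕ → Finset (Fin n))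
    (a : ℕ → Option (Fin n)) (t : ℕ) : Finset (Fin n) :=
  if h : (levels c δ μ₀ x A a t).Nonempty then
    levelSet c δ μ₀ x A a t ((levels c δ μ₀ x A a t).max' h)
  else ∅

/-- The suggested set `S_t`: it is empty before the first round has been completed
(`S_0 = S_1 = ∅`, as no arm has been pulled by time `0`) and `S_{t+1} = S_t ∪ s(p̂)`. -/
noncomputable def suggested (c δ μ₀ : ℝ) (x : Fin n → ℕ → ℕ → ℝ) (A : ℕ → Finset (Fin n))
    (a : ℕ → Option (Fin n)) : ℕ → Finset (Fin n)
  | 0 => ∅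
  | t + 1 => suggested c δ μ₀ x A a t ∪ accepted c δ μ₀ x A a t

/-- The arms of the current bracket that may still be pulled in round `t`. -/
noncomputable def available (c δ μ₀ : ℝ) (x : Fin n → ℕ → ℕ → ℝ) (A : ℕ → Finset (Fin n))
    (a : ℕ → Option (Fin n)) (t : ℕ) : Finset (Fin n) :=
  A (current t) \ suggested c δ μ₀ x A a t

/-- The available arms that have not been pulled in the current bracket before round `t`. -/
noncomputable def fresh (c δ μ₀ : ℝ) (x : Fin n → ℕ → ℕ → ℝ) (A : ℕ → Finset (Fin n))
    (a : ℕ → Option (Fin n)) (t : ℕ) : Finset (Fin n) :=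
  (available c δ μ₀ x A a t).filter fun i => pulls a i (current t) (t - 1) = 0

/-- The upper confidence bound of arm `i` in the current bracket before the pull of round `t`. -/
noncomputable def ucb (c δ : ℝ) (x : Fin n → ℕ → ℕ → ℝ) (a : ℕ → Option (Fin n)) (t : ℕ)
    (i : Fin n) : ℝ :=
  empMean x i (current t) (pulls a i (current t) (t - 1)) +
    width c (pulls a i (current t) (t - 1)) δ

/-- The arms that the algorithm may pull in round `t`: the fresh arms if there are any, and
otherwise the available arms with the largest upper confidence bound. -/
noncomputable def candidates (c δ μ₀ : ℝ) (x : Fin n → ℕ → ℕ → ℝ) (A : ℕ → Finset (Fin n))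
    (a : ℕ → Option (Fin n)) (t : ℕ) : Finset (Fin n) :=
  open Classical in
  if (fresh c δ μ₀ x A a t).Nonempty then fresh c δ μ₀ x A a t
  else (available c δ μ₀ x A a t).filter fun i =>
    ∀ j ∈ available c δ μ₀ x A a t, ucb c δ x a t j ≤ ucb c δ x a t i

/-- The pulls `a` follow the rule of the algorithm: in every round `t ≥ 1` a candidate is pulled
(ties are broken arbitrarily), and no arm is pulled if no arm is available. -/
def FollowsRule (c δ μ₀ : ℝ) (x : Fin n → ℕ → ℕ → ℝ) (A : ℕ → Finset (Fin n))
    (a : ℕ → Option (Fin n)) : Prop :=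
  ∀ t, 1 ≤ t →
    (available c δ μ₀ x A a t = ∅ ∧ a t = none) ∨
      ∃ i ∈ candidates c δ μ₀ x A a t, a t = some i

/-- The reward that is observed in round `t ≥ 1` (`0` if no arm is pulled). -/
def reward (x : Fin n → ℕ → ℕ → ℝ) (a : ℕ → Option (Fin n)) (t : ℕ) : ℝ :=
  (a t).elim 0 fun i => x i (current t) (pulls a i (current t) (t - 1))

end Path

/-! ### The bandit instance and the random run of the algorithm -/

/-- The mean `μ_i` of the distribution of arm `i`. -/
noncomputable def mean {n : ℕ} (ν : Fin n → Measure ℝ) (i : Fin n) : ℝ := ∫ y, y ∂(ν i)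

/-- `ℋ₁`, the arms with mean above the threshold. -/
noncomputable def H₁ {n : ℕ} (ν : Fin n → Measure ℝ) (μ₀ : ℝ) : Finset (Fin n) :=
  open Classical in Finset.univ.filter fun i => μ₀ < mean ν i

/-- `ℋ₀`, the arms with mean at most the threshold. -/
noncomputable def H₀ {n : ℕ} (ν : Fin n → Measure ℝ) (μ₀ : ℝ) : Finset (Fin n) :=
  open Classical in Finset.univ.filter fun i => mean ν i ≤ μ₀

/-- A run of the algorithm on the bandit instance `ν` over the probability space `(Ω, P)`. -/
structure Run {n : ℕ} (ν : Fin n → Measure ℝ) (c δ μ₀ : ℝ) {Ω : Type*} [MeasurableSpace Ω]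
    (P : Measure Ω) where
  /-- `X i r s` is the observation of the `(s + 1)`-st pull of arm `i` in bracket `r`. -/
  X : Fin n → ℕ → ℕ → Ω → ℝ
  /-- `A r` is the random set of arms of bracket `r`. -/
  A : ℕ → Ω → Finset (Fin n)
  /-- `I t` is the arm that is pulled in round `t`. -/
  I : ℕ → Ω → Option (Fin n)
  measurable_X : ∀ i r s, Measurable (X i r s)
  measurable_A : ∀ r, Measurable (A r)
  measurable_I : ∀ t o, MeasurableSet {ω | I t ω = o}
  /-- Every observation of arm `i` has law `ν i`. -/
  law_X : ∀ i r s, P.map (X i r s) = ν i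
  /-- All observations are independent. -/
  indep_X : iIndepFun (fun (q : Fin n × ℕ × ℕ) (ω : Ω) => X q.1 q.2.1 q.2.2 ω) P
  /-- Bracket `r` is drawn uniformly from the sets of `M_r` arms. -/
  law_A : ∀ r, 1 ≤ r → ∀ B : Finset (Fin n), B.card = bracketSize n r →
    P {ω | A r ω = B} = ((n.choose (bracketSize n r) : ℕ) : ℝ≥0∞)⁻¹
  /-- The brackets are independent. -/
  indep_A : iIndepFun A P
  /-- The brackets are independent of the observations. -/
  indep_X_A : IndepFun (fun (ω : Ω) (q : Fin n × ℕ × ℕ) => X q.1 q.2.1 q.2.2 ω)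
    (fun (ω : Ω) (r : ℕ) => A r ω) P
  /-- The pulls follow the rule of the algorithm. -/
  rule : ∀ ω, FollowsRule c δ μ₀ (fun i r s => X i r s ω) (fun r => A r ω) (fun t => I t ω)

namespace Run

variable {n : ℕ} {ν : Fin n → Measure ℝ} {c δ μ₀ : ℝ} {Ω : Type*} [MeasurableSpace Ω]
  {P : Measure Ω}

/-- The suggested set `S_t` of the run. -/
noncomputable def S (ρ : Run ν c δ μ₀ P) (t : ℕ) (ω : Ω) : Finset (Fin n) :=
  suggested c δ μ₀ (fun i r s => ρ.X i r s ω) (fun r => ρ.A r ω) (fun t => ρ.I t ω) t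

/-- The reward `X_{I_t, t}` that is observed in round `t` of the run. -/
def obs (ρ : Run ν c δ μ₀ P) (t : ℕ) (ω : Ω) : ℝ :=
  reward (fun i r s => ρ.X i r s ω) (fun t => ρ.I t ω) t

theorem measurable_pulls (ρ : Run ν c δ μ₀ P) (i : Fin n) (r t : ℕ) :
    Measurable fun ω => pulls (fun t => ρ.I t ω) i r t := by
  unfold pulls
  simp_rw [Finset.card_filter]
  refine Finset.measurable_sum _ fun s _ => ?_
  refine Measurable.ite ?_ measurable_const measurable_const
  exact (MeasurableSet.const (current s = r)).inter (ρ.measurable_I s (some i))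

theorem measurable_obs_at (ρ : Run ν c δ μ₀ P) (i : Fin n) (r : ℕ) {T : Ω → ℕ}
    (hT : Measurable T) : Measurable fun ω => ρ.X i r (T ω) ω := by
  have h : Measurable fun p : ℕ × Ω => ρ.X i r p.1 p.2 :=
    measurable_from_prod_countable_right fun s => ρ.measurable_X i r s
  exact h.comp (hT.prodMk measurable_id)

theorem measurable_empMean (ρ : Run ν c δ μ₀ P) (i : Fin n) (r : ℕ) {T : Ω → ℕ}
    (hT : Measurable T) :
    Measurable fun ω => empMean (fun i r s => ρ.X i r s ω) i r (T ω) := by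
  have h : Measurable fun p : ℕ × Ω => empMean (fun i r s => ρ.X i r s p.2) i r p.1 := by
    refine measurable_from_prod_countable_right fun s => ?_
    have h1 : Measurable fun ω => ∑ u ∈ Finset.range s, ρ.X i r u ω :=
      Finset.measurable_sum _ fun u _ => ρ.measurable_X i r u
    exact h1.div_const (s : ℝ)
  exact h.comp (hT.prodMk measurable_id)

theorem measurable_comp₂ {α β γ : Type*} [Countable α] [MeasurableSpace α]
    [MeasurableSingletonClass α] [Countable β] [MeasurableSpace β] [MeasurableSingletonClass β]
    [MeasurableSpace γ] (g : α → β → γ) {f₁ : Ω → α} {f₂ : Ω → β} (h₁ : Measurable f₁)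
    (h₂ : Measurable f₂) : Measurable fun ω => g (f₁ ω) (f₂ ω) :=
  (measurable_of_countable fun q : α × β => g q.1 q.2).comp (h₁.prodMk h₂)

theorem measurable_levelSet (ρ : Run ν c δ μ₀ P) (t p : ℕ) :
    Measurable fun ω => levelSet c δ μ₀ (fun i r s => ρ.X i r s ω) (fun r => ρ.A r ω)
      (fun t => ρ.I t ω) t p := by
  refine measurable_finset_iff.2 fun i => ?_
  have hT := ρ.measurable_pulls i (current t) t
  have hA := ρ.measurable_A (current t)
  have h1 : MeasurableSet {ω | 0 < pulls (fun t => ρ.I t ω) i (current t) t} :=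
    measurableSet_lt measurable_const hT
  have h2 := measurableSet_le (measurable_const (a := μ₀))
    ((ρ.measurable_empMean i (current t) hT).sub (measurable_comp₂
      (fun (T : ℕ) (B : Finset (Fin n)) =>
        width c T ((p : ℝ) / (B.card : ℝ) * bracketLevel' δ (current t))) hT hA))
  have h3 : MeasurableSet {ω | i ∈ ρ.A (current t) ω} :=
    measurableSet_setOfPred.2 ((measurable_finset_mem i).comp hA)
  refine measurableSet_setOfPred.1 ?_
  convert h3.inter (h1.inter h2) using 1
  ext ω
  simp [levelSet]

theorem measurable_accepted (ρ : Run ν c δ μ₀ P) (t : ℕ) :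
    Measurable fun ω => accepted c δ μ₀ (fun i r s => ρ.X i r s ω) (fun r => ρ.A r ω)
      (fun t => ρ.I t ω) t := by
  have hlev : ∀ L : Finset ℕ, MeasurableSet {ω | levels c δ μ₀ (fun i r s => ρ.X i r s ω)
      (fun r => ρ.A r ω) (fun t => ρ.I t ω) t = L} := by
    intro L
    simp only [Finset.ext_iff, levels, Finset.mem_filter, Finset.mem_Icc, Set.ofPred_forall]
    refine MeasurableSet.iInter fun p => measurableSet_setOfPred.2 ?_
    refine Measurable.iff (Measurable.and (Measurable.and measurable_const ?_) ?_) measurable_const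
    · exact (measurable_of_countable fun B : Finset (Fin n) => p ≤ B.card).comp
        (ρ.measurable_A (current t))
    · exact (measurable_of_countable fun B : Finset (Fin n) => p ≤ B.card).comp
        (ρ.measurable_levelSet t p)
  rw [measurable_finset_iff]
  intro i
  refine measurableSet_setOfPred.1 ?_
  have : {ω | i ∈ accepted c δ μ₀ (fun i r s => ρ.X i r s ω) (fun r => ρ.A r ω)
      (fun t => ρ.I t ω) t} = ⋃ (L : Finset ℕ) (h : L.Nonempty),
      {ω | levels c δ μ₀ (fun i r s => ρ.X i r s ω)
        (fun r => ρ.A r ω) (fun t => ρ.I t ω) t = L} ∩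
      {ω | i ∈ levelSet c δ μ₀ (fun i r s => ρ.X i r s ω) (fun r => ρ.A r ω)
        (fun t => ρ.I t ω) t (L.max' h)} := by
    ext ω
    simp only [accepted, Set.mem_ofPred_eq, Set.mem_iUnion, Set.mem_inter_iff]
    constructor
    · intro hi
      split_ifs at hi with h
      · exact ⟨_, h, rfl, hi⟩
      · simp at hi
    · rintro ⟨L, h, rfl, hi⟩
      rwa [dif_pos h]
  rw [this]
  exact MeasurableSet.iUnion fun L => MeasurableSet.iUnion fun h => (hlev L).inter
    (measurableSet_setOfPred.2 ((measurable_finset_mem i).comp (ρ.measurable_levelSet t _)))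

theorem measurable_S (ρ : Run ν c δ μ₀ P) (t : ℕ) : Measurable (ρ.S t) := by
  induction t with
  | zero => exact measurable_const
  | succ t ih =>
    exact (measurable_of_countable fun q : Finset (Fin n) × Finset (Fin n) => q.1 ∪ q.2).comp
      (ih.prodMk (ρ.measurable_accepted t))

theorem measurable_obs (ρ : Run ν c δ μ₀ P) (t : ℕ) : Measurable (ρ.obs t) := by
  have h : ρ.obs t = fun ω => ∑ i : Fin n, {ω | ρ.I t ω = some i}.indicator
      (fun ω => ρ.X i (current t) (pulls (fun t => ρ.I t ω) i (current t) (t - 1)) ω) ω := by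
    have key : ∀ (o : Option (Fin n)) (f : Fin n → ℝ),
        o.elim 0 f = ∑ i, if o = some i then f i else 0 := by
      intro o f
      cases o <;> simp
    funext ω
    simp only [Set.indicator_apply, Set.mem_ofPred_eq]
    exact key _ _
  rw [h]
  exact Finset.measurable_sum _ fun i _ =>
    (ρ.measurable_obs_at i _ (ρ.measurable_pulls i _ _)).indicator (ρ.measurable_I t (some i))

/-- The filtration `ℱ_t` generated by playing the algorithm: the `σ`-algebra generated by the
pulled arms `I_s`, the observed rewards and the sets `S_{s+1}` that are suggested after the pulls,
for the rounds `1 ≤ s ≤ t`. -/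
noncomputable def filtration (ρ : Run ν c δ μ₀ P) : Filtration ℕ (inferInstance : MeasurableSpace Ω) where
  seq t := ⨆ s ∈ Finset.Icc 1 t,
    MeasurableSpace.comap (ρ.I s) ⊤ ⊔ MeasurableSpace.comap (ρ.obs s) inferInstance ⊔
      MeasurableSpace.comap (ρ.S (s + 1)) inferInstance
  mono' := fun _ _ htu =>
    biSup_mono fun _ hs => Finset.Icc_subset_Icc_right htu hs
  le' := fun t => by
    refine iSup₂_le fun s _ => sup_le (sup_le ?_ ?_) ?_
    · rintro _ ⟨B, -, rfl⟩
      have : ρ.I s ⁻¹' B = ⋃ o ∈ B, {ω | ρ.I s ω = o} := by ext; simp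
      rw [this]
      exact MeasurableSet.biUnion B.to_countable fun o _ => ρ.measurable_I s o
    · exact (ρ.measurable_obs s).comap_le
    · exact (ρ.measurable_S (s + 1)).comap_le

end Run

/-! ### The complexity terms

The arm with index `j : Fin n` is the arm number `j + 1` in the usual list `1, …, n` of the arms, in
the order of nonincreasing means. -/

section Complexity

variable {n : ℕ}

/-- `Δ_{j,0} = μ_j - μ₀`. -/
noncomputable def gap₀ (ν : Fin n → Measure ℝ) (μ₀ : ℝ) (j : Fin n) : ℝ := mean ν j - μ₀

/-- `Δ_{j,i} = μ_j - μ_i`. -/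
noncomputable def gap (ν : Fin n → Measure ℝ) (j i : Fin n) : ℝ := mean ν j - mean ν i

/-- `Δ_{i ∨ j, 0}`, the larger one of the gaps `Δ_{i,0}` and `Δ_{j,0}`. -/
noncomputable def gapMax (ν : Fin n → Measure ℝ) (μ₀ : ℝ) (i j : Fin n) : ℝ :=
  max (gap₀ ν μ₀ i) (gap₀ ν μ₀ j)

/-- The ratio `n k / j`, where `j` is the number of the arm. -/
noncomputable def ratio (n k : ℕ) (j : Fin n) : ℝ := (n : ℝ) * (k : ℝ) / ((j : ℕ) + 1 : ℝ)

/-- The gap-dependent complexity `H_FDR(μ₀; j)`, with its doubly logarithmic factors. -/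
noncomputable def HFDR (ν : Fin n → Measure ℝ) (μ₀ δ : ℝ) (k : ℕ) (j : Fin n) : ℝ :=
  (k : ℝ) / ((j : ℕ) + 1 : ℝ) *
    (∑ i ∈ H₁ ν μ₀, (gapMax ν μ₀ i j ^ 2)⁻¹ *
        tlog (ratio n k j / δ * tlog ((gapMax ν μ₀ i j ^ 2)⁻¹)) +
      ∑ i ∈ H₀ ν μ₀, (gap ν j i ^ 2)⁻¹ * tlog (tlog ((gap ν j i ^ 2)⁻¹) / δ))

/-- The gap-independent complexity `H̃_FDR(μ₀; j)`, with its doubly logarithmic factors. -/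
noncomputable def HFDR' (ν : Fin n → Measure ℝ) (μ₀ δ : ℝ) (k : ℕ) (j : Fin n) : ℝ :=
  ratio n k j * (gap₀ ν μ₀ j ^ 2)⁻¹ *
    tlog (tlog (ratio n k j) * tlog ((gap₀ ν μ₀ j ^ 2)⁻¹) / δ)

end Complexity

end InfiniteUCB

/-! No adaptive stopping is needed. The sets `S_t` increase, so `τ_k` may be the deterministic first
time at which the expected number of true discoveries reaches `(1 - δ) k`. For each `j` and each
complexity it remains to exhibit one time of the right order with this property.

Everything rests on one concentration fact (`measure_fails_le`): for `c ≥ 4` the anytime interval of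
level `q ≤ 0.025` fails with probability at most `q ^ 2`.

False discoveries. An arm of `ℋ₀` accepted through `s(p)` in a bracket of `M` arms has a failing
interval of level `(p / M) δ'_r`, while `|S_t| ≥ p` from then on, so its share of the false
discovery proportion is at most `1 / p`. Telescoping `1 / p` dominates this by `fdrWeight`, a
combination of indicators of fixed events whose mean is at most `2 δ'_r ^ 2 / M`. Brackets are
independent of observations and contain a given arm with probability `M / n`, so a bracket
contributes at most `2 δ'_r ^ 2`, and the sum over brackets is below `2 δ`.

Discoveries. Suppose that one of the best `j` arms, `i₀`, lies in the bracket, has a valid interval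
and is still not accepted. Arms clearly worse than `i₀` stop being pulled because of their upper
bounds (`le_upper_bound`); arms clearly above the threshold stop because they get accepted
(`false_of_lower_bounds`). If the interval of arm `i` is valid at level `δ / 2 ^ d i`, its pulls
cost `w i + κ i * d i`, as the factor `2 ^ d i` leaves the logarithm additively. The gap-dependent
bound `visits_le_gap` accepts arms one at a time. The gap-independent bound `visits_le_uniform` uses
all levels `p / M` and `∑ log (M / p) ≤ M`, which saves the logarithm of the bracket size.

The first valid exponents have mean at most `2 δ ^ 2`, so a bracket used for a multiple of its
expected cost rarely misses such an arm. A bracket of about `n k / j` arms (`exists_bracket`) either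
contains all arms or is expected to contain `4 k` of the best `j`. In the first case a Markov bound
loses only `O(δ ^ 2)`; in the second the slack between `4 k` and `k` covers a second-moment
estimate. The cyclic schedule visits such a bracket `H` times within time of order `H log H`
(`exists_le_visits`). -/

namespace InfiniteUCB

/-! ### The truncated logarithm and the confidence width -/

theorem one_le_tlog (x : ℝ) : 1 ≤ tlog x := le_max_right _ _

theorem tlog_pos (x : ℝ) : 0 < tlog x := one_pos.trans_le (one_le_tlog x)

theorem log_le_tlog (x : ℝ) : Real.log x ≤ tlog x := le_max_left _ _

theorem tlog_mono {x y : ℝ} (hx : 0 < x) (hxy : x ≤ y) : tlog x ≤ tlog y :=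
  max_le_max (Real.log_le_log hx hxy) le_rfl

theorem tlog_le_self {x : ℝ} (hx : 1 ≤ x) : tlog x ≤ x :=
  max_le ((Real.log_le_sub_one_of_pos (by linarith)).trans (by linarith)) hx

theorem tlog_mul_le_add {x y : ℝ} (hx : 0 < x) (hy : 0 < y) :
    tlog (x * y) ≤ tlog x + tlog y := by
  refine max_le ?_ ?_
  · rw [Real.log_mul hx.ne' hy.ne']
    exact add_le_add (log_le_tlog x) (log_le_tlog y)
  · linarith [one_le_tlog x, one_le_tlog y]

theorem tlog_mul_le {x y : ℝ} (hx : 0 < x) (hy : 0 < y) :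
    tlog (x * y) ≤ 2 * tlog x * tlog y := by
  nlinarith [tlog_mul_le_add hx hy, one_le_tlog x, one_le_tlog y]

theorem tlog_pow_le {x : ℝ} {m : ℕ} (hm : 1 ≤ m) : tlog (x ^ m) ≤ m * tlog x := by
  have hm' : (1 : ℝ) ≤ m := by exact_mod_cast hm
  refine max_le ?_ ?_
  · rw [Real.log_pow]
    exact mul_le_mul_of_nonneg_left (log_le_tlog x) (by positivity)
  · nlinarith [one_le_tlog x]

theorem width_anti {c : ℝ} (hc : 0 ≤ c) (T : ℕ) {p q : ℝ} (hp : 0 < p) (hpq : p ≤ q) :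
    width c T q ≤ width c T p := by
  unfold width
  have h1 : tlog (tlog T / q) ≤ tlog (tlog T / p) :=
    tlog_mono (div_pos (tlog_pos _) (hp.trans_le hpq))
      (div_le_div_of_nonneg_left (tlog_pos _).le hp hpq)
  gcongr

/-- The coefficient `1 / 2` allows `exists_le_of_le_two_mul_width` to absorb the term in `y`; it
comes from the tangent of the logarithm at `(1 + y) / 2 = 1`. -/
theorem tlog_one_add_tlog_le {y : ℝ} (hy : 1 ≤ y) : tlog (1 + tlog y) ≤ y / 2 + 1 := by
  refine max_le ?_ (by linarith)
  have h1 : Real.log (1 + tlog y) ≤ Real.log (1 + y) :=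
    Real.log_le_log (by linarith [one_le_tlog y]) (by linarith [tlog_le_self hy])
  have h2 : Real.log (1 + y) = Real.log 2 + Real.log ((1 + y) / 2) := by
    rw [← Real.log_mul (by norm_num) (by positivity)]
    congr 1
    ring
  have h3 := Real.log_le_sub_one_of_pos (show 0 < (1 + y) / 2 by linarith)
  linarith [Real.log_two_lt_d9]

/-- If the confidence width after `T` observations still exceeds half of a gap `g`, then `T` is at
most of the order `g⁻² log (log (g⁻²) / q)`. -/
theorem exists_le_of_le_two_mul_width {c : ℝ} (hc : 1 ≤ c) : ∃ K : ℝ, 1 ≤ K ∧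
    ∀ (g q : ℝ) (T : ℕ), 0 < g → 0 < q → 1 ≤ T → g ≤ 2 * width c T q →
      (T : ℝ) ≤ K * ((g ^ 2)⁻¹ * tlog (tlog ((g ^ 2)⁻¹) / q)) := by
  refine ⟨32 * c ^ 2 * tlog (2 * tlog (4 * c ^ 2)), ?_, ?_⟩
  · nlinarith [one_le_tlog (2 * tlog (4 * c ^ 2)), mul_self_nonneg (c - 1)]
  intro g q T hg hq hT h
  have hT0 : (0 : ℝ) < T := by exact_mod_cast hT
  set y := tlog (tlog T / q) with hy
  have hy1 : 1 ≤ y := one_le_tlog _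
  set G := (g ^ 2)⁻¹ with hG
  have hG0 : 0 < G := by positivity
  set a := 4 * c ^ 2 * G with ha
  have ha0 : 0 < a := by positivity
  -- Squaring the hypothesis bounds `T` by a quantity that contains `T` inside `y`. Inserting this
  -- bound into `y` leaves `y ≤ tlog (tlog a / q) + tlog (1 + tlog y)`, whose last term is at most
  -- `y / 2 + 1`.
  have hTy : (T : ℝ) ≤ a * y := by
    have h1 : g ^ 2 ≤ (2 * width c T q) ^ 2 := by gcongr
    have h2 : (2 * width c T q) ^ 2 = 4 * c ^ 2 * (1 / T * y) := by
      unfold width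
      rw [← mul_assoc, mul_pow, Real.sq_sqrt (by positivity)]
      ring
    rw [h2] at h1
    have h3 : g ^ 2 * T ≤ 4 * c ^ 2 * y := by
      calc g ^ 2 * T ≤ 4 * c ^ 2 * (1 / T * y) * T := by gcongr
        _ = 4 * c ^ 2 * y := by field_simp
    calc (T : ℝ) = G * (g ^ 2 * T) := by rw [hG]; field_simp
      _ ≤ G * (4 * c ^ 2 * y) := by gcongr
      _ = a * y := by rw [ha]; ring
  have hla := one_le_tlog a
  have hlT : tlog T ≤ tlog a * (1 + tlog y) := by
    have h1 := (tlog_mono hT0 hTy).trans (tlog_mul_le_add ha0 (by linarith))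
    nlinarith [one_le_tlog y]
  have hly := one_le_tlog y
  have hy2 : y ≤ tlog (tlog a / q) + tlog (1 + tlog y) := by
    refine le_trans ?_ (tlog_mul_le_add (by positivity) (by linarith))
    refine tlog_mono (div_pos (tlog_pos _) hq) ?_
    rw [div_mul_eq_mul_div]
    gcongr
  have hy3 : y ≤ 4 * tlog (tlog a / q) := by
    linarith [tlog_one_add_tlog_le hy1, one_le_tlog (tlog a / q)]
  have hZ : tlog (tlog a / q) ≤ 2 * tlog (2 * tlog (4 * c ^ 2)) * tlog (tlog G / q) := by
    have h4 := one_le_tlog (4 * c ^ 2)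
    have h5 := tlog_pos G
    refine le_trans ?_ (tlog_mul_le (by linarith) (by positivity))
    refine tlog_mono (by positivity) ?_
    rw [← mul_div_assoc]
    gcongr
    exact tlog_mul_le (by positivity) hG0
  calc (T : ℝ) ≤ a * y := hTy
    _ ≤ a * (4 * (2 * tlog (2 * tlog (4 * c ^ 2)) * tlog (tlog G / q))) := by
      gcongr
      linarith
    _ = _ := by rw [ha]; ring

/-- Doubling `c` doubles the width. The factor four arises because half a gap is compared with two
widths: that of the valid interval and that of the bound used by the algorithm. -/
theorem exists_le_of_le_four_mul_width {c : ℝ} (hc : 1 ≤ c) : ∃ K : ℝ, 1 ≤ K ∧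
    ∀ (g q : ℝ) (T : ℕ), 0 < g → 0 < q → 1 ≤ T → g ≤ 4 * width c T q →
      (T : ℝ) ≤ K * ((g ^ 2)⁻¹ * tlog (tlog ((g ^ 2)⁻¹) / q)) := by
  obtain ⟨K, hK, h⟩ := exists_le_of_le_two_mul_width (show 1 ≤ 2 * c by linarith)
  refine ⟨K, hK, fun g q T hg hq hT hw => h g q T hg hq hT (hw.trans (le_of_eq ?_))⟩
  unfold width
  ring

/-- As `log 2 < 1`, lowering the level by `2 ^ d` costs only an additive `d`. This makes the cost of
an arm affine in the exponent of a valid level. -/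
theorem tlog_div_div_two_pow_le {z q : ℝ} (hz : 0 < z) (hq : 0 < q) (d : ℕ) :
    tlog (z / (q / 2 ^ d)) ≤ tlog (z / q) + d := by
  have h : z / (q / 2 ^ d) = z / q * 2 ^ d := by field_simp
  have hd : (0 : ℝ) ≤ d := Nat.cast_nonneg d
  rw [h]
  refine max_le ?_ (by linarith [one_le_tlog (z / q)])
  rw [Real.log_mul (by positivity) (by positivity), Real.log_pow]
  nlinarith [log_le_tlog (z / q), Real.log_two_lt_d9]

theorem bracketLevel_pos {δ : ℝ} (hδ : 0 < δ) {r : ℕ} (hr : 1 ≤ r) : 0 < bracketLevel δ r := by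
  have : (0 : ℝ) < r := by exact_mod_cast hr
  unfold bracketLevel
  positivity

theorem bracketLevel'_pos {δ : ℝ} (hδ : 0 < δ) {r : ℕ} (hr : 1 ≤ r) : 0 < bracketLevel' δ r :=
  div_pos (bracketLevel_pos hδ hr) (mul_pos (by norm_num) (tlog_pos _))

theorem bracketLevel'_le {δ : ℝ} (hδ : 0 < δ) {r : ℕ} (hr : 1 ≤ r) :
    bracketLevel' δ r ≤ δ / (r : ℝ) ^ 2 := by
  refine div_le_self (bracketLevel_pos hδ hr).le ?_
  linarith [one_le_tlog (36 / bracketLevel δ r)]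

theorem bracketLevel'_le_self {δ : ℝ} (hδ : 0 < δ) {r : ℕ} (hr : 1 ≤ r) :
    bracketLevel' δ r ≤ δ := by
  have : (1 : ℝ) ≤ r := by exact_mod_cast hr
  exact (bracketLevel'_le hδ hr).trans (div_le_self hδ.le (by nlinarith))

/-- `231` exceeds `6.4 * 36`. Bounding the logarithm in `δ'_r` by its argument squares `r ^ 2 / δ`,
which is harmless since the result is only used inside logarithms. -/
theorem inv_bracketLevel'_le {δ : ℝ} (hδ : 0 < δ) (hδ1 : δ ≤ 1) {r : ℕ} (hr : 1 ≤ r) :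
    (bracketLevel' δ r)⁻¹ ≤ 231 * ((r : ℝ) ^ 2 / δ) ^ 2 := by
  have hr' : (1 : ℝ) ≤ r := by exact_mod_cast hr
  have h1 : (1 : ℝ) ≤ (r : ℝ) ^ 2 / δ := by rw [le_div_iff₀ hδ]; nlinarith
  have h2 : tlog (36 / bracketLevel δ r) ≤ 36 * ((r : ℝ) ^ 2 / δ) := by
    have : 36 / bracketLevel δ r = 36 * ((r : ℝ) ^ 2 / δ) := by
      unfold bracketLevel
      field_simp
    rw [this]
    exact tlog_le_self (by linarith)
  calc (bracketLevel' δ r)⁻¹ = 6.4 * tlog (36 / bracketLevel δ r) * ((r : ℝ) ^ 2 / δ) := by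
        unfold bracketLevel' bracketLevel
        field_simp
    _ ≤ 6.4 * (36 * ((r : ℝ) ^ 2 / δ)) * ((r : ℝ) ^ 2 / δ) := by gcongr
    _ ≤ _ := by nlinarith

/-! ### Anytime concentration of sub-Gaussian means -/

section Concentration

variable {Ω : Type*} [MeasurableSpace Ω] {P : Measure Ω} [IsProbabilityMeasure P]

/-- The exponentials of the partial sums of independent centered sub-Gaussian variables form a
submartingale. -/
theorem submartingale_exp_sum {Y : ℕ → Ω → ℝ} (hm : ∀ s, Measurable (Y s)) (hi : iIndepFun Y P)
    (hs : ∀ s, HasSubgaussianMGF (Y s) 1 P) (h0 : ∀ s, ∫ ω, Y s ω ∂P = 0) (l : ℝ) :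
    Submartingale (fun k ω => Real.exp (l * ∑ s ∈ Finset.range (k + 1), Y s ω))
      (Filtration.natural Y fun s => (hm s).stronglyMeasurable) P := by
  have hYsm : ∀ s, StronglyMeasurable (Y s) := fun s => (hm s).stronglyMeasurable
  have hint : ∀ k, Integrable (fun ω => Real.exp (l * ∑ s ∈ Finset.range (k + 1), Y s ω)) P :=
    fun k => (HasSubgaussianMGF.sum_of_iIndepFun hi (c := fun _ => 1)
      (s := Finset.range (k + 1)) fun s _ => hs s).integrable_exp_mul l
  have hadp : StronglyAdapted (Filtration.natural Y hYsm)
      (fun k ω => Real.exp (l * ∑ s ∈ Finset.range (k + 1), Y s ω)) := by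
    intro k
    refine Measurable.stronglyMeasurable ?_
    refine Real.measurable_exp.comp (Measurable.const_mul ?_ l)
    refine Finset.measurable_sum _ fun s hs => ?_
    exact ((Filtration.stronglyAdapted_natural hYsm s).mono
      ((Filtration.natural Y hYsm).mono
        (Nat.lt_succ_iff.1 (Finset.mem_range.1 hs)))).measurable
  refine submartingale_nat hadp hint fun k => ?_
  have hexp : Integrable (fun ω => Real.exp (l * Y (k + 1) ω)) P :=
    (hs (k + 1)).integrable_exp_mul l
  have hsplit : (fun ω => Real.exp (l * ∑ s ∈ Finset.range (k + 1 + 1), Y s ω)) =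
      (fun ω => Real.exp (l * ∑ s ∈ Finset.range (k + 1), Y s ω)) *
        fun ω => Real.exp (l * Y (k + 1) ω) := by
    funext ω
    rw [Pi.mul_apply, ← Real.exp_add, Finset.sum_range_succ _ (k + 1)]
    ring_nf
  have h1 := condExp_mul_of_stronglyMeasurable_left (hadp k) (hsplit ▸ hint (k + 1)) hexp
  have h2 : P[fun ω => Real.exp (l * Y (k + 1) ω)|Filtration.natural Y hYsm k] =ᵐ[P]
      fun _ => ∫ ω, Real.exp (l * Y (k + 1) ω) ∂P := by
    refine condExp_indep_eq (hm (k + 1)).comap_le (Filtration.le _ _) ?_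
      (hi.indep_comap_natural_of_lt hYsm (Nat.lt_succ_self k))
    exact (Real.measurable_exp.comp
      ((comap_measurable (Y (k + 1))).const_mul l)).stronglyMeasurable
  have h3 : 1 ≤ ∫ ω, Real.exp (l * Y (k + 1) ω) ∂P := by
    have h4 : ∫ ω, (l * Y (k + 1) ω + 1) ∂P ≤ ∫ ω, Real.exp (l * Y (k + 1) ω) ∂P := by
      refine integral_mono ?_ hexp fun ω => Real.add_one_le_exp _
      exact ((hs (k + 1)).integrable.const_mul l).add (integrable_const 1)
    rw [integral_add ((hs (k + 1)).integrable.const_mul l) (integrable_const 1),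
      integral_const_mul, h0] at h4
    simpa using h4
  simp only [hsplit]
  filter_upwards [h1, h2] with ω hω1 hω2
  rw [hω1, Pi.mul_apply, hω2]
  nlinarith [Real.exp_pos (l * ∑ s ∈ Finset.range (k + 1), Y s ω)]

/-- Doob's maximal inequality for the exponential submartingale, at the parameter `l = x / N` that
minimizes `N l ^ 2 / 2 - l x`. -/
theorem measure_exists_sum_ge_le {Y : ℕ → Ω → ℝ} (hm : ∀ s, Measurable (Y s))
    (hi : iIndepFun Y P) (hs : ∀ s, HasSubgaussianMGF (Y s) 1 P)
    (h0 : ∀ s, ∫ ω, Y s ω ∂P = 0) {N : ℕ} (hN : 1 ≤ N) {x : ℝ} (hx : 0 ≤ x) :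
    P {ω | ∃ T, 1 ≤ T ∧ T ≤ N ∧ x ≤ ∑ s ∈ Finset.range T, Y s ω} ≤
      ENNReal.ofReal (Real.exp (-(x ^ 2 / (2 * N)))) := by
  obtain ⟨n, rfl⟩ : ∃ n, N = n + 1 := ⟨N - 1, by omega⟩
  set l : ℝ := x / (n + 1 : ℕ) with hl
  have hl0 : 0 ≤ l := by positivity
  set f : ℕ → Ω → ℝ := fun k ω => Real.exp (l * ∑ s ∈ Finset.range (k + 1), Y s ω) with hf
  have hsub := submartingale_exp_sum hm hi hs h0 l
  have hD := maximal_ineq hsub (fun k ω => (Real.exp_pos _).le)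
    (ε := (Real.exp (l * x)).toNNReal) n
  set B := {ω | (((Real.exp (l * x)).toNNReal : ℝ≥0) : ℝ) ≤
    (Finset.range (n + 1)).sup' Finset.nonempty_range_add_one fun k => f k ω} with hB
  have hsubset : {ω | ∃ T, 1 ≤ T ∧ T ≤ n + 1 ∧ x ≤ ∑ s ∈ Finset.range T, Y s ω} ⊆ B := by
    rintro ω ⟨T, hT1, hT2, hT⟩
    obtain ⟨k, rfl⟩ : ∃ k, T = k + 1 := ⟨T - 1, by omega⟩
    rw [hB, Set.mem_ofPred_eq, Real.coe_toNNReal _ (Real.exp_pos _).le]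
    refine le_trans ?_ (Finset.le_sup' (fun k => f k ω) (Finset.mem_range.2 (by omega : k < n + 1)))
    exact Real.exp_le_exp.2 (mul_le_mul_of_nonneg_left hT hl0)
  have hsum := HasSubgaussianMGF.sum_of_iIndepFun hi (c := fun _ => 1)
      (s := Finset.range (n + 1)) fun s _ => hs s
  have hint : ∫ ω in B, f n ω ∂P ≤ Real.exp ((n + 1 : ℕ) * l ^ 2 / 2) := by
    refine (setIntegral_le_integral (hsum.integrable_exp_mul l)
      (ae_of_all _ fun ω => (Real.exp_pos _).le)).trans ?_
    simpa [mgf] using hsum.mgf_le l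
  have hE : ENNReal.ofReal (Real.exp (l * x)) * P B ≤
      ENNReal.ofReal (Real.exp ((n + 1 : ℕ) * l ^ 2 / 2)) :=
    hD.trans (ENNReal.ofReal_le_ofReal hint)
  have hpos : ENNReal.ofReal (Real.exp (l * x)) ≠ 0 := by simp [Real.exp_pos]
  refine (measure_mono hsubset).trans ?_
  rw [mul_comm, ← ENNReal.le_div_iff_mul_le (Or.inl hpos) (Or.inl ENNReal.ofReal_ne_top),
    ← ENNReal.ofReal_div_of_pos (Real.exp_pos _), ← Real.exp_sub] at hE
  refine hE.trans (le_of_eq ?_)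
  congr 2
  rw [hl]
  field_simp
  ring

/-- The anytime confidence interval of level `q` for the mean `μ`, built from the observations `y`,
fails at some time. -/
def Fails (c μ q : ℝ) (y : ℕ → ℝ) : Prop :=
  ∃ T : ℕ, 1 ≤ T ∧ width c T q ≤ |(∑ s ∈ Finset.range T, y s) / (T : ℝ) - μ|

theorem Fails.mono {c μ q q' : ℝ} {y : ℕ → ℝ} (hc : 0 ≤ c) (hq : 0 < q) (hqq : q ≤ q')
    (h : Fails c μ q y) : Fails c μ q' y := by
  obtain ⟨T, hT, h⟩ := h
  exact ⟨T, hT, (width_anti hc T hq hqq).trans h⟩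

theorem measurableSet_fails (c μ q : ℝ) : MeasurableSet {y : ℕ → ℝ | Fails c μ q y} := by
  have : {y : ℕ → ℝ | Fails c μ q y} = ⋃ T : ℕ, {y : ℕ → ℝ | 1 ≤ T ∧
      width c T q ≤ |(∑ s ∈ Finset.range T, y s) / (T : ℝ) - μ|} := by
    ext y
    simp [Fails]
  rw [this]
  refine MeasurableSet.iUnion fun T => ?_
  have h : Measurable fun y : ℕ → ℝ => ∑ s ∈ Finset.range T, y s :=
    Finset.measurable_sum _ fun s _ => measurable_pi_apply s
  have h1 : MeasurableSet {y : ℕ → ℝ | width c T q ≤ |(∑ s ∈ Finset.range T, y s) / (T : ℝ) - μ|} :=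
    measurableSet_le measurable_const ((h.div_const _).sub measurable_const).abs
  have h2 : MeasurableSet {y : ℕ → ℝ | 1 ≤ T} := MeasurableSet.const _
  exact h2.inter h1

/-- For `c ≥ 4` the factor `c ^ 2 / 4` is at least `4`, so a dyadic block contributes `(q / L) ^ 4`
with `L = tlog (2 ^ b)`. As `L ≥ (b + 1) / 3`, two powers of `L` suffice to make the blocks
summable. -/
theorem exp_block_le {c q : ℝ} (hc : 4 ≤ c) (hq : 0 < q) (hq1 : q ≤ 0.025) (b : ℕ) :
    Real.exp (-(c ^ 2 * (2 ^ b * tlog (tlog (2 ^ b) / q)) / (2 * (2 ^ (b + 1) : ℕ)))) ≤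
      9 * q ^ 4 / ((b : ℝ) + 1) ^ 2 := by
  have hL1 := one_le_tlog ((2 : ℝ) ^ b)
  have hL : ((b : ℝ) + 1) / 3 ≤ tlog (2 ^ b) := by
    rcases Nat.eq_zero_or_pos b with rfl | hb
    · norm_num at hL1 ⊢
      linarith
    · have hb' : (1 : ℝ) ≤ b := by exact_mod_cast hb
      have h := log_le_tlog ((2 : ℝ) ^ b)
      rw [Real.log_pow] at h
      nlinarith [Real.log_two_gt_d9]
  set L := tlog ((2 : ℝ) ^ b)
  have hz : 0 < L / q := by positivity
  have h1 : -(c ^ 2 * (2 ^ b * tlog (L / q)) / (2 * (2 ^ (b + 1) : ℕ))) ≤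
      -(4 * Real.log (L / q)) := by
    have : c ^ 2 * (2 ^ b * tlog (L / q)) / (2 * (2 ^ (b + 1) : ℕ)) = c ^ 2 / 4 * tlog (L / q) := by
      push_cast
      rw [pow_succ]
      field_simp
      ring
    rw [this]
    nlinarith [log_le_tlog (L / q), one_le_tlog (L / q), mul_self_nonneg (c - 4)]
  refine (Real.exp_le_exp.2 h1).trans ?_
  have h2 : Real.exp (-(4 * Real.log (L / q))) = (q / L) ^ 4 := by
    rw [Real.exp_neg, show (4 : ℝ) * Real.log (L / q) = ((4 : ℕ) : ℝ) * Real.log (L / q) by norm_num,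
      Real.exp_nat_mul, Real.exp_log hz, ← inv_pow, inv_div]
  rw [h2, div_pow, div_le_div_iff₀ (by positivity) (by positivity)]
  have h3 : ((b : ℝ) + 1) ^ 2 ≤ 9 * L ^ 2 := by
    have : (b : ℝ) + 1 ≤ 3 * L := by linarith
    calc ((b : ℝ) + 1) ^ 2 ≤ (3 * L) ^ 2 := by gcongr
      _ = 9 * L ^ 2 := by ring
  have h4 : L ^ 2 ≤ L ^ 4 := pow_le_pow_right₀ hL1 (by norm_num)
  have : 0 < q ^ 4 := by positivity
  nlinarith

theorem tsum_inv_sq_succ_le : ∑' b : ℕ, (1 : ℝ) / ((b : ℝ) + 1) ^ 2 ≤ 2 := by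
  have h := hasSum_zeta_two
  have h' : ∑' b : ℕ, (1 : ℝ) / ((b : ℝ) + 1) ^ 2 = Real.pi ^ 2 / 6 := by
    rw [← h.tsum_eq, h.summable.tsum_eq_zero_add]
    simp
  rw [h']
  nlinarith [Real.pi_lt_d2, Real.pi_pos]

theorem summable_inv_sq_succ : Summable fun b : ℕ => (1 : ℝ) / ((b : ℝ) + 1) ^ 2 := by
  have := (summable_nat_add_iff 1).2 hasSum_zeta_two.summable
  simpa using this

/-- One-sided version of `measure_fails_le`, for centered observations. -/
theorem measure_exists_width_le_le {c q : ℝ} (hc : 4 ≤ c) (hq : 0 < q) (hq1 : q ≤ 0.025)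
    {Y : ℕ → Ω → ℝ} (hm : ∀ s, Measurable (Y s)) (hi : iIndepFun Y P)
    (hs : ∀ s, HasSubgaussianMGF (Y s) 1 P) (h0 : ∀ s, ∫ ω, Y s ω ∂P = 0) :
    P {ω | ∃ T : ℕ, 1 ≤ T ∧ width c T q ≤ (∑ s ∈ Finset.range T, Y s ω) / (T : ℝ)} ≤
      ENNReal.ofReal (q ^ 2 / 2) := by
  set x : ℕ → ℝ := fun b => c * √(2 ^ b * tlog (tlog (2 ^ b) / q)) with hx
  -- Peeling: `T` lies in the block `b = Nat.log 2 T`. The threshold `width c T q * T` is at least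
  -- its value `x b` at `2 ^ b`, while the maximal inequality runs up to `2 ^ (b + 1)`.
  have hsub : {ω | ∃ T : ℕ, 1 ≤ T ∧ width c T q ≤ (∑ s ∈ Finset.range T, Y s ω) / (T : ℝ)} ⊆
      ⋃ b : ℕ, {ω | ∃ T, 1 ≤ T ∧ T ≤ 2 ^ (b + 1) ∧ x b ≤ ∑ s ∈ Finset.range T, Y s ω} := by
    rintro ω ⟨T, hT, h⟩
    refine Set.mem_iUnion.2 ⟨Nat.log 2 T, T, hT, (Nat.lt_pow_succ_log_self (by norm_num) T).le, ?_⟩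
    have hT0 : (0 : ℝ) < T := by exact_mod_cast hT
    have hb : ((2 : ℝ) ^ Nat.log 2 T) ≤ T := by
      exact_mod_cast Nat.pow_log_le_self 2 (by omega)
    rw [le_div_iff₀ hT0] at h
    refine le_trans ?_ h
    have h1 : width c T q * T = c * √(T * tlog (tlog T / q)) := by
      unfold width
      rw [mul_assoc]
      congr 1
      have : (1 / (T : ℝ)) * tlog (tlog T / q) = (T * tlog (tlog T / q)) / T ^ 2 := by
        field_simp
      rw [this, Real.sqrt_div' _ (by positivity), Real.sqrt_sq hT0.le]
      field_simp
    rw [h1]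
    have h2 : tlog (tlog (2 ^ Nat.log 2 T) / q) ≤ tlog (tlog T / q) := by
      refine tlog_mono (div_pos (tlog_pos _) hq) ?_
      gcongr
      exact tlog_mono (by positivity) hb
    have := tlog_pos (tlog (2 ^ Nat.log 2 T) / q)
    exact mul_le_mul_of_nonneg_left (Real.sqrt_le_sqrt (by gcongr)) (by linarith)
  refine (measure_mono hsub).trans ((measure_iUnion_le _).trans ?_)
  have hblock : ∀ b : ℕ, P {ω | ∃ T, 1 ≤ T ∧ T ≤ 2 ^ (b + 1) ∧
      x b ≤ ∑ s ∈ Finset.range T, Y s ω} ≤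
        ENNReal.ofReal (9 * q ^ 4 * (1 / ((b : ℝ) + 1) ^ 2)) := by
    intro b
    have hxb : 0 ≤ x b := mul_nonneg (by linarith) (Real.sqrt_nonneg _)
    refine (measure_exists_sum_ge_le hm hi hs h0 Nat.one_le_two_pow hxb).trans
      (ENNReal.ofReal_le_ofReal ?_)
    have h2 : x b ^ 2 = c ^ 2 * (2 ^ b * tlog (tlog (2 ^ b) / q)) := by
      have := tlog_pos (tlog (2 ^ b) / q)
      rw [hx]
      simp only
      rw [mul_pow, Real.sq_sqrt (by positivity)]
    rw [h2, mul_one_div]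
    exact exp_block_le hc hq hq1 b
  refine (ENNReal.tsum_le_tsum hblock).trans ?_
  rw [← ENNReal.ofReal_tsum_of_nonneg (fun b => by positivity)
    (summable_inv_sq_succ.mul_left _), tsum_mul_left]
  refine ENNReal.ofReal_le_ofReal ?_
  -- The series gives at most `18 q ^ 4`; `q ≤ 0.025` trades two powers of `q` for the constant.
  have h4 : q ^ 4 ≤ q ^ 2 * 0.025 ^ 2 := by
    have : q ^ 2 ≤ 0.025 ^ 2 := by gcongr
    nlinarith [sq_nonneg q]
  nlinarith [tsum_inv_sq_succ_le, sq_nonneg q, pow_pos hq 4]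

/-- The anytime confidence interval of level `q` fails with probability at most `q²`. -/
theorem measure_fails_le {c q μ : ℝ} (hc : 4 ≤ c) (hq : 0 < q) (hq1 : q ≤ 0.025)
    {X : ℕ → Ω → ℝ} (hm : ∀ s, Measurable (X s)) (hi : iIndepFun X P)
    (hs : ∀ s, HasSubgaussianMGF (fun ω => X s ω - μ) 1 P) (h0 : ∀ s, ∫ ω, X s ω ∂P = μ) :
    P {ω | Fails c μ q fun s => X s ω} ≤ ENNReal.ofReal (q ^ 2) := by
  have hint : ∀ s, Integrable (X s) P := fun s => by
    have h := (hs s).integrable.add (integrable_const μ)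
    have e : (fun ω => X s ω - μ) + (fun _ => μ) = X s := by
      funext ω
      simp
    rwa [e] at h
  have h1 := measure_exists_width_le_le hc hq hq1 (Y := fun s ω => X s ω - μ)
    (fun s => (hm s).sub_const μ) (hi.comp (fun _ y => y - μ) fun _ => measurable_id.sub_const μ)
    hs fun s => by rw [integral_sub (hint s) (integrable_const μ), h0]; simp
  have h2 := measure_exists_width_le_le hc hq hq1 (Y := fun s ω => -(X s ω - μ))
    (fun s => ((hm s).sub_const μ).neg)
    (hi.comp (fun _ y => -(y - μ)) fun _ => (measurable_id.sub_const μ).neg)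
    (fun s => (hs s).neg) fun s => by
      rw [integral_neg, integral_sub (hint s) (integrable_const μ), h0]; simp
  have hsub : {ω | Fails c μ q fun s => X s ω} ⊆
      {ω | ∃ T : ℕ, 1 ≤ T ∧ width c T q ≤ (∑ s ∈ Finset.range T, (X s ω - μ)) / (T : ℝ)} ∪
      {ω | ∃ T : ℕ, 1 ≤ T ∧ width c T q ≤ (∑ s ∈ Finset.range T, -(X s ω - μ)) / (T : ℝ)} := by
    rintro ω ⟨T, hT, h⟩
    have hT0 : (0 : ℝ) < T := by exact_mod_cast hT
    have e : (∑ s ∈ Finset.range T, (X s ω - μ)) / (T : ℝ) =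
        (∑ s ∈ Finset.range T, X s ω) / T - μ := by
      rw [Finset.sum_sub_distrib]
      simp
      field_simp
    rcases le_abs'.1 h with h | h
    · right
      refine ⟨T, hT, ?_⟩
      rw [Finset.sum_neg_distrib, neg_div, e]
      linarith
    · left
      exact ⟨T, hT, by rwa [e]⟩
  refine (measure_mono hsub).trans ((measure_union_le _ _).trans ((add_le_add h1 h2).trans ?_))
  rw [← ENNReal.ofReal_add (by positivity) (by positivity)]
  exact ENNReal.ofReal_le_ofReal (by linarith)

end Concentration

/-! ### The schedule of the brackets -/

theorem numOpen_succ (t : ℕ) : numOpen (t + 1) =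
    if 2 ^ numOpen t * numOpen t ≤ t + 1 then numOpen t + 1 else numOpen t := rfl

theorem current_succ (t : ℕ) :
    current (t + 1) = 1 + if current t < numOpen (t + 1) then current t else 0 := rfl

theorem numOpen_mono : Monotone numOpen := by
  refine monotone_nat_of_le_succ fun t => ?_
  rw [numOpen_succ]
  split_ifs <;> omega

theorem le_numOpen {r t : ℕ} (h : 2 ^ r * r ≤ t) : r ≤ numOpen t := by
  induction r generalizing t with
  | zero => exact Nat.zero_le _
  | succ r ih =>
    have h1 : 2 ^ r * r + 1 ≤ t := by
      have : 2 ^ (r + 1) * (r + 1) = 2 ^ r * r + 2 ^ r * (r + 2) := by ring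
      have : 1 ≤ 2 ^ r * (r + 2) := Nat.one_le_iff_ne_zero.2 (by positivity)
      omega
    obtain ⟨t, rfl⟩ : ∃ u, t = u + 1 := ⟨t - 1, by omega⟩
    have h2 := ih (by omega : 2 ^ r * r ≤ t)
    rcases h2.eq_or_lt with h3 | h3
    · rw [numOpen_succ, ← h3, if_pos (by omega)]
    · exact (Nat.succ_le_of_lt h3).trans (numOpen_mono (Nat.le_succ t))

theorem pow_mul_pred_numOpen_le (t : ℕ) : 2 ^ (numOpen t - 1) * (numOpen t - 1) ≤ t := by
  induction t with
  | zero => simp [numOpen]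
  | succ t ih =>
    rw [numOpen_succ]
    split_ifs with h
    · simpa using h
    · omega

theorem numOpen_le_of_lt_pow {t L : ℕ} (hL : 1 ≤ L) (h : t < 2 ^ L) : numOpen t ≤ L := by
  by_contra hlt
  have h1 : 2 ^ L ≤ 2 ^ (numOpen t - 1) := Nat.pow_le_pow_right (by norm_num) (by omega)
  have h2 := pow_mul_pred_numOpen_le t
  have h3 : 2 ^ (numOpen t - 1) ≤ 2 ^ (numOpen t - 1) * (numOpen t - 1) :=
    Nat.le_mul_of_pos_right _ (by omega)
  omega

theorem current_le_numOpen (t : ℕ) : current t ≤ numOpen t := by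
  cases t with
  | zero => simp [current]
  | succ t =>
    have h : 1 ≤ numOpen (t + 1) :=
      (show 1 ≤ numOpen 1 by simp [numOpen]).trans (numOpen_mono (by omega))
    rw [current_succ]
    split_ifs <;> omega

theorem one_le_current {t : ℕ} (ht : 1 ≤ t) : 1 ≤ current t := by
  obtain ⟨t, rfl⟩ : ∃ u, t = u + 1 := ⟨t - 1, by omega⟩
  rw [current_succ]
  omega

/-- The conditional expression is the number of rounds until the cyclic order reaches `r` if `L`
brackets were open: directly, or after finishing the current cycle. It drops in every round that
does not reach `r`, since at most `L` brackets are open. -/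
theorem exists_current_eq_of_potential {r L : ℕ} (hr : 1 ≤ r) (d : ℕ) :
    ∀ s, r ≤ numOpen s → (∀ u, u ≤ s + d → numOpen u ≤ L) →
      (if current s < r then r - current s else L - current s + r) ≤ d →
      ∃ u, s < u ∧ u ≤ s + d ∧ current u = r := by
  induction d with
  | zero =>
    intro s hs hL h
    split_ifs at h <;> omega
  | succ d ih =>
    intro s hs hL h
    by_cases hc : current (s + 1) = r
    · exact ⟨s + 1, by omega, by omega, hc⟩
    have h1 : r ≤ numOpen (s + 1) := hs.trans (numOpen_mono (Nat.le_succ s))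
    have h2 := hL (s + 1) (by omega)
    obtain ⟨u, hu1, hu2, hu3⟩ := ih (s + 1) h1 (fun u hu => hL u (by omega)) (by
      have h3 := current_succ s
      split_ifs at h3 h ⊢ <;> omega)
    exact ⟨u, by omega, by omega, hu3⟩

theorem exists_current_eq {r L s : ℕ} (hr : 1 ≤ r) (hs : r ≤ numOpen s)
    (hL : ∀ u, u ≤ s + L → numOpen u ≤ L) : ∃ u, s < u ∧ u ≤ s + L ∧ current u = r := by
  refine exists_current_eq_of_potential hr L s hs hL ?_
  have h1 := current_le_numOpen s
  have h2 := hL s (by omega)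
  split_ifs <;> omega

/-- The number of rounds among `1, …, t` that are spent on bracket `r`. -/
def visits (r t : ℕ) : ℕ := ((Finset.Icc 1 t).filter fun s => current s = r).card

theorem visits_lt_of_current {r s u t : ℕ} (hsu : s < u) (hut : u ≤ t) (h : current u = r) :
    visits r s < visits r t := by
  refine Finset.card_lt_card (Finset.ssubset_iff_of_subset ?_ |>.2 ⟨u, ?_, ?_⟩)
  · exact Finset.filter_subset_filter _ (Finset.Icc_subset_Icc_right (by omega))
  · simp only [Finset.mem_filter, Finset.mem_Icc]
    omega
  · simp only [Finset.mem_filter, Finset.mem_Icc]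
    omega

theorem le_visits {r L s : ℕ} (hr : 1 ≤ r) (hs : r ≤ numOpen s) (N : ℕ)
    (hL : ∀ u, u ≤ s + N * L → numOpen u ≤ L) : N ≤ visits r (s + N * L) := by
  induction N with
  | zero => exact Nat.zero_le _
  | succ N ih =>
    have e : s + (N + 1) * L = s + N * L + L := by ring
    obtain ⟨u, h1, h2, h3⟩ := exists_current_eq (L := L) (s := s + N * L) hr
      (hs.trans (numOpen_mono (by omega))) fun u hu => hL u (by omega)
    have := ih fun u hu => hL u (by omega)
    have := visits_lt_of_current (t := s + (N + 1) * L) h1 (by omega) h3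
    omega

theorem five_mul_lt_pow {q : ℕ} (hq : 1 ≤ q) : 5 * q < 8 ^ q := by
  induction q, hq using Nat.le_induction with
  | base => norm_num
  | succ q hq ih =>
    rw [pow_succ]
    omega

/-- Within a time of the order `H log H`, a bracket with at most `K H` arms is opened and used in
`K H` rounds. -/
theorem exists_le_visits {K : ℝ} (hK : 1 ≤ K) : ∃ C : ℝ, 0 < C ∧ ∀ (H : ℝ) (r N : ℕ), 1 ≤ H →
    1 ≤ r → (2 : ℝ) ^ r ≤ K * H → (N : ℝ) ≤ K * H →
      ∃ t : ℕ, (t : ℝ) ≤ C * (H * tlog H) ∧ N ≤ visits r t := by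
  refine ⟨30 * K * tlog K, mul_pos (by linarith) (tlog_pos K), ?_⟩
  intro H r N hH hr h2r hN
  set B := K * H with hB
  have hB1 : 1 ≤ B := by nlinarith
  -- Since `2 ^ q > ⌊B⌋`, the whole period has length at most `⌊B⌋ * (5 * q) < 2 ^ q * 8 ^ q = 2 ^
  -- (4 * q)`. Hence at most `4 * q` brackets are open in it, and once bracket `r` is open, each `4
  -- * q` rounds visit it at least once.
  set q := Nat.log 2 ⌊B⌋₊ + 1 with hq
  have hBq : ⌊B⌋₊ < 2 ^ q := Nat.lt_pow_succ_log_self (by norm_num) _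
  have hrB : 2 ^ r ≤ ⌊B⌋₊ := Nat.le_floor (by exact_mod_cast h2r)
  have hNB : N ≤ ⌊B⌋₊ := Nat.le_floor hN
  have hrq : r ≤ q := ((Nat.pow_lt_pow_iff_right (by norm_num)).1 (hrB.trans_lt hBq)).le
  have hq3 : (q : ℝ) ≤ 3 * tlog B := by
    have h1 : 2 ^ Nat.log 2 ⌊B⌋₊ ≤ ⌊B⌋₊ :=
      Nat.pow_log_le_self 2 (Nat.floor_pos.2 hB1).ne'
    have h2 : (2 : ℝ) ^ Nat.log 2 ⌊B⌋₊ ≤ B :=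
      le_trans (by exact_mod_cast h1) (Nat.floor_le (by linarith))
    have h3 := Real.log_le_log (by positivity) h2
    rw [Real.log_pow] at h3
    have h4 := log_le_tlog B
    have h5 := one_le_tlog B
    rw [hq]
    push_cast
    nlinarith [Real.log_two_gt_d9]
  have hbound : 2 ^ r * r + N * (4 * q) ≤ ⌊B⌋₊ * (5 * q) := by
    have h1 : 2 ^ r * r ≤ ⌊B⌋₊ * q := Nat.mul_le_mul hrB hrq
    have h2 : N * (4 * q) ≤ ⌊B⌋₊ * (4 * q) := Nat.mul_le_mul_right _ hNB
    nlinarith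
  have hlt : 2 ^ r * r + N * (4 * q) < 2 ^ (4 * q) := by
    have h1 : 2 ^ (4 * q) = 2 ^ q * 8 ^ q := by
      rw [← mul_pow, pow_mul]
      norm_num
    rw [h1]
    calc _ ≤ ⌊B⌋₊ * (5 * q) := hbound
      _ ≤ 2 ^ q * (5 * q) := Nat.mul_le_mul_right _ hBq.le
      _ < 2 ^ q * 8 ^ q := Nat.mul_lt_mul_of_pos_left (five_mul_lt_pow (by omega)) (by positivity)
  refine ⟨2 ^ r * r + N * (4 * q), ?_, le_visits hr (le_numOpen le_rfl) N fun u hu =>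
    numOpen_le_of_lt_pow (by omega) (hu.trans_lt hlt)⟩
  have h1 : ((2 ^ r * r + N * (4 * q) : ℕ) : ℝ) ≤ B * (5 * q) := by
    refine le_trans (by exact_mod_cast hbound : _ ≤ ((⌊B⌋₊ * (5 * q) : ℕ) : ℝ)) ?_
    push_cast
    gcongr
    exact Nat.floor_le (by linarith)
  have h2 : tlog B ≤ 2 * tlog K * tlog H := tlog_mul_le (by linarith) (by linarith)
  calc _ ≤ B * (5 * q) := h1
    _ ≤ B * (5 * (3 * (2 * tlog K * tlog H))) := by
      gcongr
      linarith
    _ = _ := by rw [hB]; ring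

/-! ### The algorithm along one realization -/

section PathLemmas

variable {n : ℕ} {c δ μ₀ : ℝ} {x : Fin n → ℕ → ℕ → ℝ} {A : ℕ → Finset (Fin n)}
  {a : ℕ → Option (Fin n)}

theorem suggested_mono : Monotone (suggested c δ μ₀ x A a) :=
  monotone_nat_of_le_succ fun _ => Finset.subset_union_left

theorem mem_levelSet {t p : ℕ} {i : Fin n} : i ∈ levelSet c δ μ₀ x A a t p ↔
    i ∈ A (current t) ∧ 0 < pulls a i (current t) t ∧
      μ₀ ≤ empMean x i (current t) (pulls a i (current t) t) -
        width c (pulls a i (current t) t)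
          ((p : ℝ) / ((A (current t)).card : ℝ) * bracketLevel' δ (current t)) := by
  simp [levelSet]

theorem levelSet_subset_levelSet (hc : 0 ≤ c) (hδ : 0 < δ) {t p q : ℕ} (ht : 1 ≤ t) (hp : 1 ≤ p)
    (hpq : p ≤ q) : levelSet c δ μ₀ x A a t p ⊆ levelSet c δ μ₀ x A a t q := by
  intro i hi
  rw [mem_levelSet] at hi ⊢
  refine ⟨hi.1, hi.2.1, hi.2.2.trans (sub_le_sub_left (width_anti hc _ ?_ ?_) _)⟩
  · have hA : (0 : ℝ) < (A (current t)).card := by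
      exact_mod_cast Finset.card_pos.2 ⟨i, hi.1⟩
    have hp' : (0 : ℝ) < p := by exact_mod_cast hp
    exact mul_pos (div_pos hp' hA) (bracketLevel'_pos hδ (one_le_current ht))
  · have := (bracketLevel'_pos hδ (one_le_current ht)).le
    gcongr

/-- `s(p)` grows with `p` and `p̂` is the largest admissible index, so the analysis may use any
admissible `p` in place of `p̂`. -/
theorem levelSet_subset_suggested (hc : 0 ≤ c) (hδ : 0 < δ) {t p : ℕ} (ht : 1 ≤ t) (hp : 1 ≤ p)
    (h : p ≤ (levelSet c δ μ₀ x A a t p).card) :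
    levelSet c δ μ₀ x A a t p ⊆ suggested c δ μ₀ x A a (t + 1) := by
  have hmem : p ∈ levels c δ μ₀ x A a t := by
    refine Finset.mem_filter.2 ⟨Finset.mem_Icc.2 ⟨hp, h.trans (Finset.card_le_card ?_)⟩, h⟩
    exact fun i hi => (mem_levelSet.1 hi).1
  have hne : (levels c δ μ₀ x A a t).Nonempty := ⟨p, hmem⟩
  have hacc : accepted c δ μ₀ x A a t =
      levelSet c δ μ₀ x A a t ((levels c δ μ₀ x A a t).max' hne) := dif_pos hne
  refine (levelSet_subset_levelSet hc hδ ht hp (Finset.le_max' _ _ hmem)).trans ?_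
  rw [← hacc]
  exact Finset.subset_union_right

theorem pulls_succ (i : Fin n) (r t : ℕ) : pulls a i r (t + 1) =
    pulls a i r t + if current (t + 1) = r ∧ a (t + 1) = some i then 1 else 0 := by
  unfold pulls
  rw [← Finset.insert_Icc_right_eq_Icc_add_one (by omega), Finset.filter_insert]
  split_ifs with h
  · rw [Finset.card_insert_of_notMem]
    simp
  · rfl

theorem pulls_mono (i : Fin n) (r : ℕ) : Monotone (pulls a i r) := by
  refine monotone_nat_of_le_succ fun t => ?_
  rw [pulls_succ]
  omega

/-- Every number of pulls below the final one is attained just before some pull. -/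
theorem exists_pull_of_lt {i : Fin n} {r t u : ℕ} (h : u < pulls a i r t) :
    ∃ s, s < t ∧ current (s + 1) = r ∧ a (s + 1) = some i ∧ pulls a i r s = u := by
  induction t with
  | zero => simp [pulls] at h
  | succ t ih =>
    by_cases hu : u < pulls a i r t
    · obtain ⟨s, hs, h1⟩ := ih hu
      exact ⟨s, by omega, h1⟩
    · rw [pulls_succ] at h
      split_ifs at h with h1
      · exact ⟨t, by omega, h1.1, h1.2, by omega⟩
      · omega

theorem visits_le_sum_pulls {B : Finset (Fin n)} {r t : ℕ}
    (h : ∀ s, s < t → current (s + 1) = r → ∃ i ∈ B, a (s + 1) = some i) :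
    visits r t ≤ ∑ i ∈ B, pulls a i r t := by
  refine le_trans (Finset.card_le_card fun s hs => ?_) Finset.card_biUnion_le
  simp only [Finset.mem_filter, Finset.mem_Icc] at hs
  obtain ⟨i, hi, hai⟩ := h (s - 1) (by omega) (by rw [Nat.sub_add_cancel hs.1.1]; exact hs.2)
  rw [Nat.sub_add_cancel hs.1.1] at hai
  simp only [Finset.mem_biUnion, Finset.mem_filter, Finset.mem_Icc]
  exact ⟨i, hi, hs.1, hs.2, hai⟩

theorem candidates_subset_available {t : ℕ} :
    candidates c δ μ₀ x A a t ⊆ available c δ μ₀ x A a t := by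
  unfold candidates
  split_ifs
  · exact Finset.filter_subset _ _
  · exact Finset.filter_subset _ _

theorem mem_candidates_of_pull (hrule : FollowsRule c δ μ₀ x A a) {s : ℕ} {i : Fin n}
    (hi : a (s + 1) = some i) : i ∈ candidates c δ μ₀ x A a (s + 1) := by
  rcases hrule (s + 1) (by omega) with ⟨-, h⟩ | ⟨i', h, h'⟩
  · simp [h] at hi
  · rw [hi, Option.some.injEq] at h'
    exact h' ▸ h

theorem notMem_suggested_of_pull (hrule : FollowsRule c δ μ₀ x A a) {s : ℕ} {i : Fin n}
    (hi : a (s + 1) = some i) : i ∉ suggested c δ μ₀ x A a (s + 1) :=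
  (Finset.mem_sdiff.1 (candidates_subset_available (mem_candidates_of_pull hrule hi))).2

/-- There are no `p` arms of a bracket, each pulled at least twice, whose lower confidence bounds
at level `p / |A_r|` all stay above the threshold from the last but one pull on: they would have
been accepted before the last of these pulls. -/
theorem false_of_lower_bounds (hc : 0 ≤ c) (hδ : 0 < δ) (hrule : FollowsRule c δ μ₀ x A a)
    {r t : ℕ} {G : Finset (Fin n)} (hG : G ⊆ A r) (hne : G.Nonempty)
    (hT : ∀ i ∈ G, 2 ≤ pulls a i r t)
    (hL : ∀ i ∈ G, ∀ u, 1 ≤ u → pulls a i r t - 1 ≤ u → μ₀ ≤ empMean x i r u -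
      width c u ((G.card : ℝ) / ((A r).card : ℝ) * bracketLevel' δ r)) : False := by
  have h1 : ∀ i : Fin n, ∃ s, i ∈ G → s < t ∧ current (s + 1) = r ∧ a (s + 1) = some i ∧
      pulls a i r s = pulls a i r t - 2 := by
    intro i
    by_cases hi : i ∈ G
    · obtain ⟨s, hs⟩ := exists_pull_of_lt (a := a) (i := i) (r := r) (t := t)
        (u := pulls a i r t - 2) (by have := hT i hi; omega)
      exact ⟨s, fun _ => hs⟩
    · exact ⟨0, fun h => absurd h hi⟩
  choose σ hσ using h1
  -- `σ i + 1` is the round of the last but one pull of `i`. In the latest of these rounds all arms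
  -- of `G` have reached their last but one pull, so `G` is accepted, and the arm pulled there
  -- cannot have its last pull later.
  obtain ⟨i, hi, hmax⟩ := Finset.exists_max_image G σ hne
  obtain ⟨hst, hcur, has, hps⟩ := hσ i hi
  have hTi := hT i hi
  have hsub : G ⊆ levelSet c δ μ₀ x A a (σ i + 1) G.card := by
    intro i' hi'
    obtain ⟨hst', hcur', has', hps'⟩ := hσ i' hi'
    have hTi' := hT i' hi'
    have h2 : pulls a i' r t - 1 ≤ pulls a i' r (σ i + 1) := by
      have h3 : pulls a i' r (σ i' + 1) = pulls a i' r (σ i') + 1 := by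
        rw [pulls_succ, if_pos ⟨hcur', has'⟩]
      have h4 := pulls_mono (a := a) i' r (Nat.succ_le_succ (hmax i' hi'))
      simp only [Nat.succ_eq_add_one] at h4
      omega
    rw [mem_levelSet, hcur]
    exact ⟨hG hi', by omega, hL i' hi' _ (by omega) h2⟩
  have hmem := levelSet_subset_suggested hc hδ (by omega) (Finset.card_pos.2 hne)
    (Finset.card_le_card hsub) (hsub hi)
  obtain ⟨s, hs, hcur', has', hps'⟩ := exists_pull_of_lt (a := a) (i := i) (r := r) (t := t)
    (u := pulls a i r t - 1) (by omega)
  have hlt : σ i < s := by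
    by_contra hle
    have := pulls_mono (a := a) i r (not_lt.1 hle)
    omega
  exact notMem_suggested_of_pull hrule has' (suggested_mono (by omega) hmem)

variable {r t : ℕ} {i₀ : Fin n}

theorem exists_pull_of_notMem (hrule : FollowsRule c δ μ₀ x A a) (hA : i₀ ∈ A r)
    (hS : i₀ ∉ suggested c δ μ₀ x A a t) {s : ℕ} (hs : s < t) (hcur : current (s + 1) = r) :
    ∃ i ∈ A r, a (s + 1) = some i := by
  have hav : i₀ ∈ available c δ μ₀ x A a (s + 1) := by
    rw [available, Finset.mem_sdiff, hcur]
    exact ⟨hA, fun h => hS (suggested_mono (by omega) h)⟩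
  rcases hrule (s + 1) (by omega) with ⟨h, -⟩ | ⟨i, hi, hi'⟩
  · simp [h] at hav
  · have := candidates_subset_available hi
    rw [available, Finset.mem_sdiff, hcur] at this
    exact ⟨i, this.1, hi'⟩

/-- As long as a good arm `i₀` of a bracket with a valid confidence interval has not been accepted,
every arm is pulled at most once after its upper confidence bound has dropped below the mean of
`i₀`. -/
theorem le_upper_bound (hrule : FollowsRule c δ μ₀ x A a) (hA : i₀ ∈ A r)
    (hS : i₀ ∉ suggested c δ μ₀ x A a t) {m₀ : ℝ} (hgood : ¬ Fails c m₀ δ (x i₀ r)) {i : Fin n}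
    (hT : 2 ≤ pulls a i r t) :
    m₀ ≤ empMean x i r (pulls a i r t - 1) + width c (pulls a i r t - 1) δ := by
  obtain ⟨s, hs, hcur, has, hps⟩ := exists_pull_of_lt (a := a) (i := i) (r := r) (t := t)
    (u := pulls a i r t - 1) (by omega)
  have hav : i₀ ∈ available c δ μ₀ x A a (s + 1) := by
    rw [available, Finset.mem_sdiff, hcur]
    exact ⟨hA, fun h => hS (suggested_mono (by omega) h)⟩
  have hcand := mem_candidates_of_pull hrule has
  unfold candidates at hcand
  split_ifs at hcand with hf
  · have := (Finset.mem_filter.1 hcand).2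
    rw [Nat.add_sub_cancel, hcur] at this
    omega
  · have hucb := (Finset.mem_filter.1 hcand).2 i₀ hav
    -- No arm is fresh in this round, so `i₀` has been observed and its valid interval applies.
    have h0 : 1 ≤ pulls a i₀ r s := by
      by_contra h
      refine hf ⟨i₀, Finset.mem_filter.2 ⟨hav, ?_⟩⟩
      rw [Nat.add_sub_cancel, hcur]
      omega
    unfold ucb at hucb
    rw [Nat.add_sub_cancel, hcur, hps] at hucb
    refine le_trans ?_ hucb
    have h1 : |empMean x i₀ r (pulls a i₀ r s) - m₀| < width c (pulls a i₀ r s) δ := by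
      by_contra h
      exact hgood ⟨_, h0, not_lt.1 h⟩
    linarith [(abs_lt.1 h1).1]

/-- The property that pins the constant of `exists_le_of_le_four_mul_width`. -/
def InvertsWidth (c K : ℝ) : Prop := 1 ≤ K ∧ ∀ (g q : ℝ) (T : ℕ), 0 < g → 0 < q → 1 ≤ T →
  g ≤ 4 * width c T q → (T : ℝ) ≤ K * ((g ^ 2)⁻¹ * tlog (tlog ((g ^ 2)⁻¹) / q))

variable {K : ℝ}

/-- Both widths are bounded by the one at the smaller level `q / 2 ^ d`; the power of two then
leaves the logarithm as the summand `d`. -/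
theorem InvertsWidth.le_of_le_add (hK : InvertsWidth c K) {g q : ℝ} {T d : ℕ}
    (hg : 0 < g) (hq : 0 < q) (hT : 1 ≤ T) {w w' : ℝ} (hw : w ≤ width c T (q / 2 ^ d))
    (hw' : w' ≤ width c T (q / 2 ^ d)) (h : g / 2 ≤ w + w') :
    (T : ℝ) ≤ K * ((g ^ 2)⁻¹ * (tlog (tlog ((g ^ 2)⁻¹) / q) + d)) := by
  have hK0 : 0 ≤ K := by linarith [hK.1]
  refine (hK.2 g (q / 2 ^ d) T hg (by positivity) hT (by linarith)).trans ?_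
  gcongr
  exact tlog_div_div_two_pow_le (tlog_pos _) hq d

/-- An arm whose mean is smaller than that of `i₀` is pulled only as often as needed to see this. -/
theorem pulls_le_of_upper (hK : InvertsWidth c K) (hc : 0 ≤ c) (hδ : 0 < δ)
    (hrule : FollowsRule c δ μ₀ x A a) (hA : i₀ ∈ A r)
    (hS : i₀ ∉ suggested c δ μ₀ x A a t) {m₀ m g : ℝ} (hgood : ¬ Fails c m₀ δ (x i₀ r))
    {i : Fin n} {d : ℕ} (hd : ¬ Fails c m (δ / 2 ^ d) (x i r)) (hg : 0 < g) (hgap : g / 2 ≤ m₀ - m) :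
    (pulls a i r t : ℝ) ≤ 1 + K * ((g ^ 2)⁻¹ * (tlog (tlog ((g ^ 2)⁻¹) / δ) + d)) := by
  have hK0 : 0 ≤ K := by linarith [hK.1]
  have hpos := tlog_pos (tlog ((g ^ 2)⁻¹) / δ)
  by_cases hT : 2 ≤ pulls a i r t
  · obtain ⟨u, hu⟩ : ∃ u, pulls a i r t = u + 1 := ⟨pulls a i r t - 1, by omega⟩
    have hu1 : 1 ≤ u := by omega
    have hup := le_upper_bound hrule hA hS hgood hT
    rw [hu, Nat.add_sub_cancel] at hup
    have h1 : |empMean x i r u - m| < width c u (δ / 2 ^ d) := by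
      by_contra h
      exact hd ⟨u, hu1, not_lt.1 h⟩
    have h2 : width c u δ ≤ width c u (δ / 2 ^ d) :=
      width_anti hc u (by positivity) (div_le_self hδ.le (one_le_pow₀ (by norm_num)))
    have := hK.le_of_le_add hg hδ hu1 h2 le_rfl (g := g)
      (by linarith [(abs_lt.1 h1).2])
    rw [hu]
    push_cast
    linarith
  · have h1 : (pulls a i r t : ℝ) ≤ 1 := by exact_mod_cast (by omega : pulls a i r t ≤ 1)
    have : 0 ≤ K * ((g ^ 2)⁻¹ * (tlog (tlog ((g ^ 2)⁻¹) / δ) + d)) := by positivity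
    linarith

/-- The lower confidence bound of an arm above the threshold passes the threshold in time. -/
theorem lower_bound_of_lt (hK : InvertsWidth c K) (hc : 0 ≤ c) {q m g : ℝ} (hq : 0 < q)
    (hqδ : q ≤ δ) {i : Fin n} {d u : ℕ} (hd : ¬ Fails c m (δ / 2 ^ d) (x i r)) (hg : 0 < g)
    (hgap : g / 2 ≤ m - μ₀) (hu1 : 1 ≤ u)
    (hu : K * ((g ^ 2)⁻¹ * (tlog (tlog ((g ^ 2)⁻¹) / q) + d)) < u) :
    μ₀ ≤ empMean x i r u - width c u q := by
  by_contra hlt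
  have h1 : |empMean x i r u - m| < width c u (δ / 2 ^ d) := by
    by_contra h
    exact hd ⟨u, hu1, not_lt.1 h⟩
  have h2 : width c u (δ / 2 ^ d) ≤ width c u (q / 2 ^ d) :=
    width_anti hc u (by positivity) (by gcongr)
  have h3 : width c u q ≤ width c u (q / 2 ^ d) :=
    width_anti hc u (by positivity) (div_le_self hq.le (one_le_pow₀ (by norm_num)))
  exact absurd hu (not_lt.2 (hK.le_of_le_add hg hq hu1 h2 h3
    (by linarith [(abs_lt.1 h1).1])))

/-- An arm above the threshold is pulled only as often as needed to accept it on its own. -/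
theorem pulls_le_of_lower (hK : InvertsWidth c K) (hc : 0 ≤ c) (hδ : 0 < δ) (hr : 1 ≤ r)
    (hrule : FollowsRule c δ μ₀ x A a) {m g : ℝ}
    {i : Fin n} (hi : i ∈ A r) {d : ℕ} (hd : ¬ Fails c m (δ / 2 ^ d) (x i r)) (hg : 0 < g)
    (hgap : g / 2 ≤ m - μ₀) :
    (pulls a i r t : ℝ) ≤ 1 + K * ((g ^ 2)⁻¹ *
      (tlog (tlog ((g ^ 2)⁻¹) / (1 / ((A r).card : ℝ) * bracketLevel' δ r)) + d)) := by
  have hK0 : 0 ≤ K := by linarith [hK.1]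
  have hpos := tlog_pos (tlog ((g ^ 2)⁻¹) / (1 / ((A r).card : ℝ) * bracketLevel' δ r))
  have hcard : (1 : ℝ) ≤ (A r).card := by exact_mod_cast Finset.card_pos.2 ⟨i, hi⟩
  have hq : 0 < 1 / ((A r).card : ℝ) * bracketLevel' δ r :=
    mul_pos (by positivity) (bracketLevel'_pos hδ hr)
  have hqδ : 1 / ((A r).card : ℝ) * bracketLevel' δ r ≤ δ := by
    refine le_trans ?_ (bracketLevel'_le_self hδ hr)
    refine mul_le_of_le_one_left (bracketLevel'_pos hδ hr).le ?_
    rw [div_le_one (by linarith)]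
    exact hcard
  have hnonneg : 0 ≤ K * ((g ^ 2)⁻¹ *
      (tlog (tlog ((g ^ 2)⁻¹) / (1 / ((A r).card : ℝ) * bracketLevel' δ r)) + d)) := by positivity
  by_contra hlt
  rw [not_le] at hlt
  have hT : 2 ≤ pulls a i r t := by
    have : (1 : ℝ) < pulls a i r t := by linarith
    exact_mod_cast this
  refine false_of_lower_bounds hc hδ hrule (G := {i}) (t := t) (by simpa using hi) (by simp)
    (by simpa using hT) ?_
  simp only [Finset.mem_singleton, forall_eq, Finset.card_singleton, Nat.cast_one]
  intro u hu1 hu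
  refine lower_bound_of_lt hK hc hq hqδ hd hg hgap hu1 ?_
  have : (pulls a i r t : ℝ) ≤ u + 1 := by exact_mod_cast (by omega : pulls a i r t ≤ u + 1)
  linarith

/-- If fewer than `p` members exceed `N p`, for every `p ≥ 1`, then the sum is at most the sum of
the `N p`. -/
theorem sum_le_sum_of_card_lt {ι : Type*} {f : ι → ℝ} {N : ℕ → ℝ} (s : Finset ι)
    (h : ∀ t ⊆ s, t.Nonempty → ∃ i ∈ t, f i ≤ N t.card) :
    ∑ i ∈ s, f i ≤ ∑ p ∈ Finset.Icc 1 s.card, N p := by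
  classical
  induction hk : s.card generalizing s with
  | zero =>
    rw [Finset.card_eq_zero.1 hk]
    simp
  | succ k ih =>
    -- The member found for the whole set is charged to the index `s.card` and removed, so the
    -- values need not be sorted.
    obtain ⟨i, hi, hfi⟩ := h s subset_rfl (Finset.card_pos.1 (by omega))
    have h1 := ih (s.erase i) (fun t ht => h t (ht.trans (Finset.erase_subset i s)))
      (by rw [Finset.card_erase_of_mem hi]; omega)
    rw [← Finset.add_sum_erase s f hi, Finset.sum_Icc_succ_top (by omega)]
    rw [hk] at hfi
    linarith

theorem prod_Icc_cast_eq_factorial (M : ℕ) : ∏ p ∈ Finset.Icc 1 M, (p : ℝ) = M.factorial := by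
  induction M with
  | zero => simp
  | succ M ih =>
    rw [Finset.prod_Icc_succ_top (by omega), ih, Nat.factorial_succ]
    push_cast
    ring

/-- The sum is `log (M ^ M / M!)`, and `M ^ M / M!` is a single term of the series of `exp M`. So
the levels `p / M` cost a constant per arm on average instead of `log M`. -/
theorem sum_log_div_le (M : ℕ) : ∑ p ∈ Finset.Icc 1 M, Real.log ((M : ℝ) / p) ≤ M := by
  rcases Nat.eq_zero_or_pos M with rfl | hM
  · simp
  have hM' : (0 : ℝ) < M := by exact_mod_cast hM
  have h1 : ∑ p ∈ Finset.Icc 1 M, Real.log ((M : ℝ) / p) =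
      Real.log ((M : ℝ) ^ M / (M.factorial : ℝ)) := by
    rw [← Real.log_prod, Finset.prod_div_distrib]
    · congr 2
      · simp
      · exact prod_Icc_cast_eq_factorial M
    · intro p hp
      have : (0 : ℝ) < p := by exact_mod_cast (Finset.mem_Icc.1 hp).1
      positivity
  rw [h1]
  calc _ ≤ Real.log (Real.exp M) := Real.log_le_log (by positivity)
        (Real.pow_div_factorial_le_exp _ hM'.le M)
    _ = M := Real.log_exp _

theorem sum_tlog_le {X : ℝ} (hX : 0 < X) {h M : ℕ} (hM : h ≤ M) :
    ∑ p ∈ Finset.Icc 1 h, tlog (X * ((M : ℝ) / p)) ≤ 2 * M * tlog X := by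
  have h1 : ∀ p ∈ Finset.Icc 1 M,
      tlog (X * ((M : ℝ) / p)) ≤ tlog X + Real.log ((M : ℝ) / p) := by
    intro p hp
    obtain ⟨hp1, hp2⟩ := Finset.mem_Icc.1 hp
    have hp0 : (0 : ℝ) < p := by exact_mod_cast hp1
    have h2 : (1 : ℝ) ≤ (M : ℝ) / p := by
      rw [one_le_div hp0]
      exact_mod_cast hp2
    have h3 := Real.log_nonneg h2
    refine max_le ?_ (by linarith [one_le_tlog X])
    rw [Real.log_mul hX.ne' (by linarith)]
    linarith [log_le_tlog X]
  calc ∑ p ∈ Finset.Icc 1 h, tlog (X * ((M : ℝ) / p))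
      ≤ ∑ p ∈ Finset.Icc 1 M, tlog (X * ((M : ℝ) / p)) :=
        Finset.sum_le_sum_of_subset_of_nonneg (Finset.Icc_subset_Icc_right hM)
          fun p _ _ => (tlog_pos _).le
    _ ≤ ∑ p ∈ Finset.Icc 1 M, (tlog X + Real.log ((M : ℝ) / p)) := Finset.sum_le_sum h1
    _ ≤ M * tlog X + M := by
        rw [Finset.sum_add_distrib]
        simpa using sum_log_div_le M
    _ ≤ 2 * M * tlog X := by nlinarith [one_le_tlog X, Nat.cast_nonneg (α := ℝ) M]

/-- Gap-dependent bound on the number of rounds in a bracket that contains a good arm `i₀` which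
has not been accepted. -/
theorem visits_le_gap (hK : InvertsWidth c K) (hc : 0 ≤ c) (hδ : 0 < δ) (hr : 1 ≤ r)
    (hrule : FollowsRule c δ μ₀ x A a) (hA : i₀ ∈ A r)
    (hS : i₀ ∉ suggested c δ μ₀ x A a t) {m : Fin n → ℝ} {b : ℝ} (hb : μ₀ < b) (hb' : b ≤ m i₀)
    (hgood : ¬ Fails c (m i₀) δ (x i₀ r)) {d : Fin n → ℕ}
    (hd : ∀ i ∈ A r, ¬ Fails c (m i) (δ / 2 ^ d i) (x i r)) {w κ : Fin n → ℝ}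
    (h₁ : ∀ i ∈ A r, μ₀ < m i → κ i = K * (max (m i - μ₀) (b - μ₀) ^ 2)⁻¹ ∧
      1 + κ i * tlog (tlog ((max (m i - μ₀) (b - μ₀) ^ 2)⁻¹) /
        (1 / ((A r).card : ℝ) * bracketLevel' δ r)) ≤ w i)
    (h₀ : ∀ i ∈ A r, m i ≤ μ₀ → κ i = K * ((b - m i) ^ 2)⁻¹ ∧
      1 + κ i * tlog (tlog (((b - m i) ^ 2)⁻¹) / δ) ≤ w i) :
    (visits r t : ℝ) ≤ ∑ i ∈ A r, (w i + κ i * d i) := by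
  have hv := visits_le_sum_pulls (a := a) (r := r) (t := t) (B := A r) fun s hs hcur =>
    exists_pull_of_notMem hrule hA hS hs hcur
  refine le_trans (by exact_mod_cast hv : (visits r t : ℝ) ≤ ((∑ i ∈ A r, pulls a i r t : ℕ) : ℝ)) ?_
  push_cast
  refine Finset.sum_le_sum fun i hi => ?_
  rcases le_or_gt (m i) μ₀ with hm | hm
  · obtain ⟨e, hw⟩ := h₀ i hi hm
    have := pulls_le_of_upper (t := t) hK hc hδ hrule hA hS hgood (hd i hi)
      (show 0 < b - m i by linarith) (by linarith)
    rw [e] at hw ⊢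
    linarith
  · obtain ⟨e, hw⟩ := h₁ i hi hm
    set g := max (m i - μ₀) (b - μ₀) with hg
    have hg0 : 0 < g := lt_max_of_lt_right (by linarith)
    -- Either arm `i` is at least `g / 2` above the threshold and gets accepted on its own, or `g =
    -- b - μ₀` and `m i` lies more than `g / 2` below `b ≤ m i₀`, so that the upper bounds stop its
    -- pulls.
    by_cases hcase : g / 2 ≤ m i - μ₀
    · have := pulls_le_of_lower (t := t) hK hc hδ hr hrule hi (hd i hi) hg0 hcase
      rw [e] at hw ⊢
      linarith
    · have hgb : g = b - μ₀ := by
        rcases max_choice (m i - μ₀) (b - μ₀) with h | h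
        · rw [← hg] at h
          linarith
        · exact h
      have := pulls_le_of_upper (t := t) hK hc hδ hrule hA hS hgood (hd i hi) hg0 (by linarith)
      have hcard : (1 : ℝ) ≤ (A r).card := by exact_mod_cast Finset.card_pos.2 ⟨i, hi⟩
      have hK0 : 0 ≤ K := by linarith [hK.1]
      have hbl := bracketLevel'_pos hδ hr
      have hle : tlog (tlog ((g ^ 2)⁻¹) / δ) ≤
          tlog (tlog ((g ^ 2)⁻¹) / (1 / ((A r).card : ℝ) * bracketLevel' δ r)) := by
        have h5 := tlog_pos ((g ^ 2)⁻¹)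
        refine tlog_mono (by positivity) (div_le_div_of_nonneg_left h5.le (by positivity) ?_)
        refine le_trans ?_ (bracketLevel'_le_self hδ hr)
        refine mul_le_of_le_one_left hbl.le ?_
        rw [div_le_one (by linarith)]
        exact hcard
      have hle' := mul_le_mul_of_nonneg_left hle (show 0 ≤ K * (g ^ 2)⁻¹ by positivity)
      rw [e] at hw ⊢
      linarith

/-- Gap-independent bound on the number of rounds in a bracket that contains a good arm `i₀` which
has not been accepted. -/
theorem visits_le_uniform (hK : InvertsWidth c K) (hc : 0 ≤ c) (hδ : 0 < δ) (hr : 1 ≤ r)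
    (hrule : FollowsRule c δ μ₀ x A a) (hA : i₀ ∈ A r)
    (hS : i₀ ∉ suggested c δ μ₀ x A a t) {m : Fin n → ℝ} {g : ℝ} (hg : 0 < g) (hg1 : g ≤ 1)
    (hb : μ₀ + g ≤ m i₀)
    (hgood : ¬ Fails c (m i₀) δ (x i₀ r)) {d : Fin n → ℕ}
    (hd : ∀ i ∈ A r, ¬ Fails c (m i) (δ / 2 ^ d i) (x i r)) :
    (visits r t : ℝ) ≤ ∑ i ∈ A r, (4 * (K * (g ^ 2)⁻¹) *
      tlog (tlog ((g ^ 2)⁻¹) / bracketLevel' δ r) + K * (g ^ 2)⁻¹ * d i) := by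
  classical
  have hv := visits_le_sum_pulls (a := a) (r := r) (t := t) (B := A r) fun s hs hcur =>
    exists_pull_of_notMem hrule hA hS hs hcur
  refine le_trans (by exact_mod_cast hv : (visits r t : ℝ) ≤ ((∑ i ∈ A r, pulls a i r t : ℕ) : ℝ)) ?_
  push_cast
  set G := (g ^ 2)⁻¹ with hG
  have hG1 : 1 ≤ G := (one_le_inv₀ (by positivity)).2 (by nlinarith)
  have hK1 := hK.1
  have hbl := bracketLevel'_pos hδ hr
  have hlG := tlog_pos G
  set X := tlog G / bracketLevel' δ r with hX
  have hX0 : 0 < X := by positivity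
  have hX1 := one_le_tlog X
  have hKG : 1 ≤ K * G := by nlinarith
  set M := (A r).card with hM
  -- The pulls beyond the first one and beyond the allowance for failing intervals; what remains
  -- depends on the arm only through the level.
  set f : Fin n → ℝ := fun i => (pulls a i r t : ℝ) - 1 - K * G * d i with hf
  have hlow : ∑ i ∈ (A r).filter (fun i => ¬ g / 2 ≤ m i - μ₀), f i ≤
      M * (K * G * tlog X) := by
    have h1 : ∀ i ∈ (A r).filter (fun i => ¬ g / 2 ≤ m i - μ₀), f i ≤ K * G * tlog X := by
      intro i hi
      obtain ⟨hi, hlt⟩ := Finset.mem_filter.1 hi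
      have := pulls_le_of_upper (t := t) hK hc hδ hrule hA hS hgood (hd i hi) hg (by linarith)
      have hle : tlog (tlog G / δ) ≤ tlog X := tlog_mono (by positivity)
        (div_le_div_of_nonneg_left hlG.le hbl (bracketLevel'_le_self hδ hr))
      have hle' := mul_le_mul_of_nonneg_left hle (show 0 ≤ K * G by positivity)
      simp only [hf]
      linarith
    refine (Finset.sum_le_card_nsmul _ _ _ h1).trans ?_
    rw [nsmul_eq_mul]
    have hcard : (((A r).filter (fun i => ¬ g / 2 ≤ m i - μ₀)).card : ℝ) ≤ M := by
      exact_mod_cast Finset.card_filter_le _ _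
    gcongr
  have hhigh : ∑ i ∈ (A r).filter (fun i => g / 2 ≤ m i - μ₀), f i ≤
      K * G * (2 * M * tlog X) := by
    -- Among any `p` arms well above the threshold, one has at most the number of pulls needed at
    -- level `p / M`: otherwise all `p` lower bounds would have passed and the arms would have been
    -- accepted together.
    refine (sum_le_sum_of_card_lt (N := fun p => K * G * tlog (X * ((M : ℝ) / p))) _ ?_).trans ?_
    · intro B hB hne
      by_contra hcon
      push Not at hcon
      have hBA : B ⊆ A r := hB.trans (Finset.filter_subset _ _)
      have hB0 : (0 : ℝ) < B.card := by exact_mod_cast Finset.card_pos.2 hne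
      have hM0 : (0 : ℝ) < M := by
        have : B.card ≤ M := Finset.card_le_card hBA
        have : (B.card : ℝ) ≤ M := by exact_mod_cast this
        linarith
      set q := (B.card : ℝ) / M * bracketLevel' δ r with hq
      have hq0 : 0 < q := by positivity
      have hqδ : q ≤ δ := by
        refine le_trans (mul_le_of_le_one_left hbl.le ?_) (bracketLevel'_le_self hδ hr)
        rw [div_le_one hM0]
        exact_mod_cast Finset.card_le_card hBA
      have hXq : X * ((M : ℝ) / B.card) = tlog G / q := by
        rw [hX, hq]
        field_simp
      rw [hXq] at hcon
      have hpos := tlog_pos (tlog G / q)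
      have hlarge : ∀ i ∈ B, 1 + K * (G * (tlog (tlog G / q) + d i)) < pulls a i r t := by
        intro i hi
        have := hcon i hi
        simp only [hf] at this
        linarith
      refine false_of_lower_bounds hc hδ hrule (t := t) hBA hne (fun i hi => ?_)
        fun i hi u hu1 hu => ?_
      · have h1 : (1 : ℝ) < pulls a i r t := by
          have : 0 ≤ K * (G * (tlog (tlog G / q) + d i)) := by positivity
          linarith [hlarge i hi]
        exact_mod_cast h1
      · refine lower_bound_of_lt hK hc hq0 hqδ (hd i (hBA hi)) hg
          (Finset.mem_filter.1 (hB hi)).2 hu1 ?_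
        have : (pulls a i r t : ℝ) ≤ u + 1 := by
          exact_mod_cast (by omega : pulls a i r t ≤ u + 1)
        linarith [hlarge i hi]
    · rw [← Finset.mul_sum]
      exact mul_le_mul_of_nonneg_left (sum_tlog_le hX0 (Finset.card_filter_le _ _)) (by linarith)
  have hsum : ∑ i ∈ A r, f i ≤ 3 * M * (K * G * tlog X) := by
    rw [← Finset.sum_filter_add_sum_filter_not (A r) (fun i => g / 2 ≤ m i - μ₀)]
    linarith
  have e : ∑ i ∈ A r, (pulls a i r t : ℝ) = ∑ i ∈ A r, f i + ∑ i ∈ A r, (1 + K * G * d i) := by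
    rw [← Finset.sum_add_distrib]
    refine Finset.sum_congr rfl fun i _ => ?_
    simp only [hf]
    ring
  rw [e, Finset.sum_add_distrib, Finset.sum_add_distrib]
  simp only [Finset.sum_const, nsmul_eq_mul, mul_one]
  rw [← hM]
  have : (M : ℝ) ≤ M * (K * G * tlog X) := by
    refine le_mul_of_one_le_right (Nat.cast_nonneg _) ?_
    nlinarith
  linarith

end PathLemmas

/-! ### Uniformly random brackets -/

theorem card_filter_subset_powersetCard {n M : ℕ} (I : Finset (Fin n)) (hI : I.card ≤ M) :
    ((Finset.powersetCard M Finset.univ).filter fun B : Finset (Fin n) => I ⊆ B).card =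
      (n - I.card).choose (M - I.card) := by
  have h : (n - I.card).choose (M - I.card) =
      (Finset.powersetCard (M - I.card) (Finset.univ \ I)).card := by
    rw [Finset.card_powersetCard, Finset.card_sdiff_of_subset (Finset.subset_univ I),
      Finset.card_univ, Fintype.card_fin]
  rw [h]
  refine Finset.card_nbij' (fun B => B \ I) (fun B => B ∪ I) ?_ ?_ ?_ ?_
  · intro B hB
    simp only [Finset.coe_filter, Set.mem_ofPred_eq, Finset.mem_powersetCard] at hB
    simp only [Finset.mem_coe, Finset.mem_powersetCard]
    refine ⟨Finset.sdiff_subset_sdiff (Finset.subset_univ B) subset_rfl, ?_⟩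
    rw [Finset.card_sdiff_of_subset hB.2, hB.1.2]
  · intro B hB
    simp only [Finset.mem_coe, Finset.mem_powersetCard] at hB
    simp only [Finset.coe_filter, Set.mem_ofPred_eq, Finset.mem_powersetCard]
    refine ⟨⟨Finset.subset_univ _, ?_⟩, Finset.subset_union_right⟩
    rw [Finset.card_union_of_disjoint, hB.2]
    · omega
    · exact Finset.disjoint_of_subset_left hB.1 Finset.sdiff_disjoint
  · intro B hB
    simp only [Finset.coe_filter, Set.mem_ofPred_eq] at hB
    exact Finset.sdiff_union_of_subset hB.2
  · intro B hB
    simp only [Finset.mem_coe, Finset.mem_powersetCard] at hB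
    exact Finset.union_sdiff_cancel_right
      (Finset.disjoint_of_subset_left hB.1 Finset.sdiff_disjoint)

theorem natCast_mul_inv_eq_ofReal (a : ℕ) {b : ℕ} (hb : 0 < b) :
    (a : ℝ≥0∞) * (b : ℝ≥0∞)⁻¹ = ENNReal.ofReal ((a : ℝ) / b) := by
  rw [ENNReal.ofReal_div_of_pos (by exact_mod_cast hb), ENNReal.ofReal_natCast,
    ENNReal.ofReal_natCast, div_eq_mul_inv]

theorem one_le_bracketSize {n : ℕ} (hn : 1 ≤ n) (r : ℕ) : 1 ≤ bracketSize n r :=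
  le_min hn Nat.one_le_two_pow

namespace Run

variable {n : ℕ} {ν : Fin n → Measure ℝ} {c δ μ₀ : ℝ} {Ω : Type*} [MeasurableSpace Ω]
  {P : Measure Ω}

theorem measurableSet_A (ρ : Run ν c δ μ₀ P) (r : ℕ) (𝒬 : Set (Finset (Fin n))) :
    MeasurableSet {ω | ρ.A r ω ∈ 𝒬} := ρ.measurable_A r 𝒬.to_countable.measurableSet

theorem measure_A_mem (ρ : Run ν c δ μ₀ P) {r : ℕ} (hr : 1 ≤ r) (𝒬 : Finset (Finset (Fin n)))
    (h : 𝒬 ⊆ Finset.powersetCard (bracketSize n r) Finset.univ) :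
    P {ω | ρ.A r ω ∈ 𝒬} = ENNReal.ofReal ((𝒬.card : ℝ) / n.choose (bracketSize n r)) := by
  have e : {ω | ρ.A r ω ∈ 𝒬} = ⋃ B ∈ 𝒬, {ω | ρ.A r ω = B} := by
    ext ω
    simp
  rw [e, measure_biUnion_finset]
  · rw [Finset.sum_congr rfl fun B hB =>
      ρ.law_A r hr B (Finset.mem_powersetCard.1 (h hB)).2]
    rw [Finset.sum_const, nsmul_eq_mul]
    exact natCast_mul_inv_eq_ofReal _ (Nat.choose_pos (min_le_left _ _))
  · intro B _ B' _ hBB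
    refine Set.disjoint_left.2 fun ω h1 h2 => hBB ?_
    rw [Set.mem_ofPred_eq] at h1 h2
    rw [← h1, h2]
  · exact fun B _ => ρ.measurableSet_A r {B}

theorem measurable_X_path (ρ : Run ν c δ μ₀ P) (i : Fin n) (r : ℕ) :
    Measurable fun ω (s : ℕ) => ρ.X i r s ω :=
  measurable_pi_lambda _ fun s => ρ.measurable_X i r s

/-- The brackets are independent of the observations. -/
theorem lintegral_indicator_A_mul (ρ : Run ν c δ μ₀ P) (r : ℕ) (𝒬 : Set (Finset (Fin n)))
    (i : Fin n) {g : (ℕ → ℝ) → ℝ≥0∞} (hg : Measurable g) :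
    ∫⁻ ω, {ω | ρ.A r ω ∈ 𝒬}.indicator 1 ω * g (fun s => ρ.X i r s ω) ∂P =
      P {ω | ρ.A r ω ∈ 𝒬} * ∫⁻ ω, g (fun s => ρ.X i r s ω) ∂P := by
  have h1 : Measurable fun B : ℕ → Finset (Fin n) => 𝒬.indicator (1 : Finset (Fin n) → ℝ≥0∞) (B r) :=
    (measurable_of_countable (𝒬.indicator (1 : Finset (Fin n) → ℝ≥0∞))).comp
      (measurable_pi_apply r)
  have h2 : Measurable fun y : Fin n × ℕ × ℕ → ℝ => g fun s => y (i, r, s) :=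
    hg.comp (measurable_pi_lambda _ fun s => measurable_pi_apply _)
  have hind := (ρ.indep_X_A.comp h2 h1).symm
  have hmA : Measurable fun (ω : Ω) (r : ℕ) => ρ.A r ω :=
    measurable_pi_lambda _ fun r => ρ.measurable_A r
  have hmX : Measurable fun (ω : Ω) (q : Fin n × ℕ × ℕ) => ρ.X q.1 q.2.1 q.2.2 ω :=
    measurable_pi_lambda _ fun q => ρ.measurable_X _ _ _
  have := lintegral_mul_eq_lintegral_mul_lintegral_of_indepFun (h1.comp hmA) (h2.comp hmX) hind
  have e : ∫⁻ ω, {ω | ρ.A r ω ∈ 𝒬}.indicator (1 : Ω → ℝ≥0∞) ω ∂P = P {ω | ρ.A r ω ∈ 𝒬} := by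
    rw [lintegral_indicator (ρ.measurableSet_A r 𝒬)]
    simp
  rw [← e]
  exact this

variable [IsProbabilityMeasure P]

theorem ae_card_A (ρ : Run ν c δ μ₀ P) {r : ℕ} (hr : 1 ≤ r) :
    ∀ᵐ ω ∂P, (ρ.A r ω).card = bracketSize n r := by
  have h := ρ.measure_A_mem hr _ subset_rfl
  have h0 : (0 : ℝ) < n.choose (bracketSize n r) := by
    exact_mod_cast Nat.choose_pos (min_le_left _ _)
  rw [Finset.card_powersetCard, Finset.card_univ, Fintype.card_fin, div_self h0.ne',
    ENNReal.ofReal_one] at h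
  have h' := (prob_compl_eq_zero_iff (ρ.measurableSet_A r
    (Finset.powersetCard (bracketSize n r) Finset.univ : Finset (Finset (Fin n))))).2 h
  filter_upwards [measure_eq_zero_iff_ae_notMem.1 h'] with ω hω
  simpa using hω

theorem measure_subset_A (ρ : Run ν c δ μ₀ P) {r : ℕ} (hr : 1 ≤ r) (I : Finset (Fin n)) :
    P {ω | I ⊆ ρ.A r ω} = ENNReal.ofReal
      (((Finset.powersetCard (bracketSize n r) Finset.univ).filter
        fun B : Finset (Fin n) => I ⊆ B).card / n.choose (bracketSize n r)) := by
  rw [← ρ.measure_A_mem hr _ (Finset.filter_subset _ _)]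
  refine measure_congr ?_
  filter_upwards [ρ.ae_card_A hr] with ω hω
  refine propext ⟨fun h => ?_, fun h => ?_⟩
  · exact Finset.mem_filter.2 ⟨Finset.mem_powersetCard.2 ⟨Finset.subset_univ _, hω⟩, h⟩
  · exact (Finset.mem_filter.1 h).2

theorem choose_pred_div_choose {n M : ℕ} (hM : 1 ≤ M) (hMn : M ≤ n) :
    ((n - 1).choose (M - 1) : ℝ) / n.choose M = M / n := by
  have h0 : (0 : ℝ) < n.choose M := by exact_mod_cast Nat.choose_pos hMn
  have hn : (0 : ℝ) < n := by exact_mod_cast (by omega : 0 < n)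
  rw [div_eq_div_iff h0.ne' hn.ne']
  have h := Nat.add_one_mul_choose_eq (n - 1) (M - 1)
  rw [Nat.sub_add_cancel hM, Nat.sub_add_cancel (hM.trans hMn)] at h
  have h' : ((n * (n - 1).choose (M - 1) : ℕ) : ℝ) = (n.choose M * M : ℕ) := by rw [h]
  push_cast at h'
  linarith

theorem measure_mem_A (ρ : Run ν c δ μ₀ P) {r : ℕ} (hr : 1 ≤ r) (i : Fin n) :
    P {ω | i ∈ ρ.A r ω} = ENNReal.ofReal ((bracketSize n r : ℝ) / n) := by
  have hM := one_le_bracketSize (Fin.pos i) r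
  have h := ρ.measure_subset_A hr {i}
  rw [card_filter_subset_powersetCard _ (by simpa using hM), Finset.card_singleton,
    choose_pred_div_choose hM (min_le_left _ _)] at h
  simpa using h

/-- Sampling without replacement: given that one arm is drawn, the other is drawn with probability
`(M - 1) / (n - 1) ≤ M / n`. A bracket with a single arm contains no pair. -/
theorem measure_pair_mem_A_le (ρ : Run ν c δ μ₀ P) {r : ℕ} (hr : 1 ≤ r) {i i' : Fin n}
    (hne : i ≠ i') : P {ω | i ∈ ρ.A r ω ∧ i' ∈ ρ.A r ω} ≤
      ENNReal.ofReal (((bracketSize n r : ℝ) / n) ^ 2) := by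
  have hM := one_le_bracketSize (Fin.pos i) r
  have hMn : bracketSize n r ≤ n := min_le_left _ _
  have hcard : ({i, i'} : Finset (Fin n)).card = 2 := Finset.card_pair hne
  have h := ρ.measure_subset_A hr {i, i'}
  have e : {ω | ({i, i'} : Finset (Fin n)) ⊆ ρ.A r ω} =
      {ω | i ∈ ρ.A r ω ∧ i' ∈ ρ.A r ω} := by
    ext ω
    simp [Finset.insert_subset_iff]
  rw [e] at h
  rw [h]
  refine ENNReal.ofReal_le_ofReal ?_
  set M := bracketSize n r
  have hn : (0 : ℝ) < n := by exact_mod_cast Fin.pos i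
  rcases Nat.lt_or_ge 1 M with h2 | h2
  · rw [card_filter_subset_powersetCard _ (by omega), hcard]
    have h1 := choose_pred_div_choose hM hMn
    have h3 := choose_pred_div_choose (show 1 ≤ M - 1 by omega) (show M - 1 ≤ n - 1 by omega)
    have h4 : (0 : ℝ) < (n - 1).choose (M - 1) := by
      exact_mod_cast Nat.choose_pos (show M - 1 ≤ n - 1 by omega)
    have h5 : ((n - 2).choose (M - 2) : ℝ) / n.choose M =
        ((n - 1 - 1).choose (M - 1 - 1) : ℝ) / (n - 1).choose (M - 1) *
          (((n - 1).choose (M - 1) : ℝ) / n.choose M) := by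
      rw [show n - 1 - 1 = n - 2 by omega, show M - 1 - 1 = M - 2 by omega]
      field_simp
    rw [h5, h1, h3, sq]
    refine mul_le_mul_of_nonneg_right ?_ (by positivity)
    have hMr : (M : ℝ) ≤ n := by exact_mod_cast hMn
    have hn1 : (1 : ℝ) < n := by exact_mod_cast (by omega : 1 < n)
    rw [Nat.cast_sub hM, Nat.cast_sub (by omega), Nat.cast_one,
      div_le_div_iff₀ (by linarith) hn]
    nlinarith
  · rw [Finset.filter_eq_empty_iff.2]
    · simp
      positivity
    · intro B hB hsub
      have := Finset.card_le_card hsub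
      have := (Finset.mem_powersetCard.1 hB).2
      omega

theorem measure_fails_le (ρ : Run ν c δ μ₀ P)
    (hν : ∀ i, HasSubgaussianMGF (fun y : ℝ => y - mean ν i) 1 (ν i)) (hc : 4 ≤ c) {q : ℝ}
    (hq : 0 < q) (hq1 : q ≤ 0.025) (i : Fin n) (r : ℕ) :
    P {ω | Fails c (mean ν i) q fun s => ρ.X i r s ω} ≤ ENNReal.ofReal (q ^ 2) := by
  refine InfiniteUCB.measure_fails_le hc hq hq1 (ρ.measurable_X i r) ?_ (fun s => ?_) fun s => ?_
  · exact ρ.indep_X.precomp (g := fun s : ℕ => (i, r, s)) fun s s' h => by simpa using h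
  · have h := hν i
    rw [← ρ.law_X i r s] at h
    exact HasSubgaussianMGF.of_map (ρ.measurable_X i r s).aemeasurable h
  · have h := integral_map (μ := P) (ρ.measurable_X i r s).aemeasurable
      (f := fun y : ℝ => y) aestronglyMeasurable_id
    rw [ρ.law_X i r s] at h
    exact h.symm

end Run

/-! ### The false discovery rate -/

theorem sum_Icc_inv_sq_le (R : ℕ) : ∑ r ∈ Finset.Icc 1 R, 1 / (r : ℝ) ^ 2 ≤ 2 := by
  have e : ∑ r ∈ Finset.Icc 1 R, 1 / (r : ℝ) ^ 2 =
      ∑ b ∈ Finset.range R, 1 / ((b : ℝ) + 1) ^ 2 := by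
    induction R with
    | zero => simp
    | succ R ih =>
      rw [Finset.sum_Icc_succ_top (by omega), ih, Finset.sum_range_succ]
      push_cast
      rfl
  rw [e]
  exact (summable_inv_sq_succ.sum_le_tsum _ fun b _ => by positivity).trans tsum_inv_sq_succ_le

/-- The weight of a sequence of observations in a bracket of `M` arms: it is at least `1 / p`
whenever the confidence interval of level `(p / M) δ'` fails. -/
noncomputable def fdrWeight (c μ δ' : ℝ) (M : ℕ) (y : ℕ → ℝ) : ℝ≥0∞ :=
  ∑ p ∈ Finset.Icc 1 M, {y | Fails c μ ((p : ℝ) / M * δ') y}.indicator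
      (fun _ => ENNReal.ofReal (1 / ((p : ℝ) * (p + 1)))) y +
    {y | Fails c μ δ' y}.indicator (fun _ => ENNReal.ofReal (1 / ((M : ℝ) + 1))) y

theorem measurable_fdrWeight (c μ δ' : ℝ) (M : ℕ) : Measurable (fdrWeight c μ δ' M) :=
  (Finset.measurable_sum _ fun _ _ => measurable_const.indicator (measurableSet_fails _ _ _)).add
    (measurable_const.indicator (measurableSet_fails _ _ _))

theorem sum_Icc_inv_mul_succ {p M : ℕ} (hp : 1 ≤ p) (hpM : p ≤ M) :
    ∑ q ∈ Finset.Icc p M, 1 / ((q : ℝ) * (q + 1)) + 1 / ((M : ℝ) + 1) = 1 / p := by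
  have hp0 : (0 : ℝ) < p := by exact_mod_cast hp
  induction M, hpM using Nat.le_induction with
  | base =>
    simp only [Finset.Icc_self, Finset.sum_singleton]
    field_simp
    ring
  | succ M hM ih =>
    rw [Finset.sum_Icc_succ_top (by omega)]
    have hM0 : (0 : ℝ) ≤ M := Nat.cast_nonneg M
    have h : 1 / (((M + 1 : ℕ) : ℝ) * ((M + 1 : ℕ) + 1)) + 1 / (((M + 1 : ℕ) : ℝ) + 1) =
        1 / ((M : ℝ) + 1) := by
      push_cast
      field_simp
      ring
    rw [add_assoc, h, ih]

/-- An interval failing at index `p` fails at every larger index, and the weights from `p` on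
telescope to `1 / p`. The random index is thus traded for events that do not depend on the pulls. -/
theorem le_fdrWeight {c μ δ' : ℝ} (hc : 0 ≤ c) (hδ : 0 < δ') {p M : ℕ} (hp : 1 ≤ p) (hpM : p ≤ M)
    {y : ℕ → ℝ} (h : Fails c μ ((p : ℝ) / M * δ') y) :
    ENNReal.ofReal (1 / p) ≤ fdrWeight c μ δ' M y := by
  have hp0 : (0 : ℝ) < p := by exact_mod_cast hp
  have hM0 : (0 : ℝ) < M := by exact_mod_cast hp.trans hpM
  rw [← sum_Icc_inv_mul_succ hp hpM, ENNReal.ofReal_add (Finset.sum_nonneg fun q _ => by positivity)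
    (by positivity), ENNReal.ofReal_sum_of_nonneg fun q _ => by positivity]
  refine add_le_add ?_ ?_
  · refine le_trans (Finset.sum_le_sum fun q hq => ?_)
      (Finset.sum_le_sum_of_subset (Finset.Icc_subset_Icc_left hp))
    rw [Set.indicator_of_mem]
    refine h.mono hc (by positivity) ?_
    have : (p : ℝ) ≤ q := by exact_mod_cast (Finset.mem_Icc.1 hq).1
    gcongr
  · rw [Set.indicator_of_mem]
    refine h.mono hc (by positivity) (mul_le_of_le_one_left hδ.le ?_)
    rw [div_le_one hM0]
    exact_mod_cast hpM

/-! ### Pathwise control of the false discovery proportion -/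

section FDR

variable {n : ℕ} {c δ μ₀ : ℝ} {x : Fin n → ℕ → ℕ → ℝ} {A : ℕ → Finset (Fin n)}
  {a : ℕ → Option (Fin n)}

/-- A falsely accepted arm has a failing confidence interval at a level that is controlled by the
number of accepted arms. -/
theorem exists_fails_of_mem_suggested {t : ℕ} {i : Fin n} {m : ℝ} (hm : m ≤ μ₀)
    (hi : i ∈ suggested c δ μ₀ x A a t) : ∃ r p, 1 ≤ r ∧ r ≤ numOpen t ∧ i ∈ A r ∧ 1 ≤ p ∧
      p ≤ (A r).card ∧ p ≤ (suggested c δ μ₀ x A a t).card ∧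
      Fails c m ((p : ℝ) / ((A r).card : ℝ) * bracketLevel' δ r) (x i r) := by
  induction t with
  | zero => simp [suggested] at hi
  | succ t ih =>
    rcases Finset.mem_union.1 (show i ∈ suggested c δ μ₀ x A a t ∪ accepted c δ μ₀ x A a t from hi)
      with h | h
    · obtain ⟨r, p, h1, h2, h3, h4, h5, h6, h7⟩ := ih h
      exact ⟨r, p, h1, h2.trans (numOpen_mono (Nat.le_succ t)), h3, h4, h5,
        h6.trans (Finset.card_le_card (suggested_mono (Nat.le_succ t))), h7⟩
    · have hsub : accepted c δ μ₀ x A a t ⊆ suggested c δ μ₀ x A a (t + 1) :=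
        Finset.subset_union_right
      have hcard := Finset.card_le_card hsub
      unfold accepted at h hcard
      split_ifs at h hcard with hne
      · have hmax := (levels c δ μ₀ x A a t).max'_mem hne
        set p := (levels c δ μ₀ x A a t).max' hne
        obtain ⟨hp, hle⟩ := Finset.mem_filter.1 hmax
        rw [Finset.mem_Icc] at hp
        obtain ⟨hiA, hpos, hlcb⟩ := mem_levelSet.1 h
        have ht : 1 ≤ t := by
          by_contra ht
          have : t = 0 := by omega
          subst this
          simp [pulls] at hpos
        refine ⟨current t, p, one_le_current ht,
          (current_le_numOpen t).trans (numOpen_mono (Nat.le_succ t)), hiA, hp.1, hp.2,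
          hle.trans hcard, pulls a i (current t) t, hpos, ?_⟩
        refine le_trans ?_ (le_abs_self _)
        unfold empMean at hlcb
        linarith
      · simp at h

/-- Each false discovery has a share of at most `1 / p` for some failing index `p ≤ |S|`, hence at
most its weight. The bound involves only brackets and observations, which are independent. -/
theorem fdp_le (hc : 0 ≤ c) (hδ : 0 < δ) {t : ℕ} {m : Fin n → ℝ} {H : Finset (Fin n)}
    (hH : ∀ i ∈ H, m i ≤ μ₀) :
    ENNReal.ofReal (((suggested c δ μ₀ x A a t ∩ H).card : ℝ) /
      (max (suggested c δ μ₀ x A a t).card 1 : ℕ)) ≤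
    ∑ r ∈ Finset.Icc 1 (numOpen t), ∑ i ∈ H, {B : Finset (Fin n) | i ∈ B}.indicator 1 (A r) *
      fdrWeight c (m i) (bracketLevel' δ r) (A r).card (x i r) := by
  set S := suggested c δ μ₀ x A a t with hS
  have hpos : (0 : ℝ) < (max S.card 1 : ℕ) := by
    exact_mod_cast lt_max_of_lt_right Nat.one_pos
  rw [Finset.sum_comm]
  have e : ENNReal.ofReal (((S ∩ H).card : ℝ) / (max S.card 1 : ℕ)) =
      ∑ i ∈ S ∩ H, ENNReal.ofReal (1 / (max S.card 1 : ℕ)) := by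
    rw [Finset.sum_const, nsmul_eq_mul, ← ENNReal.ofReal_natCast,
      ← ENNReal.ofReal_mul (Nat.cast_nonneg _), mul_one_div]
  rw [e]
  refine le_trans (Finset.sum_le_sum fun i hi => ?_)
    (Finset.sum_le_sum_of_subset Finset.inter_subset_right)
  obtain ⟨hiS, hiH⟩ := Finset.mem_inter.1 hi
  obtain ⟨r, p, h1, h2, h3, h4, h5, h6, h7⟩ := exists_fails_of_mem_suggested (hH i hiH) hiS
  refine le_trans ?_ (Finset.single_le_sum
    (f := fun r => {B : Finset (Fin n) | i ∈ B}.indicator (1 : Finset (Fin n) → ℝ≥0∞) (A r) *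
      fdrWeight c (m i) (bracketLevel' δ r) (A r).card (x i r))
    (fun _ _ => zero_le) (Finset.mem_Icc.2 ⟨h1, h2⟩))
  rw [Set.indicator_of_mem (show A r ∈ {B : Finset (Fin n) | i ∈ B} from h3), Pi.one_apply, one_mul]
  refine le_trans (ENNReal.ofReal_le_ofReal ?_)
    (le_fdrWeight hc (bracketLevel'_pos hδ h1) h4 h5 h7)
  have hp0 : (0 : ℝ) < p := by exact_mod_cast h4
  refine one_div_le_one_div_of_le hp0 ?_
  exact_mod_cast h6.trans (le_max_left _ _)

end FDR

namespace Run

variable {n : ℕ} {ν : Fin n → Measure ℝ} {c δ μ₀ : ℝ} {Ω : Type*} [MeasurableSpace Ω]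
  {P : Measure Ω} [IsProbabilityMeasure P]

theorem lintegral_fdrWeight_le (ρ : Run ν c δ μ₀ P)
    (hν : ∀ i, HasSubgaussianMGF (fun y : ℝ => y - mean ν i) 1 (ν i)) (hc : 4 ≤ c) {δ' : ℝ}
    (hδ : 0 < δ') (hδ1 : δ' ≤ 0.025) (i : Fin n) (r : ℕ) {M : ℕ} (hM : 1 ≤ M) :
    ∫⁻ ω, fdrWeight c (mean ν i) δ' M (fun s => ρ.X i r s ω) ∂P ≤
      ENNReal.ofReal (2 * δ' ^ 2 / M) := by
  have hM0 : (0 : ℝ) < M := by exact_mod_cast hM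
  have hind : ∀ (q b : ℝ), 0 < q → q ≤ 0.025 → 0 ≤ b →
      ∫⁻ ω, {y | Fails c (mean ν i) q y}.indicator (fun _ => ENNReal.ofReal b)
        (fun s => ρ.X i r s ω) ∂P ≤ ENNReal.ofReal (b * q ^ 2) := by
    intro q b hq hq1 hb
    have e : ∀ ω, {y | Fails c (mean ν i) q y}.indicator (fun _ => ENNReal.ofReal b)
        (fun s => ρ.X i r s ω) = {ω | Fails c (mean ν i) q fun s => ρ.X i r s ω}.indicator
          (fun _ => ENNReal.ofReal b) ω := fun ω => rfl
    simp_rw [e]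
    have hms : MeasurableSet {ω | Fails c (mean ν i) q fun s => ρ.X i r s ω} :=
      ρ.measurable_X_path i r (measurableSet_fails _ _ _)
    rw [lintegral_indicator_const hms, ENNReal.ofReal_mul hb]
    gcongr
    exact ρ.measure_fails_le hν hc hq hq1 i r
  have hmeas : ∀ q b : ℝ, Measurable fun ω => {y | Fails c (mean ν i) q y}.indicator
      (fun _ => ENNReal.ofReal b) (fun s => ρ.X i r s ω) := fun q b =>
    (measurable_const.indicator (measurableSet_fails _ _ _)).comp (ρ.measurable_X_path i r)
  unfold fdrWeight
  rw [lintegral_add_right _ (hmeas _ _), lintegral_finsetSum _ fun p _ => hmeas _ _]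
  have hlev : ∀ p ∈ Finset.Icc 1 M, (0 : ℝ) < p ∧ (p : ℝ) / M * δ' ≤ δ' := by
    intro p hp
    obtain ⟨hp1, hp2⟩ := Finset.mem_Icc.1 hp
    refine ⟨by exact_mod_cast hp1, mul_le_of_le_one_left hδ.le ?_⟩
    rw [div_le_one hM0]
    exact_mod_cast hp2
  -- The squared level `(p δ' / M) ^ 2` offsets the weight `1 / (p (p + 1))`, so each of the `M`
  -- indices contributes at most `δ' ^ 2 / M ^ 2`.
  calc _ ≤ ∑ p ∈ Finset.Icc 1 M, ENNReal.ofReal (δ' ^ 2 / M ^ 2) +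
        ENNReal.ofReal (δ' ^ 2 / M) := by
        refine add_le_add (Finset.sum_le_sum fun p hp => ?_) ?_
        · obtain ⟨hp0, hp1⟩ := hlev p hp
          refine (hind _ _ (by positivity) (hp1.trans hδ1) (by positivity)).trans
            (ENNReal.ofReal_le_ofReal ?_)
          have : 1 / ((p : ℝ) * (p + 1)) * (p / M * δ') ^ 2 =
              δ' ^ 2 / M ^ 2 * (p / (p + 1)) := by
            field_simp
          rw [this]
          refine mul_le_of_le_one_right (by positivity) ?_
          rw [div_le_one (by positivity)]
          linarith
        · refine (hind _ _ hδ hδ1 (by positivity)).trans (ENNReal.ofReal_le_ofReal ?_)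
          rw [one_div_mul_eq_div]
          gcongr
          linarith
    _ = ENNReal.ofReal (2 * δ' ^ 2 / M) := by
        rw [Finset.sum_const, nsmul_eq_mul, ← ENNReal.ofReal_natCast,
          ← ENNReal.ofReal_mul (Nat.cast_nonneg _), ← ENNReal.ofReal_add (by positivity)
          (by positivity)]
        congr 1
        simp only [Nat.card_Icc, Nat.add_sub_cancel]
        field_simp
        norm_num

/-- The false discovery rate of the algorithm is at most `2δ`. -/
theorem fdr_le (ρ : Run ν c δ μ₀ P)
    (hν : ∀ i, HasSubgaussianMGF (fun y : ℝ => y - mean ν i) 1 (ν i)) (hc : 4 ≤ c)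
    (hδ : 0 < δ) (hδ1 : δ ≤ 0.025) (t : ℕ) :
    ∫ ω, ((ρ.S t ω ∩ H₀ ν μ₀).card : ℝ) / (max (ρ.S t ω).card 1 : ℕ) ∂P ≤ 2 * δ := by
  have hmeas : Measurable fun ω => ((ρ.S t ω ∩ H₀ ν μ₀).card : ℝ) / (max (ρ.S t ω).card 1 : ℕ) :=
    (measurable_of_countable fun B : Finset (Fin n) =>
      ((B ∩ H₀ ν μ₀).card : ℝ) / (max B.card 1 : ℕ)).comp (ρ.measurable_S t)
  rw [integral_eq_lintegral_of_nonneg_ae (ae_of_all _ fun ω => by positivity)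
    hmeas.aestronglyMeasurable]
  refine ENNReal.toReal_le_of_le_ofReal (by positivity) ?_
  have hH : ∀ i ∈ H₀ ν μ₀, mean ν i ≤ μ₀ := fun i hi => by simpa [H₀] using hi
  refine (lintegral_mono fun ω => fdp_le (by linarith) hδ hH).trans ?_
  have hterm : ∀ r ∈ Finset.Icc 1 (numOpen t), ∀ i ∈ H₀ ν μ₀,
      Measurable fun ω => {ω | ρ.A r ω ∈ {B : Finset (Fin n) | i ∈ B}}.indicator
        (1 : Ω → ℝ≥0∞) ω * fdrWeight c (mean ν i) (bracketLevel' δ r) (bracketSize n r)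
          (fun s => ρ.X i r s ω) := fun r _ i _ =>
    (measurable_one.indicator (ρ.measurableSet_A r _)).mul
      ((measurable_fdrWeight _ _ _ _).comp (ρ.measurable_X_path i r))
  calc _ = ∫⁻ ω, ∑ r ∈ Finset.Icc 1 (numOpen t), ∑ i ∈ H₀ ν μ₀,
        {ω | ρ.A r ω ∈ {B : Finset (Fin n) | i ∈ B}}.indicator (1 : Ω → ℝ≥0∞) ω *
          fdrWeight c (mean ν i) (bracketLevel' δ r) (bracketSize n r)
            (fun s => ρ.X i r s ω) ∂P := by
        refine lintegral_congr_ae ?_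
        have hall : ∀ᵐ ω ∂P, ∀ r ∈ Finset.Icc 1 (numOpen t),
            (ρ.A r ω).card = bracketSize n r :=
          (Finset.eventually_all _).2 fun r hr => ρ.ae_card_A (Finset.mem_Icc.1 hr).1
        filter_upwards [hall] with ω hω
        refine Finset.sum_congr rfl fun r hr => Finset.sum_congr rfl fun i _ => ?_
        rw [hω r hr]
        rfl
    _ = ∑ r ∈ Finset.Icc 1 (numOpen t), ∑ i ∈ H₀ ν μ₀, ENNReal.ofReal ((bracketSize n r : ℝ) / n) *
          ∫⁻ ω, fdrWeight c (mean ν i) (bracketLevel' δ r) (bracketSize n r)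
            (fun s => ρ.X i r s ω) ∂P := by
        rw [lintegral_finsetSum _ fun r hr => Finset.measurable_sum _ fun i hi => hterm r hr i hi]
        refine Finset.sum_congr rfl fun r hr => ?_
        rw [lintegral_finsetSum _ fun i hi => hterm r hr i hi]
        refine Finset.sum_congr rfl fun i _ => ?_
        rw [ρ.lintegral_indicator_A_mul r _ i (measurable_fdrWeight _ _ _ _)]
        congr 1
        exact ρ.measure_mem_A (Finset.mem_Icc.1 hr).1 i
    _ ≤ ∑ r ∈ Finset.Icc 1 (numOpen t), ∑ i ∈ H₀ ν μ₀,
          ENNReal.ofReal (2 * δ ^ 2 * (1 / (r : ℝ) ^ 2) / n) := by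
        refine Finset.sum_le_sum fun r hr => Finset.sum_le_sum fun i _ => ?_
        have hr1 := (Finset.mem_Icc.1 hr).1
        have hM := one_le_bracketSize (Fin.pos i) r
        have hM0 : (0 : ℝ) < bracketSize n r := by exact_mod_cast hM
        have hn0 : (0 : ℝ) < n := by exact_mod_cast Fin.pos i
        have hr0 : (1 : ℝ) ≤ r := by exact_mod_cast hr1
        have hb := bracketLevel'_pos hδ hr1
        refine (mul_le_mul_right (ρ.lintegral_fdrWeight_le hν hc hb
          ((bracketLevel'_le_self hδ hr1).trans hδ1) i r hM) _).trans ?_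
        rw [← ENNReal.ofReal_mul (by positivity)]
        refine ENNReal.ofReal_le_ofReal ?_
        -- The inclusion probability cancels the bracket size, leaving `1 / n` for the sum over at
        -- most `n` arms.
        have e : (bracketSize n r : ℝ) / n * (2 * bracketLevel' δ r ^ 2 / bracketSize n r) =
            2 * bracketLevel' δ r ^ 2 / n := by
          field_simp
        rw [e]
        have h1 : bracketLevel' δ r ^ 2 ≤ (δ / (r : ℝ) ^ 2) ^ 2 := by
          have := bracketLevel'_le hδ hr1
          gcongr
        have h2 : (δ / (r : ℝ) ^ 2) ^ 2 ≤ δ ^ 2 * (1 / (r : ℝ) ^ 2) := by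
          have h3 : (δ / (r : ℝ) ^ 2) ^ 2 = δ ^ 2 * (1 / (r : ℝ) ^ 2) * (1 / (r : ℝ) ^ 2) := by
            field_simp
          rw [h3]
          refine mul_le_of_le_one_right (by positivity) ?_
          rw [div_le_one (by positivity)]
          nlinarith
        exact div_le_div_of_nonneg_right (by linarith) hn0.le
    _ ≤ ∑ r ∈ Finset.Icc 1 (numOpen t), ENNReal.ofReal (2 * δ ^ 2 * (1 / (r : ℝ) ^ 2)) := by
        refine Finset.sum_le_sum fun r _ => ?_
        rw [Finset.sum_const, nsmul_eq_mul, ← ENNReal.ofReal_natCast,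
          ← ENNReal.ofReal_mul (Nat.cast_nonneg _)]
        refine ENNReal.ofReal_le_ofReal ?_
        have hcard : ((H₀ ν μ₀).card : ℝ) ≤ n := by
          exact_mod_cast (Finset.card_le_univ _).trans (Fintype.card_fin n).le
        rw [← mul_div_assoc, mul_comm, mul_div_assoc]
        exact mul_le_of_le_one_right (by positivity)
          (div_le_one_of_le₀ hcard (Nat.cast_nonneg n))
    -- The total is at most `4 δ ^ 2`, which is below `2 δ` for `δ ≤ 0.025`.
    _ ≤ ENNReal.ofReal (2 * δ) := by
        rw [← ENNReal.ofReal_sum_of_nonneg fun r _ => by positivity, ← Finset.mul_sum]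
        refine ENNReal.ofReal_le_ofReal ?_
        nlinarith [sum_Icc_inv_sq_le (numOpen t), sq_nonneg δ]

end Run

/-! ### The expected number of discoveries -/

/-- The number of levels `δ / 2 ^ q` at which the confidence interval fails. -/
noncomputable def failCount (c μ δ : ℝ) (y : ℕ → ℝ) : ℝ≥0∞ :=
  ∑' q : ℕ, {y | Fails c μ (δ / 2 ^ q) y}.indicator 1 y

theorem measurable_failCount (c μ δ : ℝ) : Measurable (failCount c μ δ) :=
  Measurable.tsum fun _ => measurable_one.indicator (measurableSet_fails _ _ _)

theorem not_fails_of_failCount_lt_one {c μ δ : ℝ} {y : ℕ → ℝ} (h : failCount c μ δ y < 1) :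
    ¬ Fails c μ δ y := by
  intro hf
  refine absurd h (not_lt.2 ?_)
  refine le_trans ?_ (ENNReal.le_tsum 0)
  rw [Set.indicator_of_mem (by simpa using hf)]
  rfl

theorem exists_not_fails_of_failCount_ne_top {c μ δ : ℝ} {y : ℕ → ℝ}
    (h : failCount c μ δ y ≠ ⊤) :
    ∃ d : ℕ, ¬ Fails c μ (δ / 2 ^ d) y ∧ (d : ℝ≥0∞) ≤ failCount c μ δ y := by
  classical
  have hex : ∃ d : ℕ, ¬ Fails c μ (δ / 2 ^ d) y := by
    by_contra hall
    push Not at hall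
    refine h ?_
    have e : failCount c μ δ y = ∑' _ : ℕ, (1 : ℝ≥0∞) :=
      tsum_congr fun q => Set.indicator_of_mem (show y ∈ {y | Fails c μ (δ / 2 ^ q) y} from hall q) 1
    rw [e, ENNReal.tsum_const_eq_top_of_ne_zero one_ne_zero]
  -- `d` is the first valid exponent, so the exponents `0, …, d - 1` all fail and are counted.
  refine ⟨Nat.find hex, Nat.find_spec hex, ?_⟩
  refine le_trans ?_ (ENNReal.sum_le_tsum (Finset.range (Nat.find hex)))
  rw [Finset.sum_congr rfl fun q hq => Set.indicator_of_mem (s := {y | Fails c μ (δ / 2 ^ q) y})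
    (not_not.1 (Nat.find_min hex (Finset.mem_range.1 hq))) 1]
  simp

section Pointwise

variable {n : ℕ} {c δ : ℝ} {m w κ : Fin n → ℝ} {y : Fin n → ℕ → ℝ}

/-- If every good arm that is missed makes the bracket expensive, then the number of missed arms is
controlled by the failing confidence intervals and by the cost of the bracket. -/
theorem card_inter_le_add {A J S H : Finset (Fin n)} {N : ℕ} (hJ : J ⊆ H)
    (hκ : ∀ i, 0 < κ i) (hκw : ∀ i, κ i ≤ w i)
    (hcost : ∀ d : Fin n → ℕ, (∀ i ∈ A, ¬ Fails c (m i) (δ / 2 ^ d i) (y i)) →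
      ∀ i₀ ∈ A, i₀ ∈ J → ¬ Fails c (m i₀) δ (y i₀) → i₀ ∉ S →
        (N : ℝ) ≤ ∑ i ∈ A, (w i + κ i * d i)) {E : ℝ≥0∞}
    (hE : (N : ℝ≥0∞) ≤ ∑ i ∈ A, (ENNReal.ofReal (w i) +
      ENNReal.ofReal (κ i) * failCount c (m i) δ (y i)) → 1 ≤ E) :
    ∑ i ∈ J, {B : Finset (Fin n) | i ∈ B}.indicator (1 : Finset (Fin n) → ℝ≥0∞) A ≤
      ((S ∩ H).card : ℝ≥0∞) +
        ∑ i ∈ J, {B : Finset (Fin n) | i ∈ B}.indicator 1 A * failCount c (m i) δ (y i) +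
        ∑ i ∈ J, {B : Finset (Fin n) | i ∈ B}.indicator 1 A * E := by
  classical
  have hS : ∑ i ∈ J, (if i ∈ S then (1 : ℝ≥0∞) else 0) ≤ ((S ∩ H).card : ℝ≥0∞) := by
    rw [Finset.sum_ite_mem, Finset.sum_const, nsmul_eq_mul, mul_one, Finset.inter_comm]
    exact_mod_cast Finset.card_le_card (Finset.inter_subset_inter_left hJ)
  refine le_trans ?_ (add_le_add_left (add_le_add_left hS _) _)
  rw [← Finset.sum_add_distrib, ← Finset.sum_add_distrib]
  refine Finset.sum_le_sum fun i hi => ?_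
  by_cases hA : i ∈ A
  · rw [Set.indicator_of_mem (show A ∈ {B : Finset (Fin n) | i ∈ B} from hA), Pi.one_apply, one_mul,
      one_mul]
    by_cases hiS : i ∈ S
    · rw [if_pos hiS, add_assoc]
      exact le_self_add
    -- A missed arm is paid for by its own failure count or, if that is below one and its interval
    -- of level `δ` is therefore valid, by `E`.
    by_cases hD : 1 ≤ failCount c (m i) δ (y i)
    · exact hD.trans (le_add_right le_add_self)
    refine le_trans (hE ?_) le_add_self
    -- If some failure count is infinite, `κ > 0` makes the cost of the bracket infinite; otherwise
    -- valid exponents `d` exist for all arms.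
    by_cases htop : ∃ i' ∈ A, failCount c (m i') δ (y i') = ⊤
    · obtain ⟨i', hi', htop⟩ := htop
      refine le_trans ?_ (Finset.single_le_sum (fun _ _ => zero_le) hi')
      rw [htop, ENNReal.mul_top (by simpa using hκ i'), add_top]
      exact le_top
    · push Not at htop
      have hd : ∀ i', ∃ d : ℕ, i' ∈ A → ¬ Fails c (m i') (δ / 2 ^ d) (y i') ∧
          (d : ℝ≥0∞) ≤ failCount c (m i') δ (y i') := by
        intro i'
        by_cases hi' : i' ∈ A
        · obtain ⟨d, hd⟩ := exists_not_fails_of_failCount_ne_top (htop i' hi')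
          exact ⟨d, fun _ => hd⟩
        · exact ⟨0, fun h => absurd h hi'⟩
      choose d hd using hd
      have h1 := hcost d (fun i' hi' => (hd i' hi').1) i hA hi
        (not_fails_of_failCount_lt_one (not_le.1 hD)) hiS
      have h2 := ENNReal.ofReal_le_ofReal h1
      rw [ENNReal.ofReal_natCast, ENNReal.ofReal_sum_of_nonneg fun i' _ =>
        add_nonneg ((hκ i').le.trans (hκw i')) (mul_nonneg (hκ i').le (Nat.cast_nonneg _))] at h2
      refine h2.trans (Finset.sum_le_sum fun i' hi' => ?_)
      rw [ENNReal.ofReal_add ((hκ i').le.trans (hκw i'))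
        (mul_nonneg (hκ i').le (Nat.cast_nonneg _)), ENNReal.ofReal_mul (hκ i').le,
        ENNReal.ofReal_natCast]
      gcongr
      exact (hd i' hi').2
  · rw [Set.indicator_of_notMem (show A ∉ {B : Finset (Fin n) | i ∈ B} from hA)]
    exact zero_le

end Pointwise

namespace Run

variable {n : ℕ} {ν : Fin n → Measure ℝ} {c δ μ₀ : ℝ} {Ω : Type*} [MeasurableSpace Ω]
  {P : Measure Ω}

/-- Missing a good arm of bracket `r` with a valid confidence interval until time `t` forces the
bracket to cost at least `N` rounds, where the cost of an arm `i` is `w i + κ i * d i` if its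
confidence interval of level `δ / 2 ^ d i` is valid. -/
def CostBound (ρ : Run ν c δ μ₀ P) (r t N : ℕ) (J : Finset (Fin n)) (w κ : Fin n → ℝ) : Prop :=
  ∀ ω, (ρ.A r ω).card = bracketSize n r →
    ∀ d : Fin n → ℕ, (∀ i ∈ ρ.A r ω, ¬ Fails c (mean ν i) (δ / 2 ^ d i) fun s => ρ.X i r s ω) →
      ∀ i₀ ∈ ρ.A r ω, i₀ ∈ J → ¬ Fails c (mean ν i₀) δ (fun s => ρ.X i₀ r s ω) → i₀ ∉ ρ.S t ω →
        (N : ℝ) ≤ ∑ i ∈ ρ.A r ω, (w i + κ i * d i)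

theorem measurable_indicator_A (ρ : Run ν c δ μ₀ P) (r : ℕ) (i : Fin n) :
    Measurable fun ω => {B : Finset (Fin n) | i ∈ B}.indicator (1 : Finset (Fin n) → ℝ≥0∞)
      (ρ.A r ω) :=
  (measurable_of_countable ({B : Finset (Fin n) | i ∈ B}.indicator
    (1 : Finset (Fin n) → ℝ≥0∞))).comp (ρ.measurable_A r)

theorem measurable_failCount_path (ρ : Run ν c δ μ₀ P) (i : Fin n) (r : ℕ) :
    Measurable fun ω => failCount c (mean ν i) δ (fun s => ρ.X i r s ω) :=
  (measurable_failCount _ _ _).comp (ρ.measurable_X_path i r)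

variable [IsProbabilityMeasure P]

theorem lintegral_failCount_le (ρ : Run ν c δ μ₀ P)
    (hν : ∀ i, HasSubgaussianMGF (fun y : ℝ => y - mean ν i) 1 (ν i)) (hc : 4 ≤ c)
    (hδ : 0 < δ) (hδ1 : δ ≤ 0.025) (i : Fin n) (r : ℕ) :
    ∫⁻ ω, failCount c (mean ν i) δ (fun s => ρ.X i r s ω) ∂P ≤ ENNReal.ofReal (2 * δ ^ 2) := by
  have hms : ∀ q : ℕ, MeasurableSet {ω | Fails c (mean ν i) (δ / 2 ^ q) fun s => ρ.X i r s ω} :=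
    fun q => ρ.measurable_X_path i r (measurableSet_fails _ _ _)
  have e : ∀ ω, failCount c (mean ν i) δ (fun s => ρ.X i r s ω) =
      ∑' q : ℕ, {ω | Fails c (mean ν i) (δ / 2 ^ q) fun s => ρ.X i r s ω}.indicator 1 ω :=
    fun ω => rfl
  simp_rw [e]
  rw [lintegral_tsum fun q => (measurable_one.indicator (hms q)).aemeasurable]
  have hq : ∀ q : ℕ, ∫⁻ ω, {ω | Fails c (mean ν i) (δ / 2 ^ q) fun s => ρ.X i r s ω}.indicator
      (1 : Ω → ℝ≥0∞) ω ∂P ≤ ENNReal.ofReal (δ ^ 2 * (1 / 2) ^ q) := by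
    intro q
    rw [lintegral_indicator_one (hms q)]
    have hq1 : δ / 2 ^ q ≤ δ := div_le_self hδ.le (one_le_pow₀ (by norm_num))
    refine (ρ.measure_fails_le hν hc (by positivity) (hq1.trans hδ1) i r).trans
      (ENNReal.ofReal_le_ofReal ?_)
    have h1 : (δ / 2 ^ q) ^ 2 = δ ^ 2 * (1 / 2) ^ q * (1 / 2) ^ q := by
      rw [div_pow, ← pow_mul, mul_assoc, ← pow_add, one_div, inv_pow, ← div_eq_mul_inv, mul_two]
    rw [h1]
    exact mul_le_of_le_one_right (by positivity) (pow_le_one₀ (by norm_num) (by norm_num))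
  refine (ENNReal.tsum_le_tsum hq).trans ?_
  rw [← ENNReal.ofReal_tsum_of_nonneg (fun q => by positivity)
    ((summable_geometric_of_lt_one (by norm_num) (by norm_num)).mul_left _), tsum_mul_left,
    tsum_geometric_of_lt_one (by norm_num) (by norm_num)]
  refine ENNReal.ofReal_le_ofReal (le_of_eq ?_)
  norm_num
  ring

/-- Up to the probability of failing confidence intervals and of an expensive bracket, all good
arms of the bracket are found. -/
theorem le_lintegral_card_inter_add (ρ : Run ν c δ μ₀ P)
    (hν : ∀ i, HasSubgaussianMGF (fun y : ℝ => y - mean ν i) 1 (ν i)) (hc : 4 ≤ c)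
    (hδ : 0 < δ) (hδ1 : δ ≤ 0.025) {r t N : ℕ} (hr : 1 ≤ r) {J H : Finset (Fin n)} (hJ : J ⊆ H)
    {w κ : Fin n → ℝ} (hκ : ∀ i, 0 < κ i) (hκw : ∀ i, κ i ≤ w i)
    (hcost : ρ.CostBound r t N J w κ) {E : Ω → ℝ≥0∞} (hEm : Measurable E)
    (hE : ∀ ω, (N : ℝ≥0∞) ≤ ∑ i ∈ ρ.A r ω, (ENNReal.ofReal (w i) +
      ENNReal.ofReal (κ i) * failCount c (mean ν i) δ (fun s => ρ.X i r s ω)) → 1 ≤ E ω) :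
    ENNReal.ofReal (J.card * ((bracketSize n r : ℝ) / n)) ≤
      ∫⁻ ω, ((ρ.S t ω ∩ H).card : ℝ≥0∞) ∂P +
        ENNReal.ofReal (J.card * ((bracketSize n r : ℝ) / n) * (2 * δ ^ 2)) +
        ∑ i ∈ J, ∫⁻ ω, {B : Finset (Fin n) | i ∈ B}.indicator 1 (ρ.A r ω) * E ω ∂P := by
  set θ := (bracketSize n r : ℝ) / n with hθ
  have hθ0 : 0 ≤ θ := by positivity
  have hpt : ∀ᵐ ω ∂P, ∑ i ∈ J, {B : Finset (Fin n) | i ∈ B}.indicator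
      (1 : Finset (Fin n) → ℝ≥0∞) (ρ.A r ω) ≤ ((ρ.S t ω ∩ H).card : ℝ≥0∞) +
        ∑ i ∈ J, {B : Finset (Fin n) | i ∈ B}.indicator 1 (ρ.A r ω) *
          failCount c (mean ν i) δ (fun s => ρ.X i r s ω) +
        ∑ i ∈ J, {B : Finset (Fin n) | i ∈ B}.indicator 1 (ρ.A r ω) * E ω := by
    filter_upwards [ρ.ae_card_A hr] with ω hω
    exact card_inter_le_add (y := fun i s => ρ.X i r s ω) hJ hκ hκw (hcost ω hω) (hE ω)
  have hP : ∀ i, ∫⁻ ω, {B : Finset (Fin n) | i ∈ B}.indicator (1 : Finset (Fin n) → ℝ≥0∞)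
      (ρ.A r ω) ∂P = ENNReal.ofReal θ := by
    intro i
    rw [hθ, ← ρ.measure_mem_A hr i]
    exact lintegral_indicator_one (ρ.measurableSet_A r {B | i ∈ B})
  have h := lintegral_mono_ae hpt
  have hD : ∀ i, ∫⁻ ω, {B : Finset (Fin n) | i ∈ B}.indicator 1 (ρ.A r ω) *
      failCount c (mean ν i) δ (fun s => ρ.X i r s ω) ∂P ≤ ENNReal.ofReal (θ * (2 * δ ^ 2)) := by
    intro i
    have h1 := ρ.lintegral_indicator_A_mul r {B | i ∈ B} i (measurable_failCount c (mean ν i) δ)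
    refine (le_of_eq h1).trans ?_
    rw [ENNReal.ofReal_mul hθ0]
    exact mul_le_mul' (ρ.measure_mem_A hr i).le (ρ.lintegral_failCount_le hν hc hδ hδ1 i r)
  have hm1 : ∀ i, Measurable fun ω => {B : Finset (Fin n) | i ∈ B}.indicator 1 (ρ.A r ω) * E ω :=
    fun i => (ρ.measurable_indicator_A r i).mul hEm
  have hm2 : ∀ i, Measurable fun ω => {B : Finset (Fin n) | i ∈ B}.indicator 1 (ρ.A r ω) *
      failCount c (mean ν i) δ (fun s => ρ.X i r s ω) :=
    fun i => (ρ.measurable_indicator_A r i).mul (ρ.measurable_failCount_path i r)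
  rw [lintegral_finsetSum _ fun i _ => ρ.measurable_indicator_A r i,
    lintegral_add_right _ (Finset.measurable_sum _ fun i _ => hm1 i),
    lintegral_add_right _ (Finset.measurable_sum _ fun i _ => hm2 i),
    lintegral_finsetSum _ fun i _ => hm1 i, lintegral_finsetSum _ fun i _ => hm2 i] at h
  have e1 : ∑ i ∈ J, ∫⁻ ω, {B : Finset (Fin n) | i ∈ B}.indicator
      (1 : Finset (Fin n) → ℝ≥0∞) (ρ.A r ω) ∂P = ENNReal.ofReal (J.card * θ) := by
    rw [Finset.sum_congr rfl fun i _ => hP i, Finset.sum_const, nsmul_eq_mul,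
      ENNReal.ofReal_mul (Nat.cast_nonneg _), ENNReal.ofReal_natCast]
  have e2 : ∑ i ∈ J, ∫⁻ ω, {B : Finset (Fin n) | i ∈ B}.indicator 1 (ρ.A r ω) *
      failCount c (mean ν i) δ (fun s => ρ.X i r s ω) ∂P ≤
        ENNReal.ofReal (J.card * θ * (2 * δ ^ 2)) := by
    refine (Finset.sum_le_sum fun i _ => hD i).trans (le_of_eq ?_)
    rw [Finset.sum_const, nsmul_eq_mul, mul_assoc, ENNReal.ofReal_mul (Nat.cast_nonneg _),
      ENNReal.ofReal_natCast]
  rw [e1] at h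
  exact h.trans (add_le_add_left (add_le_add_right e2 _) _)

theorem le_integral_card_inter_of_le (ρ : Run ν c δ μ₀ P) {t : ℕ} {H : Finset (Fin n)}
    {a b : ℝ} (hb : 0 ≤ b)
    (h : ENNReal.ofReal a ≤ ∫⁻ ω, ((ρ.S t ω ∩ H).card : ℝ≥0∞) ∂P + ENNReal.ofReal b) :
    a - b ≤ ∫ ω, ((ρ.S t ω ∩ H).card : ℝ) ∂P := by
  have e : ∫ ω, ((ρ.S t ω ∩ H).card : ℝ) ∂P =
      (∫⁻ ω, ((ρ.S t ω ∩ H).card : ℝ≥0∞) ∂P).toReal := by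
    have hm : Measurable fun ω => ((ρ.S t ω ∩ H).card : ℝ) :=
      (measurable_of_countable fun B : Finset (Fin n) => ((B ∩ H).card : ℝ)).comp
        (ρ.measurable_S t)
    rw [integral_eq_lintegral_of_nonneg_ae (ae_of_all _ fun ω => Nat.cast_nonneg _)
      hm.aestronglyMeasurable]
    simp
  have hfin : ∫⁻ ω, ((ρ.S t ω ∩ H).card : ℝ≥0∞) ∂P ≠ ⊤ := by
    refine ((lintegral_mono fun ω => (show ((ρ.S t ω ∩ H).card : ℝ≥0∞) ≤ (n : ℝ≥0∞) from ?_)).trans_lt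
      ?_).ne
    · exact_mod_cast (Finset.card_le_univ _).trans (Fintype.card_fin n).le
    · simp
  rw [e, sub_le_iff_le_add, ← ENNReal.toReal_ofReal hb, ← ENNReal.toReal_add hfin (by simp)]
  exact (ENNReal.ofReal_le_iff_le_toReal (by simp [hfin])).1 h

/-- If the bracket contains all arms and is used often enough, then a fraction `1 - δ` of the good
arms is found. -/
theorem le_integral_card_inter_full (ρ : Run ν c δ μ₀ P)
    (hν : ∀ i, HasSubgaussianMGF (fun y : ℝ => y - mean ν i) 1 (ν i)) (hc : 4 ≤ c)
    (hδ : 0 < δ) (hδ1 : δ ≤ 0.025) (hn : 1 ≤ n) {r t N : ℕ} (hr : 1 ≤ r)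
    (hfull : bracketSize n r = n) {J H : Finset (Fin n)}
    (hJ : J ⊆ H) {w κ : Fin n → ℝ} (hκ : ∀ i, 0 < κ i) (hκw : ∀ i, κ i ≤ w i)
    (hcost : ρ.CostBound r t N J w κ) (hN : 2 * ∑ i, w i ≤ N) :
    (1 - δ) * J.card ≤ ∫ ω, ((ρ.S t ω ∩ H).card : ℝ) ∂P := by
  have : Nonempty (Fin n) := ⟨⟨0, hn⟩⟩
  have hn0 : (0 : ℝ) < n := by exact_mod_cast hn
  set W := ∑ i, w i with hW
  have hw : ∀ i, 0 < w i := fun i => (hκ i).trans_le (hκw i)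
  have hW0 : 0 < W := Finset.sum_pos (fun i _ => hw i) Finset.univ_nonempty
  have hWne : ENNReal.ofReal W ≠ 0 := by simpa using hW0
  -- As `N` is at least twice the deterministic cost `W`, an expensive bracket needs a failure cost
  -- of at least `W`. Only this part enters the Markov bound, so the loss is of order `δ ^ 2`, as
  -- the factor `1 - δ` requires.
  set E : Ω → ℝ≥0∞ := fun ω => (∑ i, ENNReal.ofReal (κ i) *
    failCount c (mean ν i) δ (fun s => ρ.X i r s ω)) / ENNReal.ofReal W with hE
  have hEm0 : Measurable fun ω => ∑ i, ENNReal.ofReal (κ i) *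
      failCount c (mean ν i) δ (fun s => ρ.X i r s ω) :=
    Finset.measurable_sum _ fun i _ => (ρ.measurable_failCount_path i r).const_mul _
  have hEm : Measurable E := hEm0.div_const _
  have h := ρ.le_lintegral_card_inter_add hν hc hδ hδ1 hr hJ hκ hκw hcost hEm fun ω hω => by
    rw [hE]
    simp only
    rw [ENNReal.le_div_iff_mul_le (Or.inl hWne) (Or.inl ENNReal.ofReal_ne_top), one_mul]
    have h1 : ENNReal.ofReal W + ENNReal.ofReal W ≤ ENNReal.ofReal W +
        ∑ i, ENNReal.ofReal (κ i) * failCount c (mean ν i) δ (fun s => ρ.X i r s ω) := by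
      calc ENNReal.ofReal W + ENNReal.ofReal W ≤ ENNReal.ofReal N := by
            rw [← ENNReal.ofReal_add hW0.le hW0.le]
            exact ENNReal.ofReal_le_ofReal (by linarith)
        _ ≤ _ := by
            rw [ENNReal.ofReal_natCast]
            refine hω.trans ((Finset.sum_le_sum_of_subset (Finset.subset_univ _)).trans ?_)
            rw [Finset.sum_add_distrib, hW, ENNReal.ofReal_sum_of_nonneg fun i _ => (hw i).le]
    exact (ENNReal.add_le_add_iff_left ENNReal.ofReal_ne_top).1 h1
  have hEint : ∫⁻ ω, E ω ∂P ≤ ENNReal.ofReal (2 * δ ^ 2) := by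
    rw [hE]
    simp only [div_eq_mul_inv]
    rw [lintegral_mul_const _ hEm0, lintegral_finsetSum _ fun i _ =>
      (ρ.measurable_failCount_path i r).const_mul _, ← div_eq_mul_inv]
    refine ENNReal.div_le_of_le_mul ?_
    calc _ ≤ ∑ i, ENNReal.ofReal (2 * δ ^ 2 * w i) := by
          refine Finset.sum_le_sum fun i _ => ?_
          rw [lintegral_const_mul _ (ρ.measurable_failCount_path i r), mul_comm,
            ENNReal.ofReal_mul (by positivity)]
          exact mul_le_mul' (ρ.lintegral_failCount_le hν hc hδ hδ1 i r)
            (ENNReal.ofReal_le_ofReal (hκw i))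
      _ = _ := by
          rw [← ENNReal.ofReal_sum_of_nonneg fun i _ => mul_nonneg (by positivity) (hw i).le,
            ← Finset.mul_sum, ENNReal.ofReal_mul (by positivity)]
  have hlast : ∑ i ∈ J, ∫⁻ ω, {B : Finset (Fin n) | i ∈ B}.indicator 1 (ρ.A r ω) * E ω ∂P ≤
      ENNReal.ofReal (J.card * (2 * δ ^ 2)) := by
    refine (Finset.sum_le_sum fun i _ => (lintegral_mono fun ω => ?_).trans hEint).trans
      (le_of_eq ?_)
    · exact mul_le_of_le_one_left' (Set.indicator_apply_le' (fun _ => le_rfl) fun _ => zero_le)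
    · rw [Finset.sum_const, nsmul_eq_mul, ENNReal.ofReal_mul (Nat.cast_nonneg _),
        ENNReal.ofReal_natCast]
  have h' := h.trans (add_le_add_right hlast _)
  rw [add_assoc, ← ENNReal.ofReal_add (by positivity) (by positivity), hfull,
    div_self hn0.ne'] at h'
  refine le_trans ?_ (ρ.le_integral_card_inter_of_le (by positivity) h')
  have hJ0 : (0 : ℝ) ≤ J.card := Nat.cast_nonneg _
  nlinarith [mul_nonneg hJ0 hδ.le]

/-- If the bracket is expected to contain at least `4k` good arms and is used often enough, then
at least `k` good arms are found in expectation. -/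
theorem le_integral_card_inter_partial (ρ : Run ν c δ μ₀ P)
    (hν : ∀ i, HasSubgaussianMGF (fun y : ℝ => y - mean ν i) 1 (ν i)) (hc : 4 ≤ c)
    (hδ : 0 < δ) (hδ1 : δ ≤ 0.025) (hn : 1 ≤ n) {r t N k : ℕ} (hr : 1 ≤ r) (hk : 1 ≤ k)
    {J H : Finset (Fin n)} (hJ : J ⊆ H) {w κ : Fin n → ℝ} (hκ : ∀ i, 0 < κ i)
    (hκw : ∀ i, κ i ≤ w i) (hcost : ρ.CostBound r t N J w κ)
    (hkJ : 4 * (k : ℝ) ≤ J.card * ((bracketSize n r : ℝ) / n))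
    (hN : 10 * ((bracketSize n r : ℝ) / n * ∑ i, w i) ≤ N) :
    (k : ℝ) ≤ ∫ ω, ((ρ.S t ω ∩ H).card : ℝ) ∂P := by
  classical
  have : Nonempty (Fin n) := ⟨⟨0, hn⟩⟩
  have hn0 : (0 : ℝ) < n := by exact_mod_cast hn
  have hM0 : (0 : ℝ) < bracketSize n r := by exact_mod_cast one_le_bracketSize hn r
  set θ := (bracketSize n r : ℝ) / n with hθ
  have hθ0 : 0 < θ := by positivity
  set W := ∑ i, w i with hW
  have hw : ∀ i, 0 < w i := fun i => (hκ i).trans_le (hκw i)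
  have hW0 : 0 < W := Finset.sum_pos (fun i _ => hw i) Finset.univ_nonempty
  have hN0 : (0 : ℝ) < N := by
    have : 0 < 10 * (θ * W) := by positivity
    linarith
  have hNne : (N : ℝ≥0∞) ≠ 0 := by
    have : N ≠ 0 := by rintro rfl; simp at hN0
    exact_mod_cast this
  set g : Fin n → (ℕ → ℝ) → ℝ≥0∞ := fun i y => (ENNReal.ofReal (w i) +
    ENNReal.ofReal (κ i) * failCount c (mean ν i) δ y) / N with hg
  have hgm : ∀ i, Measurable (g i) := fun i =>
    (((measurable_failCount _ _ _).const_mul _).const_add _).div_const _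
  have hgmX : ∀ i, Measurable fun ω => g i (fun s => ρ.X i r s ω) := fun i =>
    (hgm i).comp (ρ.measurable_X_path i r)
  -- Here the cost depends on the random bracket and is correlated with the presence of the arms of
  -- `J`. Written as a sum over members, its products with the indicators of `J` reduce to inclusion
  -- probabilities of pairs.
  set E : Ω → ℝ≥0∞ := fun ω => ∑ i, {B : Finset (Fin n) | i ∈ B}.indicator 1 (ρ.A r ω) *
    g i (fun s => ρ.X i r s ω) with hE
  have hEm : Measurable E := Finset.measurable_sum _ fun i _ =>
    (ρ.measurable_indicator_A r i).mul (hgmX i)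
  have h := ρ.le_lintegral_card_inter_add hν hc hδ hδ1 hr hJ hκ hκw hcost hEm fun ω hω => by
    have e : E ω = (∑ i ∈ ρ.A r ω, (ENNReal.ofReal (w i) +
        ENNReal.ofReal (κ i) * failCount c (mean ν i) δ (fun s => ρ.X i r s ω))) / N := by
      simp only [hE, hg, Set.indicator_apply, Set.mem_ofPred_eq, Pi.one_apply, ite_mul, one_mul,
        zero_mul, div_eq_mul_inv, Finset.sum_mul]
      rw [Finset.sum_ite_mem, Finset.univ_inter]
    rw [e, ENNReal.le_div_iff_mul_le (Or.inl hNne) (Or.inl (ENNReal.natCast_ne_top N)), one_mul]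
    exact hω
  have hgint : ∀ i, ∫⁻ ω, g i (fun s => ρ.X i r s ω) ∂P ≤ ENNReal.ofReal (2 * w i / N) := by
    intro i
    have h1 : ∫⁻ ω, (ENNReal.ofReal (w i) + ENNReal.ofReal (κ i) *
        failCount c (mean ν i) δ (fun s => ρ.X i r s ω)) ∂P ≤ ENNReal.ofReal (2 * w i) := by
      rw [lintegral_add_left measurable_const, lintegral_const, measure_univ, mul_one,
        lintegral_const_mul _ (ρ.measurable_failCount_path i r), two_mul,
        ENNReal.ofReal_add (hw i).le (hw i).le]
      refine add_le_add_right ?_ _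
      refine (mul_le_mul' (ENNReal.ofReal_le_ofReal (hκw i))
        ((ρ.lintegral_failCount_le hν hc hδ hδ1 i r).trans (ENNReal.ofReal_le_ofReal
          (show 2 * δ ^ 2 ≤ 1 by nlinarith)))).trans (le_of_eq ?_)
      rw [ENNReal.ofReal_one, mul_one]
    simp only [hg, div_eq_mul_inv]
    rw [lintegral_mul_const _ (((ρ.measurable_failCount_path i r).const_mul _).const_add _),
      ← div_eq_mul_inv, ← div_eq_mul_inv, ENNReal.ofReal_div_of_pos hN0, ENNReal.ofReal_natCast]
    exact ENNReal.div_le_div_right h1 _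
  have hpair : ∀ i i', P {ω | i ∈ ρ.A r ω ∧ i' ∈ ρ.A r ω} ≤
      ENNReal.ofReal (θ ^ 2 + if i = i' then θ else 0) := by
    intro i i'
    split_ifs with hii
    · subst hii
      simp only [and_self]
      rw [ρ.measure_mem_A hr i]
      exact ENNReal.ofReal_le_ofReal (by nlinarith)
    · rw [add_zero]
      exact ρ.measure_pair_mem_A_le hr hii
  have hprod : ∀ i i', ∫⁻ ω, {B : Finset (Fin n) | i ∈ B}.indicator 1 (ρ.A r ω) *
      ({B : Finset (Fin n) | i' ∈ B}.indicator 1 (ρ.A r ω) * g i' (fun s => ρ.X i' r s ω)) ∂P ≤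
        ENNReal.ofReal ((θ ^ 2 + if i = i' then θ else 0) * (2 * w i' / N)) := by
    intro i i'
    have h1 := ρ.lintegral_indicator_A_mul r {B | i ∈ B ∧ i' ∈ B} i' (hgm i')
    have h2 : 0 ≤ θ ^ 2 + if i = i' then θ else 0 := by
      split_ifs <;> positivity
    rw [ENNReal.ofReal_mul h2]
    refine le_trans (le_of_eq ?_) (h1.le.trans (mul_le_mul' (hpair i i') (hgint i')))
    refine lintegral_congr fun ω => ?_
    by_cases hi : i ∈ ρ.A r ω <;> by_cases hi' : i' ∈ ρ.A r ω <;>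
      simp [hi, hi']
  -- The diagonal pairs `i = i'` produce the summand `1`.
  have hsum : ∑ i ∈ J, ∑ i', (θ ^ 2 + if i = i' then θ else 0) * (2 * w i' / N) ≤
      2 / N * (θ * W) * (J.card * θ + 1) := by
    have h1 : ∀ i, ∑ i', (θ ^ 2 + if i = i' then θ else 0) * (2 * w i' / N) =
        2 / N * (θ * (θ * W + w i)) := by
      intro i
      simp only [add_mul, ite_mul, zero_mul, Finset.sum_add_distrib, Finset.sum_ite_eq,
        Finset.mem_univ, if_true]
      rw [← Finset.mul_sum, ← Finset.sum_div, ← Finset.mul_sum, ← hW]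
      field_simp
    rw [Finset.sum_congr rfl fun i _ => h1 i, ← Finset.mul_sum, ← Finset.mul_sum,
      Finset.sum_add_distrib, Finset.sum_const, nsmul_eq_mul]
    have h2 : ∑ i ∈ J, w i ≤ W :=
      Finset.sum_le_sum_of_subset_of_nonneg (Finset.subset_univ _) fun i _ _ => (hw i).le
    calc 2 / N * (θ * (J.card * (θ * W) + ∑ i ∈ J, w i))
        ≤ 2 / N * (θ * (J.card * (θ * W) + W)) := by gcongr
      _ = _ := by ring
  have hlast : ∑ i ∈ J, ∫⁻ ω, {B : Finset (Fin n) | i ∈ B}.indicator 1 (ρ.A r ω) * E ω ∂P ≤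
      ENNReal.ofReal (2 / N * (θ * W) * (J.card * θ + 1)) := by
    have hnn : ∀ i i', 0 ≤ (θ ^ 2 + if i = i' then θ else 0) * (2 * w i' / N) := by
      intro i i'
      have := hw i'
      split_ifs <;> positivity
    refine le_trans ?_ (ENNReal.ofReal_le_ofReal hsum)
    rw [ENNReal.ofReal_sum_of_nonneg fun i _ => Finset.sum_nonneg fun i' _ => hnn i i']
    refine Finset.sum_le_sum fun i _ => ?_
    rw [ENNReal.ofReal_sum_of_nonneg fun i' _ => hnn i i']
    simp only [hE, Finset.mul_sum]
    have hm : ∀ i', Measurable fun ω => {B : Finset (Fin n) | i ∈ B}.indicator 1 (ρ.A r ω) *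
        ({B : Finset (Fin n) | i' ∈ B}.indicator 1 (ρ.A r ω) * g i' (fun s => ρ.X i' r s ω)) :=
      fun i' => (ρ.measurable_indicator_A r i).mul ((ρ.measurable_indicator_A r i').mul (hgmX i'))
    rw [lintegral_finsetSum _ fun i' _ => hm i']
    exact Finset.sum_le_sum fun i' _ => hprod i i'
  have h' := h.trans (add_le_add_right hlast _)
  rw [add_assoc, ← ENNReal.ofReal_add (by positivity) (by positivity)] at h'
  refine le_trans ?_ (ρ.le_integral_card_inter_of_le (by positivity) h')
  have hk1 : (1 : ℝ) ≤ k := by exact_mod_cast hk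
  set q := J.card * θ with hq
  have h5 : 2 / N * (θ * W) ≤ 1 / 5 := by
    rw [div_mul_eq_mul_div, div_le_div_iff₀ hN0 (by norm_num)]
    linarith
  have h6 : 2 / N * (θ * W) * (q + 1) ≤ 1 / 5 * (q + 1) :=
    mul_le_mul_of_nonneg_right h5 (by linarith)
  have h7 : q * (2 * δ ^ 2) ≤ q * (1 / 10) :=
    mul_le_mul_of_nonneg_left (by nlinarith) (by linarith)
  -- With `q ≥ 4 k` there remains `q - q / 10 - (q + 1) / 5 = 7 q / 10 - 1 / 5 ≥ k`.
  linarith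

end Run

/-! ### Sample complexity -/

/-- There is a bracket of the order of `n k / j` arms that contains all arms or is expected to
contain `4 k` of the best `j` arms. -/
theorem exists_bracket {n k : ℕ} (hn : 1 ≤ n) (hk : 1 ≤ k) {j : Fin n} :
    ∃ r : ℕ, 1 ≤ r ∧ (2 : ℝ) ^ r ≤ 16 * ratio n k j ∧
      (bracketSize n r : ℝ) / n ≤ 8 * ((k : ℝ) / ((j : ℕ) + 1 : ℝ)) ∧
      (bracketSize n r = n ∨
        4 * (k : ℝ) ≤ ((j : ℕ) + 1 : ℝ) * ((bracketSize n r : ℝ) / n)) := by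
  have hn0 : (0 : ℝ) < n := by exact_mod_cast hn
  have hj0 : (0 : ℝ) < (j : ℕ) + 1 := by positivity
  have hk0 : (1 : ℝ) ≤ k := by exact_mod_cast hk
  have hR : ratio n k j = n * (k / ((j : ℕ) + 1 : ℝ)) := by
    unfold ratio
    rw [mul_div_assoc]
  have hjn : ((j : ℕ) + 1 : ℝ) ≤ n := by exact_mod_cast j.2
  have hR1 : 1 ≤ ratio n k j := by
    unfold ratio
    rw [le_div_iff₀ hj0]
    nlinarith
  -- If `8 * ratio` reaches `n`, all arms are taken; otherwise the size is a power of two between `4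
  -- * ratio` and `8 * ratio`.
  rcases le_or_gt (n : ℝ) (8 * ratio n k j) with h | h
  · have hlt : n < 2 ^ (Nat.log 2 n + 1) := Nat.lt_pow_succ_log_self (by norm_num) n
    have hM : bracketSize n (Nat.log 2 n + 1) = n := min_eq_left hlt.le
    have hle : (2 : ℝ) ^ Nat.log 2 n ≤ n := by
      exact_mod_cast Nat.pow_log_le_self 2 (by omega)
    refine ⟨Nat.log 2 n + 1, by omega, ?_, ?_, Or.inl hM⟩
    · rw [pow_succ]
      linarith
    · rw [hM, div_self hn0.ne']
      rw [hR] at h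
      nlinarith
  · set q := Nat.log 2 ⌊4 * ratio n k j⌋₊ with hq
    have hfl : 1 ≤ ⌊4 * ratio n k j⌋₊ := Nat.le_floor (by push_cast; linarith)
    have hgt : 4 * ratio n k j ≤ 2 ^ (q + 1) := by
      have h1 : ⌊4 * ratio n k j⌋₊ + 1 ≤ 2 ^ (q + 1) :=
        Nat.lt_pow_succ_log_self (by norm_num) _
      have h2 : ((⌊4 * ratio n k j⌋₊ : ℝ) + 1) ≤ 2 ^ (q + 1) := by exact_mod_cast h1
      linarith [Nat.lt_floor_add_one (4 * ratio n k j)]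
    have hle : (2 : ℝ) ^ (q + 1) ≤ 8 * ratio n k j := by
      have h1 : 2 ^ q ≤ ⌊4 * ratio n k j⌋₊ := Nat.pow_log_le_self 2 (by omega)
      have h2 : (2 : ℝ) ^ q ≤ 4 * ratio n k j :=
        le_trans (by exact_mod_cast h1) (Nat.floor_le (by linarith))
      rw [pow_succ]
      linarith
    have hM : bracketSize n (q + 1) = 2 ^ (q + 1) := by
      refine min_eq_right ?_
      have : (2 : ℝ) ^ (q + 1) ≤ n := by linarith
      exact_mod_cast this
    refine ⟨q + 1, by omega, by linarith, ?_, Or.inr ?_⟩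
    · rw [hM, div_le_iff₀ hn0]
      push_cast
      rw [hR] at hle
      linarith
    · rw [hM]
      push_cast
      rw [← mul_div_assoc, le_div_iff₀ hn0]
      unfold ratio at hgt
      rw [← mul_div_assoc, div_le_iff₀ hj0] at hgt
      linarith

theorem one_le_ratio {n k : ℕ} (hk : 1 ≤ k) (j : Fin n) : 1 ≤ ratio n k j := by
  have hk0 : (1 : ℝ) ≤ k := by exact_mod_cast hk
  have hjn : ((j : ℕ) + 1 : ℝ) ≤ n := by exact_mod_cast j.2
  unfold ratio
  rw [le_div_iff₀ (by positivity)]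
  nlinarith [Nat.cast_nonneg (α := ℝ) (j : ℕ)]

theorem cast_le_two_pow (r : ℕ) : (r : ℝ) ≤ 2 ^ r := by
  exact_mod_cast Nat.lt_two_pow_self.le

/-- The level of the bracket enters the gap-dependent bound through `log (n k / (j δ))`. -/
theorem exists_tlog_div_level_le : ∃ K : ℝ, 1 ≤ K ∧ ∀ (R δ z : ℝ) (M r : ℕ), 1 ≤ R → 0 < δ →
    δ ≤ 1 → 1 ≤ r → (2 : ℝ) ^ r ≤ 16 * R → 1 ≤ M → M ≤ 2 ^ r → 1 ≤ z →
      tlog (z / (1 / (M : ℝ) * bracketLevel' δ r)) ≤ K * tlog (R / δ * z) := by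
  have hL := one_le_tlog (231 * 16 ^ 5)
  refine ⟨10 * tlog (231 * 16 ^ 5), by linarith, ?_⟩
  intro R δ z M r hR hδ hδ1 hr h2r hM hM2 hz
  have hM0 : (0 : ℝ) < M := by exact_mod_cast hM
  have hM2' : (M : ℝ) ≤ 16 * R := le_trans (by exact_mod_cast hM2) h2r
  have hr16 : (r : ℝ) ≤ 16 * R := (cast_le_two_pow r).trans h2r
  have hb := bracketLevel'_pos hδ hr
  have hi := inv_bracketLevel'_le hδ hδ1 hr
  -- `M` and `r` are at most `16 R`, so `M (r ^ 2) ^ 2` has degree five in `R`. Raising `1 / δ` and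
  -- `z`, both at least one, to the same power costs only a constant after the logarithm.
  have h1 : z / (1 / (M : ℝ) * bracketLevel' δ r) ≤ 231 * 16 ^ 5 * (R / δ * z) ^ 5 := by
    have e : z / (1 / (M : ℝ) * bracketLevel' δ r) = M * (bracketLevel' δ r)⁻¹ * z := by
      field_simp
    rw [e]
    have hzp : z ≤ z ^ 5 := le_self_pow₀ hz (by norm_num)
    have hδp : (1 / δ) ^ 2 ≤ (1 / δ) ^ 5 :=
      pow_le_pow_right₀ (by rw [le_div_iff₀ hδ]; linarith) (by norm_num)
    calc M * (bracketLevel' δ r)⁻¹ * z ≤ 16 * R * (231 * (((16 * R) ^ 2) / δ) ^ 2) * z := by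
          gcongr
          refine hi.trans ?_
          gcongr
      _ = 231 * 16 ^ 5 * (R ^ 5 * (1 / δ) ^ 2 * z) := by ring
      _ ≤ 231 * 16 ^ 5 * (R ^ 5 * (1 / δ) ^ 5 * z ^ 5) := by gcongr
      _ = _ := by ring
  calc tlog (z / (1 / (M : ℝ) * bracketLevel' δ r))
      ≤ tlog (231 * 16 ^ 5 * (R / δ * z) ^ 5) := tlog_mono (by positivity) h1
    _ ≤ 2 * tlog (231 * 16 ^ 5) * tlog ((R / δ * z) ^ 5) :=
        tlog_mul_le (by norm_num) (by positivity)
    _ ≤ 2 * tlog (231 * 16 ^ 5) * ((5 : ℕ) * tlog (R / δ * z)) := by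
        gcongr
        exact tlog_pow_le (by norm_num)
    _ = _ := by push_cast; ring

/-- The level of the bracket enters the gap-independent bound through `log (n k / j)`. -/
theorem exists_tlog_div_bracketLevel'_le : ∃ K : ℝ, 1 ≤ K ∧ ∀ (R δ z : ℝ) (r : ℕ), 1 ≤ R →
    0 < δ → δ ≤ 1 → 1 ≤ r → (2 : ℝ) ^ r ≤ 16 * R → 1 ≤ z →
      tlog (z / bracketLevel' δ r) ≤ K * tlog (tlog R * z / δ) := by
  have h16 := one_le_tlog 16
  have hL := one_le_tlog (231 * (4 * tlog 16) ^ 4)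
  refine ⟨8 * tlog (231 * (4 * tlog 16) ^ 4), by linarith, ?_⟩
  intro R δ z r hR hδ hδ1 hr h2r hz
  have hlR := one_le_tlog R
  have hb := bracketLevel'_pos hδ hr
  have hi := inv_bracketLevel'_le hδ hδ1 hr
  -- Without the factor `M`, the bracket enters only through `r`, which is of order `log R` as `2 ^
  -- r ≤ 16 R`.
  have hr4 : (r : ℝ) ≤ 4 * tlog 16 * tlog R := by
    have h1 := Real.log_le_log (by positivity) h2r
    rw [Real.log_pow] at h1
    have h2 := log_le_tlog (16 * R)
    have h3 : tlog (16 * R) ≤ 2 * tlog 16 * tlog R := tlog_mul_le (by norm_num) (by linarith)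
    nlinarith [Real.log_two_gt_d9, Nat.cast_nonneg (α := ℝ) r]
  have h1 : z / bracketLevel' δ r ≤ 231 * (4 * tlog 16) ^ 4 * (tlog R * z / δ) ^ 4 := by
    have hzp : z ≤ z ^ 4 := le_self_pow₀ hz (by norm_num)
    have hδp : (1 / δ) ^ 2 ≤ (1 / δ) ^ 4 :=
      pow_le_pow_right₀ (by rw [le_div_iff₀ hδ]; linarith) (by norm_num)
    calc z / bracketLevel' δ r = (bracketLevel' δ r)⁻¹ * z := by rw [div_eq_inv_mul]
      _ ≤ 231 * ((4 * tlog 16 * tlog R) ^ 2 / δ) ^ 2 * z := by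
          gcongr
          refine hi.trans ?_
          gcongr
      _ = 231 * (4 * tlog 16) ^ 4 * (tlog R ^ 4 * (1 / δ) ^ 2 * z) := by ring
      _ ≤ 231 * (4 * tlog 16) ^ 4 * (tlog R ^ 4 * (1 / δ) ^ 4 * z ^ 4) := by gcongr
      _ = _ := by ring
  calc tlog (z / bracketLevel' δ r)
      ≤ tlog (231 * (4 * tlog 16) ^ 4 * (tlog R * z / δ) ^ 4) := tlog_mono (by positivity) h1
    _ ≤ 2 * tlog (231 * (4 * tlog 16) ^ 4) * tlog ((tlog R * z / δ) ^ 4) :=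
        tlog_mul_le (by positivity) (by positivity)
    _ ≤ 2 * tlog (231 * (4 * tlog 16) ^ 4) * ((4 : ℕ) * tlog (tlog R * z / δ)) := by
        gcongr
        exact tlog_pow_le (by norm_num)
    _ = _ := by push_cast; ring

theorem lt_mean_of_lt_card {n : ℕ} {ν : Fin n → Measure ℝ} {μ₀ : ℝ} (hanti : Antitone (mean ν))
    {j : Fin n} (hj : (j : ℕ) + 1 ≤ (H₁ ν μ₀).card) : μ₀ < mean ν j := by
  by_contra hle
  have hsub : H₁ ν μ₀ ⊆ Finset.Iio j := by
    intro i hi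
    simp only [H₁, Finset.mem_filter, Finset.mem_univ, true_and] at hi
    rw [Finset.mem_Iio]
    by_contra hji
    linarith [hanti (not_lt.1 hji), not_lt.1 hle]
  have := Finset.card_le_card hsub
  rw [Fin.card_Iio] at this
  omega

theorem Iic_subset_H₁ {n : ℕ} {ν : Fin n → Measure ℝ} {μ₀ : ℝ} (hanti : Antitone (mean ν))
    {j : Fin n} (hj : μ₀ < mean ν j) : Finset.Iic j ⊆ H₁ ν μ₀ := by
  intro i hi
  simp only [H₁, Finset.mem_filter, Finset.mem_univ, true_and]
  exact hj.trans_le (hanti (Finset.mem_Iic.1 hi))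

theorem sum_H₁_add_sum_H₀ {n : ℕ} (ν : Fin n → Measure ℝ) (μ₀ : ℝ) (f : Fin n → ℝ) :
    ∑ i ∈ H₁ ν μ₀, f i + ∑ i ∈ H₀ ν μ₀, f i = ∑ i, f i := by
  classical
  rw [← Finset.sum_filter_add_sum_filter_not Finset.univ (fun i => μ₀ < mean ν i) f]
  unfold H₁ H₀
  congr 2
  ext i
  simp

/-! ### Ranges of the gaps and lower bounds for the complexities -/

section Complexity

variable {n k : ℕ} {ν : Fin n → Measure ℝ} {δ μ₀ : ℝ} {j : Fin n}

theorem one_le_inv_sq {g : ℝ} (hg : 0 < g) (hg1 : g ≤ 1) : 1 ≤ (g ^ 2)⁻¹ :=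
  (one_le_inv₀ (by positivity)).2 (by nlinarith)

theorem gap₀_mem (hmean : ∀ i, mean ν i ∈ Set.Icc (0 : ℝ) 1) (hμ₀ : μ₀ ∈ Set.Icc (0 : ℝ) 1)
    (hj : μ₀ < mean ν j) : 0 < gap₀ ν μ₀ j ∧ gap₀ ν μ₀ j ≤ 1 :=
  ⟨by unfold gap₀; linarith, by unfold gap₀; linarith [(hmean j).2, hμ₀.1]⟩

theorem gapMax_mem (hmean : ∀ i, mean ν i ∈ Set.Icc (0 : ℝ) 1) (hμ₀ : μ₀ ∈ Set.Icc (0 : ℝ) 1)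
    (hj : μ₀ < mean ν j) (i : Fin n) : 0 < gapMax ν μ₀ i j ∧ gapMax ν μ₀ i j ≤ 1 :=
  ⟨lt_max_of_lt_right (gap₀_mem hmean hμ₀ hj).1,
    max_le (by unfold gap₀; linarith [(hmean i).2, hμ₀.1]) (gap₀_mem hmean hμ₀ hj).2⟩

theorem gap_mem (hmean : ∀ i, mean ν i ∈ Set.Icc (0 : ℝ) 1) (hj : μ₀ < mean ν j) {i : Fin n}
    (hi : mean ν i ≤ μ₀) : 0 < gap ν j i ∧ gap ν j i ≤ 1 :=
  ⟨by unfold gap; linarith, by unfold gap; linarith [(hmean j).2, (hmean i).1]⟩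

/-- Each of the `n` summands is at least one, as all gaps lie in `(0, 1]`. The complexity thus also
covers the opening of a bracket of order `n k / j` arms. -/
theorem ratio_le_HFDR (hmean : ∀ i, mean ν i ∈ Set.Icc (0 : ℝ) 1) (hμ₀ : μ₀ ∈ Set.Icc (0 : ℝ) 1)
    (hj : μ₀ < mean ν j) : ratio n k j ≤ HFDR ν μ₀ δ k j := by
  have h1 : ∀ i, 1 ≤ (gapMax ν μ₀ i j ^ 2)⁻¹ *
      tlog (ratio n k j / δ * tlog ((gapMax ν μ₀ i j ^ 2)⁻¹)) := fun i =>
    one_le_mul_of_one_le_of_one_le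
      (one_le_inv_sq (gapMax_mem hmean hμ₀ hj i).1 (gapMax_mem hmean hμ₀ hj i).2) (one_le_tlog _)
  have h0 : ∀ i ∈ H₀ ν μ₀, 1 ≤ (gap ν j i ^ 2)⁻¹ * tlog (tlog ((gap ν j i ^ 2)⁻¹) / δ) := by
    intro i hi
    have hi' : mean ν i ≤ μ₀ := by simpa [H₀] using hi
    exact one_le_mul_of_one_le_of_one_le
      (one_le_inv_sq (gap_mem hmean hj hi').1 (gap_mem hmean hj hi').2) (one_le_tlog _)
  have hsum := sum_H₁_add_sum_H₀ ν μ₀ fun _ => 1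
  simp only [Finset.sum_const, Finset.card_univ, Fintype.card_fin, nsmul_eq_mul, mul_one] at hsum
  have h2 := Finset.card_nsmul_le_sum (H₁ ν μ₀) _ 1 fun i _ => h1 i
  have h3 := Finset.card_nsmul_le_sum (H₀ ν μ₀) _ 1 h0
  rw [nsmul_eq_mul, mul_one] at h2 h3
  unfold HFDR
  calc ratio n k j = (k : ℝ) / ((j : ℕ) + 1 : ℝ) * n := by unfold ratio; ring
    _ ≤ _ := mul_le_mul_of_nonneg_left (by linarith) (by positivity)

theorem ratio_le_HFDR' (hk : 1 ≤ k) (hmean : ∀ i, mean ν i ∈ Set.Icc (0 : ℝ) 1)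
    (hμ₀ : μ₀ ∈ Set.Icc (0 : ℝ) 1) (hj : μ₀ < mean ν j) :
    ratio n k j ≤ HFDR' ν μ₀ δ k j := by
  obtain ⟨h1, h2⟩ := gap₀_mem hmean hμ₀ hj
  have h3 := one_le_ratio hk j
  unfold HFDR'
  rw [mul_assoc]
  exact le_mul_of_one_le_right (by linarith)
    (one_le_mul_of_one_le_of_one_le (one_le_inv_sq h1 h2) (one_le_tlog _))

end Complexity

namespace Run

variable {n : ℕ} {ν : Fin n → Measure ℝ} {c δ μ₀ : ℝ} {Ω : Type*} [MeasurableSpace Ω]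
  {P : Measure Ω}

/-- If the total cost of a suitable bracket is of the order `H`, then enough good arms are found
within a time of the order `H log H`. -/
theorem exists_time_of_cost.{u} {K : ℝ} (hK : 1 ≤ K) : ∃ C : ℝ, 0 < C ∧ ∀ {n : ℕ}
    {ν : Fin n → Measure ℝ} {c δ μ₀ : ℝ} {Ω : Type u} [MeasurableSpace Ω] {P : Measure Ω}
    [IsProbabilityMeasure P] (ρ : Run ν c δ μ₀ P)
    (_ : ∀ i, HasSubgaussianMGF (fun y : ℝ => y - mean ν i) 1 (ν i)) (_ : 4 ≤ c)
    (_ : 0 < δ) (_ : δ ≤ 0.025) {r k : ℕ} {j : Fin n} (_ : 1 ≤ r) (_ : 1 ≤ k)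
    (_ : k ≤ (j : ℕ) + 1) (_ : Finset.Iic j ⊆ H₁ ν μ₀) (_ : (2 : ℝ) ^ r ≤ 16 * ratio n k j)
    (_ : (bracketSize n r : ℝ) / n ≤ 8 * ((k : ℝ) / ((j : ℕ) + 1 : ℝ)))
    (_ : bracketSize n r = n ∨
        4 * (k : ℝ) ≤ ((j : ℕ) + 1 : ℝ) * ((bracketSize n r : ℝ) / n))
    {w κ : Fin n → ℝ} (_ : ∀ i, 0 < κ i) (_ : ∀ i, κ i ≤ w i)
    (_ : ∀ t, ρ.CostBound r t (visits r t) (Finset.Iic j) w κ) {H : ℝ}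
    (_ : ratio n k j ≤ H) (_ : (k : ℝ) / ((j : ℕ) + 1 : ℝ) * ∑ i, w i ≤ K * H),
      ∃ t : ℕ, (t : ℝ) ≤ C * (H * tlog H) ∧
        (1 - δ) * k ≤ ∫ ω, ((ρ.S t ω ∩ H₁ ν μ₀).card : ℝ) ∂P := by
  -- `81 = 10 * 8 + 1`: ten times the expected deterministic cost is required, the inclusion
  -- probability is at most `8 k / j`, and rounding up adds one visit.
  obtain ⟨C, hC, hvis⟩ := exists_le_visits (show 1 ≤ 81 * K by linarith)
  refine ⟨C, hC, ?_⟩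
  intro n ν c δ μ₀ Ω _ P _ ρ hν hc hδ hδ1 r k j hr hk hkj hJ h2r hθ hor w κ hκ hκw hcost H hRH hW
  have hR1 := one_le_ratio hk j
  have hn : 1 ≤ n := Fin.pos j
  have hH1 : 1 ≤ H := hR1.trans hRH
  have hw : ∀ i, 0 < w i := fun i => (hκ i).trans_le (hκw i)
  have hW0 : 0 ≤ ∑ i, w i := Finset.sum_nonneg fun i _ => (hw i).le
  set θ := (bracketSize n r : ℝ) / n with hθdef
  have hNle : (⌈10 * (θ * ∑ i, w i)⌉₊ : ℝ) ≤ 81 * K * H := by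
    have h1 : θ * ∑ i, w i ≤ 8 * ((k : ℝ) / ((j : ℕ) + 1 : ℝ)) * ∑ i, w i := by gcongr
    have h2 := Nat.ceil_lt_add_one (show 0 ≤ 10 * (θ * ∑ i, w i) by positivity)
    nlinarith
  obtain ⟨t, ht, hN⟩ := hvis H r ⌈10 * (θ * ∑ i, w i)⌉₊ hH1 hr (by nlinarith) hNle
  refine ⟨t, ht, ?_⟩
  have hN' : 10 * (θ * ∑ i, w i) ≤ visits r t :=
    (Nat.le_ceil _).trans (by exact_mod_cast hN)
  have hcard : (Finset.Iic j).card = (j : ℕ) + 1 := Fin.card_Iic j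
  have hk0 : (0 : ℝ) ≤ k := Nat.cast_nonneg k
  rcases hor with hfull | hpart
  · have hn0 : (0 : ℝ) < n := by exact_mod_cast hn
    have h1 : θ = 1 := by rw [hθdef, hfull, div_self hn0.ne']
    rw [h1, one_mul] at hN'
    refine le_trans ?_ (ρ.le_integral_card_inter_full hν hc hδ hδ1 hn hr hfull hJ hκ hκw
      (hcost t) (by linarith))
    refine mul_le_mul_of_nonneg_left ?_ (by linarith)
    rw [hcard]
    exact_mod_cast hkj
  · refine le_trans ?_ (ρ.le_integral_card_inter_partial hν hc hδ hδ1 hn hr hk hJ hκ hκw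
      (hcost t) ?_ hN')
    · nlinarith
    · rw [hcard]
      push_cast
      exact hpart

/-- Gap-dependent sample complexity. -/
theorem exists_time_HFDR.{u} {c : ℝ} (hc : 4 ≤ c) : ∃ C : ℝ, 0 < C ∧ ∀ {n : ℕ}
    {ν : Fin n → Measure ℝ} {δ μ₀ : ℝ} {Ω : Type u} [MeasurableSpace Ω] {P : Measure Ω}
    [IsProbabilityMeasure P] (ρ : Run ν c δ μ₀ P)
    (_ : ∀ i, HasSubgaussianMGF (fun y : ℝ => y - mean ν i) 1 (ν i))
    (_ : ∀ i, mean ν i ∈ Set.Icc (0 : ℝ) 1) (_ : Antitone (mean ν))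
    (_ : μ₀ ∈ Set.Icc (0 : ℝ) 1) (_ : 0 < δ) (_ : δ ≤ 0.025) {k : ℕ} {j : Fin n} (_ : 1 ≤ k)
    (_ : k ≤ (j : ℕ) + 1) (_ : μ₀ < mean ν j),
      ∃ t : ℕ, (t : ℝ) ≤ C * (HFDR ν μ₀ δ k j * tlog (HFDR ν μ₀ δ k j)) ∧
        (1 - δ) * k ≤ ∫ ω, ((ρ.S t ω ∩ H₁ ν μ₀).card : ℝ) ∂P := by
  classical
  obtain ⟨K, hK⟩ := exists_le_of_le_four_mul_width (show 1 ≤ c by linarith)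
  have hinv : InvertsWidth c K := hK
  obtain ⟨L, hL, hlev⟩ := exists_tlog_div_level_le
  have hK1 := hK.1
  obtain ⟨C, hC, htime⟩ := exists_time_of_cost.{u} (show 1 ≤ 2 * K * L by nlinarith)
  refine ⟨C, hC, ?_⟩
  intro n ν δ μ₀ Ω _ P _ ρ hν hmean hanti hμ₀ hδ hδ1 k j hk hkj hj
  have hn : 1 ≤ n := Fin.pos j
  obtain ⟨r, hr, h2r, hθ, hor⟩ := exists_bracket hn hk (j := j)
  set M := bracketSize n r with hM
  have hM1 : 1 ≤ M := one_le_bracketSize hn r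
  -- `G i` is the inverse squared gap that governs arm `i`, and `Z i` its logarithmic factor: at the
  -- level of a single acceptance (`p = 1`) above the threshold, at level `δ` below it. The factor
  -- two in the cost `2 * (K * G i) * Z i` absorbs one extra pull.
  set G : Fin n → ℝ := fun i =>
    if μ₀ < mean ν i then (gapMax ν μ₀ i j ^ 2)⁻¹ else (gap ν j i ^ 2)⁻¹ with hG
  set Z : Fin n → ℝ := fun i => if μ₀ < mean ν i then
    tlog (tlog (G i) / (1 / (M : ℝ) * bracketLevel' δ r)) else tlog (tlog (G i) / δ) with hZ
  have hG1 : ∀ i, 1 ≤ G i := by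
    intro i
    simp only [hG]
    split_ifs with hi
    · exact one_le_inv_sq (gapMax_mem hmean hμ₀ hj i).1 (gapMax_mem hmean hμ₀ hj i).2
    · have := gap_mem hmean hj (not_lt.1 hi)
      exact one_le_inv_sq this.1 this.2
  have hZ1 : ∀ i, 1 ≤ Z i := by
    intro i
    simp only [hZ]
    split_ifs <;> exact one_le_tlog _
  have hKG : ∀ i, 1 ≤ K * G i := fun i => one_le_mul_of_one_le_of_one_le hK1 (hG1 i)
  have hw1 : ∀ i, 1 + K * G i * Z i ≤ 2 * (K * G i) * Z i := fun i => by
    nlinarith [one_le_mul_of_one_le_of_one_le (hKG i) (hZ1 i)]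
  refine htime ρ hν hc hδ hδ1 hr hk hkj (Iic_subset_H₁ hanti hj) h2r hθ hor
    (w := fun i => 2 * (K * G i) * Z i) (κ := fun i => K * G i)
    (fun i => by linarith [hKG i]) (fun i => by nlinarith [hKG i, hZ1 i]) ?_
    (ratio_le_HFDR hmean hμ₀ hj) ?_
  · intro t ω hcard d hd i₀ hi₀ hi₀J hgood hS
    refine visits_le_gap (m := mean ν) (b := mean ν j) hinv (by linarith) hδ hr (ρ.rule ω) hi₀ hS hj
      (hanti (Finset.mem_Iic.1 hi₀J)) hgood hd (fun i _ hi => ⟨?_, ?_⟩) fun i _ hi => ⟨?_, ?_⟩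
    · simp only [hG, if_pos hi]
      rfl
    · have h := hw1 i
      simp only [hZ, hG, if_pos hi] at h ⊢
      rw [hcard]
      exact h
    · simp only [hG, if_neg (not_lt.2 hi)]
      rfl
    · have h := hw1 i
      simp only [hZ, hG, if_neg (not_lt.2 hi)] at h ⊢
      exact h
  · unfold HFDR
    rw [← sum_H₁_add_sum_H₀ ν μ₀]
    have hM2 : M ≤ 2 ^ r := min_le_right _ _
    have hbound1 : ∑ i ∈ H₁ ν μ₀, 2 * (K * G i) * Z i ≤ 2 * K * L * ∑ i ∈ H₁ ν μ₀,
        (gapMax ν μ₀ i j ^ 2)⁻¹ * tlog (ratio n k j / δ * tlog ((gapMax ν μ₀ i j ^ 2)⁻¹)) := by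
      rw [Finset.mul_sum]
      refine Finset.sum_le_sum fun i hi => ?_
      have hi' : μ₀ < mean ν i := by simpa [H₁] using hi
      have h1 := hlev (ratio n k j) δ (tlog (G i)) M r (one_le_ratio hk j) hδ (by linarith) hr h2r
        hM1 hM2 (one_le_tlog _)
      have h2 := mul_le_mul_of_nonneg_left h1 (show 0 ≤ 2 * (K * G i) by linarith [hKG i])
      simp only [hZ, hG, if_pos hi'] at h2 ⊢
      refine h2.trans (le_of_eq ?_)
      ring
    have hbound0 : ∑ i ∈ H₀ ν μ₀, 2 * (K * G i) * Z i ≤ 2 * K * L * ∑ i ∈ H₀ ν μ₀,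
        (gap ν j i ^ 2)⁻¹ * tlog (tlog ((gap ν j i ^ 2)⁻¹) / δ) := by
      rw [Finset.mul_sum]
      refine Finset.sum_le_sum fun i hi => ?_
      have hi' : ¬ μ₀ < mean ν i := by simpa [H₀] using hi
      have h1 : 2 * (K * G i) * Z i ≤ 2 * K * L * (G i * Z i) := by
        have h3 : 0 ≤ K * G i * Z i := mul_nonneg (by linarith [hKG i]) (by linarith [hZ1 i])
        nlinarith
      simp only [hZ, hG, if_neg hi'] at h1 ⊢
      exact h1
    rw [mul_left_comm]
    refine mul_le_mul_of_nonneg_left ?_ (by positivity)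
    linarith

/-- Gap-independent sample complexity. -/
theorem exists_time_HFDR'.{u} {c : ℝ} (hc : 4 ≤ c) : ∃ C : ℝ, 0 < C ∧ ∀ {n : ℕ}
    {ν : Fin n → Measure ℝ} {δ μ₀ : ℝ} {Ω : Type u} [MeasurableSpace Ω] {P : Measure Ω}
    [IsProbabilityMeasure P] (ρ : Run ν c δ μ₀ P)
    (_ : ∀ i, HasSubgaussianMGF (fun y : ℝ => y - mean ν i) 1 (ν i))
    (_ : ∀ i, mean ν i ∈ Set.Icc (0 : ℝ) 1) (_ : Antitone (mean ν))
    (_ : μ₀ ∈ Set.Icc (0 : ℝ) 1) (_ : 0 < δ) (_ : δ ≤ 0.025) {k : ℕ} {j : Fin n} (_ : 1 ≤ k)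
    (_ : k ≤ (j : ℕ) + 1) (_ : μ₀ < mean ν j),
      ∃ t : ℕ, (t : ℝ) ≤ C * (HFDR' ν μ₀ δ k j * tlog (HFDR' ν μ₀ δ k j)) ∧
        (1 - δ) * k ≤ ∫ ω, ((ρ.S t ω ∩ H₁ ν μ₀).card : ℝ) ∂P := by
  obtain ⟨K, hK⟩ := exists_le_of_le_four_mul_width (show 1 ≤ c by linarith)
  have hinv : InvertsWidth c K := hK
  obtain ⟨L, hL, hlev⟩ := exists_tlog_div_bracketLevel'_le
  have hK1 := hK.1
  obtain ⟨C, hC, htime⟩ := exists_time_of_cost.{u} (show 1 ≤ 4 * K * L by nlinarith)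
  refine ⟨C, hC, ?_⟩
  intro n ν δ μ₀ Ω _ P _ ρ hν hmean hanti hμ₀ hδ hδ1 k j hk hkj hj
  have hn : 1 ≤ n := Fin.pos j
  obtain ⟨r, hr, h2r, hθ, hor⟩ := exists_bracket hn hk (j := j)
  obtain ⟨hg, hg1⟩ := gap₀_mem hmean hμ₀ hj
  set G := (gap₀ ν μ₀ j ^ 2)⁻¹ with hG
  have hG1 : 1 ≤ G := one_le_inv_sq hg hg1
  have hKG : 1 ≤ K * G := one_le_mul_of_one_le_of_one_le hK1 hG1
  set Z := tlog (tlog G / bracketLevel' δ r) with hZ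
  have hZ1 : 1 ≤ Z := one_le_tlog _
  have hR1 := one_le_ratio hk j
  refine htime ρ hν hc hδ hδ1 hr hk hkj (Iic_subset_H₁ hanti hj) h2r hθ hor
    (w := fun _ => 4 * (K * G) * Z) (κ := fun _ => K * G)
    (fun i => by linarith) (fun i => by nlinarith) ?_
    (ratio_le_HFDR' hk hmean hμ₀ hj) ?_
  · intro t ω hcard d hd i₀ hi₀ hi₀J hgood hS
    refine visits_le_uniform (m := mean ν) hinv (by linarith) hδ hr (ρ.rule ω) hi₀ hS hg hg1 ?_
      hgood hd
    have := hanti (Finset.mem_Iic.1 hi₀J)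
    unfold gap₀
    linarith
  · have h1 := hlev (ratio n k j) δ (tlog G) r hR1 hδ (by linarith) hr h2r (one_le_tlog _)
    have h2 := mul_le_mul_of_nonneg_left h1
      (show 0 ≤ ratio n k j * (4 * (K * G)) from mul_nonneg (by linarith) (by linarith))
    unfold HFDR'
    simp only [Finset.sum_const, Finset.card_univ, Fintype.card_fin, nsmul_eq_mul]
    rw [← hG]
    calc _ = ratio n k j * (4 * (K * G)) * Z := by unfold ratio; ring
      _ ≤ _ := h2
      _ = _ := by ring

theorem integral_card_inter_mono [IsProbabilityMeasure P] (ρ : Run ν c δ μ₀ P)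
    {H : Finset (Fin n)} {t : ℕ} {σ : Ω → ℕ} (hσ : Measurable σ) (h : ∀ᵐ ω ∂P, t ≤ σ ω) :
    ∫ ω, ((ρ.S t ω ∩ H).card : ℝ) ∂P ≤ ∫ ω, ((ρ.S (σ ω) ω ∩ H).card : ℝ) ∂P := by
  have hbound : ∀ B : Finset (Fin n), ‖((B ∩ H).card : ℝ)‖ ≤ n := by
    intro B
    rw [Real.norm_natCast]
    exact_mod_cast (Finset.card_le_univ _).trans (Fintype.card_fin n).le
  have hm : ∀ {S : Ω → Finset (Fin n)}, Measurable S →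
      Integrable (fun ω => ((S ω ∩ H).card : ℝ)) P := by
    intro S hS
    refine Integrable.of_bound (C := n) ?_ (ae_of_all _ fun ω => hbound (S ω))
    exact ((measurable_of_countable fun B : Finset (Fin n) => ((B ∩ H).card : ℝ)).comp
      hS).aestronglyMeasurable
  have hSσ : Measurable fun ω => ρ.S (σ ω) ω := by
    have h2 : Measurable fun p : ℕ × Ω => ρ.S p.1 p.2 :=
      measurable_from_prod_countable_right fun s => ρ.measurable_S s
    exact h2.comp (hσ.prodMk measurable_id)
  refine integral_mono_ae (hm (ρ.measurable_S t)) (hm hSσ) ?_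
  filter_upwards [h] with ω hω
  have := Finset.card_le_card (Finset.inter_subset_inter_right (u := H)
    (suggested_mono (c := c) (δ := δ) (μ₀ := μ₀) (x := fun i r s => ρ.X i r s ω)
      (A := fun r => ρ.A r ω) (a := fun t => ρ.I t ω) hω))
  exact_mod_cast this

end Run

end InfiniteUCB

/-! ### The least sufficient time as stopping time -/

theorem theorem3 :
    ∃ c₀ : ℝ, 0 < c₀ ∧ ∀ c : ℝ, c₀ ≤ c → ∃ C : ℝ, 0 < C ∧
      ∀ (n : ℕ) (ν : Fin n → Measure ℝ) (δ μ₀ : ℝ),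
        (∀ i, IsProbabilityMeasure (ν i)) →
        (∀ i, HasSubgaussianMGF (fun y : ℝ => y - InfiniteUCB.mean ν i) 1 (ν i)) →
        (∀ i, InfiniteUCB.mean ν i ∈ Set.Icc (0 : ℝ) 1) →
        Antitone (InfiniteUCB.mean ν) →
        μ₀ ∈ Set.Icc (0 : ℝ) 1 →
        0 < δ → δ ≤ 0.025 →
        ∀ (Ω : Type*) [MeasurableSpace Ω] (P : Measure Ω) [IsProbabilityMeasure P]
          (ρ : InfiniteUCB.Run ν c δ μ₀ P),
          -- false discovery rate
          (∀ t : ℕ,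
            ∫ ω, ((ρ.S t ω ∩ InfiniteUCB.H₀ ν μ₀).card : ℝ) / (max (ρ.S t ω).card 1 : ℕ) ∂P
              ≤ 2 * δ) ∧
          ∀ k : ℕ, 1 ≤ k → k ≤ (InfiniteUCB.H₁ ν μ₀).card →
            ∃ τ : Ω → WithTop ℕ, IsStoppingTime ρ.filtration τ ∧
              -- gap-dependent bound: at most the minimum over the arms number `k, …, m`
              (∀ j : Fin n, k ≤ (j : ℕ) + 1 → (j : ℕ) + 1 ≤ (InfiniteUCB.H₁ ν μ₀).card →
                ∫⁻ ω, ENat.toENNReal (τ ω) ∂P ≤ ENNReal.ofReal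
                  (C * (InfiniteUCB.HFDR ν μ₀ δ k j *
                    InfiniteUCB.tlog (InfiniteUCB.HFDR ν μ₀ δ k j +
                      (InfiniteUCB.gap₀ ν μ₀ j ^ 2)⁻¹)))) ∧
              -- gap-independent bound: at most the minimum over the arms number `k, …, m`
              (∀ j : Fin n, k ≤ (j : ℕ) + 1 → (j : ℕ) + 1 ≤ (InfiniteUCB.H₁ ν μ₀).card →
                ∫⁻ ω, ENat.toENNReal (τ ω) ∂P ≤ ENNReal.ofReal
                  (C * (InfiniteUCB.HFDR' ν μ₀ δ k j *
                    InfiniteUCB.tlog (InfiniteUCB.HFDR' ν μ₀ δ k j)))) ∧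
              -- true positive rate at every random time `σ ≥ τ`
              (∀ σ : Ω → ℕ, Measurable σ → (∀ᵐ ω ∂P, τ ω ≤ (σ ω : WithTop ℕ)) →
                (1 - δ) * (k : ℝ) ≤
                  ∫ ω, ((ρ.S (σ ω) ω ∩ InfiniteUCB.H₁ ν μ₀).card : ℝ) ∂P) ∧
              -- true positive rate at every fixed time `t`, given that `τ ≤ t`
              (∀ t : ℕ,
                (1 - δ) * (k : ℝ) * P.real {ω | τ ω ≤ (t : WithTop ℕ)} ≤
                  ∫ ω in {ω | τ ω ≤ (t : WithTop ℕ)},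
                    ((ρ.S t ω ∩ InfiniteUCB.H₁ ν μ₀).card : ℝ) ∂P) := by
  refine ⟨4, by norm_num, fun c hc => ?_⟩
  obtain ⟨C₁, hC₁, h₁⟩ := InfiniteUCB.Run.exists_time_HFDR hc
  obtain ⟨C₂, hC₂, h₂⟩ := InfiniteUCB.Run.exists_time_HFDR' hc
  refine ⟨max C₁ C₂, lt_max_of_lt_left hC₁, ?_⟩
  intro n ν δ μ₀ _ hν hmean hanti hμ₀ hδ hδ1 Ω _ P _ ρ
  refine ⟨ρ.fdr_le hν hc hδ hδ1, fun k hk hkm => ?_⟩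
  classical
  -- A deterministic time suffices: both complexities bound the least time at which the expected
  -- number of true discoveries is at least `(1 - δ) k`.
  have hex : ∃ t : ℕ, (1 - δ) * k ≤
      ∫ ω, ((ρ.S t ω ∩ InfiniteUCB.H₁ ν μ₀).card : ℝ) ∂P := by
    have hmn : (InfiniteUCB.H₁ ν μ₀).card ≤ n :=
      (Finset.card_le_univ _).trans (Fintype.card_fin n).le
    -- The arm number `k` has index `k - 1` and lies above the threshold as `k ≤ m`, so it is always
    -- an admissible `j`.
    obtain ⟨t, -, ht⟩ := h₁ ρ hν hmean hanti hμ₀ hδ hδ1 (j := ⟨k - 1, by omega⟩) hk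
      (by simp only; omega) (InfiniteUCB.lt_mean_of_lt_card hanti (by simp only; omega))
    exact ⟨t, ht⟩
  set t₀ := Nat.find hex with ht₀
  have hspec := Nat.find_spec hex
  have hlint : ∀ b : ℝ, (t₀ : ℝ) ≤ b →
      ∫⁻ _, ENat.toENNReal ((t₀ : ℕ) : WithTop ℕ) ∂P ≤ ENNReal.ofReal b := by
    intro b hb
    rw [lintegral_const, measure_univ, mul_one]
    refine le_trans (le_of_eq ?_) (ENNReal.ofReal_le_ofReal hb)
    rw [ENNReal.ofReal_natCast]
    rfl
  refine ⟨fun _ => (t₀ : WithTop ℕ), isStoppingTime_const _ _, fun j hkj hjm => ?_,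
    fun j hkj hjm => ?_, fun σ hσ hσt => ?_, fun t => ?_⟩
  · have hj := InfiniteUCB.lt_mean_of_lt_card hanti hjm
    obtain ⟨t, ht, ht'⟩ := h₁ ρ hν hmean hanti hμ₀ hδ hδ1 hk hkj hj
    refine hlint _ ?_
    have hle : (t₀ : ℝ) ≤ t := by exact_mod_cast Nat.find_min' hex ht'
    have hR := (InfiniteUCB.one_le_ratio hk j).trans
      (InfiniteUCB.ratio_le_HFDR (δ := δ) hmean hμ₀ hj)
    -- The bound holds without `Δ_{j,0}⁻²` inside the logarithm; adding it only enlarges the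
    -- right-hand side.
    have hlog : InfiniteUCB.tlog (InfiniteUCB.HFDR ν μ₀ δ k j) ≤ InfiniteUCB.tlog
        (InfiniteUCB.HFDR ν μ₀ δ k j + (InfiniteUCB.gap₀ ν μ₀ j ^ 2)⁻¹) :=
      InfiniteUCB.tlog_mono (by linarith) (le_add_of_nonneg_right (by positivity))
    have hpos := InfiniteUCB.tlog_pos (InfiniteUCB.HFDR ν μ₀ δ k j)
    refine hle.trans (ht.trans (mul_le_mul (le_max_left _ _)
      (mul_le_mul_of_nonneg_left hlog (by linarith)) (mul_nonneg (by linarith) hpos.le)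
      (hC₁.le.trans (le_max_left _ _))))
  · have hj := InfiniteUCB.lt_mean_of_lt_card hanti hjm
    obtain ⟨t, ht, ht'⟩ := h₂ ρ hν hmean hanti hμ₀ hδ hδ1 hk hkj hj
    refine hlint _ ?_
    have hle : (t₀ : ℝ) ≤ t := by exact_mod_cast Nat.find_min' hex ht'
    have hR := (InfiniteUCB.one_le_ratio hk j).trans
      (InfiniteUCB.ratio_le_HFDR' (δ := δ) hk hmean hμ₀ hj)
    have hpos := InfiniteUCB.tlog_pos (InfiniteUCB.HFDR' ν μ₀ δ k j)
    exact hle.trans (ht.trans (mul_le_mul_of_nonneg_right (le_max_right _ _)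
      (mul_nonneg (by linarith) hpos.le)))
  · refine hspec.trans (ρ.integral_card_inter_mono hσ ?_)
    filter_upwards [hσt] with ω hω
    exact WithTop.coe_le_coe.1 hω
  -- The stopping time is constant, so the event is everything or empty; in the latter case both
  -- sides vanish.
  · by_cases ht : t₀ ≤ t
    · have e : {ω : Ω | (t₀ : WithTop ℕ) ≤ (t : WithTop ℕ)} = Set.univ :=
        Set.eq_univ_of_forall fun _ => WithTop.coe_le_coe.2 ht
      rw [e, probReal_univ, mul_one, Measure.restrict_univ]
      exact hspec.trans (ρ.integral_card_inter_mono measurable_const (ae_of_all _ fun _ => ht))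
    · have e : {ω : Ω | (t₀ : WithTop ℕ) ≤ (t : WithTop ℕ)} = ∅ :=
        Set.eq_empty_of_forall_notMem fun _ h => ht (WithTop.coe_le_coe.1 h)
      rw [e]
      simp
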